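/- Let $F$ be a field of characteristic $0$ and let $q,s\in F$ be algebraically independent over $\mathbb{Q}$ (for example $F=\mathbb{K}=\mathbb{Q}(q,s)$ or $F=\overline{\mathbb{K}}$). Put $[n]_q=\frac{q^n-q^{-n}}{q-q^{-1}}$, $[n]_q!=[1]_q\cdots[n]_q$ and ${n\brack k}_q=\frac{[n]_q!}{[k]_q!\,[n-k]_q!}$. Let $\mathbf V$ be the $F$-vector space with basis $v_0,v_1,v_2,\dots$, with the operators $Kv_j=sq^{-2j}v_j$ and $Ev_j=v_{j-1}$ (where $v_{-1}=0$); $K$ and $E$ act on tensor powers of $\mathbf V$ through $\Delta(K)=K\otimes K$ and $\Delta(E)=E\otimes K+1\otimes E$. Let $R\in\mathrm{End}(\mathbf V\otimes\mathbf V)$ be $$R(v_i\otimes v_j)=s^{-i-j}\sum_{n=0}^{i}q^{2(i-n)(j+n)+\frac{n(n-1)}2}{n+j\brack j}_q\prod_{k=0}^{n-1}\left(sq^{-k-j}-s^{-1}q^{k+j}\right)v_{j+n}\otimes v_{i-n}.$$ For $\ell\ge 0$ let $\mathbf V_{4,\ell}\subset\mathbf V^{\otimes4}$ be the span of the pure tensors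 $v_a\otimes v_b\otimes v_c\otimes v_d$ with $a+b+c+d=\ell$, and let $\mathbf W_{4,\ell}=\ker(E)\cap\mathbf V_{4,\ell}$. Matrices of endomorphisms of $\mathbf V_{4,\ell}$, and their transposes, are taken in the basis of pure tensors. For a vector space $M$, $\mathrm{PSL}(M)$ is $\mathrm{SL}(M)$ modulo its center, and $\mathrm{GL}(M)$ acts on $\mathrm{PSL}(M)$ by conjugation. The braid group $B_4=\langle\sigma_1,\sigma_2,\sigma_3\mid\sigma_1\sigma_2\sigma_1=\sigma_2\sigma_1\sigma_2,\ \sigma_2\sigma_3\sigma_2=\sigma_3\sigma_2\sigma_3,\ \sigma_1\sigma_3=\sigma_3\sigma_1\rangle$ acts linearly on $\mathbf V_{4,\ell}$, with $\sigma_1,\sigma_2,\sigma_3$ acting as the restrictions of $R\otimes1\otimes1$, $1\otimes R\otimes1$, $1\otimes1\otimes R$. The subspace $\mathbf W_{4,\ell}$ is preserved, and the center $Z(B_4)$ acts on it by scalars. Moreover: 1. There is an invertible matrix $J$ over $F$ such that $J\sigma_i^TJ^{-1}=\sigma_i$ on $\mathbf V_{4,\ell}$ for $i=1,2,3$; if $F$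 is algebraically closed, $J$ can be taken of determinant $1$, so that it defines an element of $\mathrm{PSL}(\mathbf V_{4,\ell})$. For such a $J$, fixed from now on, the following hold. 2. The automorphism $\varphi(A)=J(A^T)^{-1}J^{-1}$ of $\mathrm{GL}(\mathbf V_{4,\ell})$ satisfies $\varphi(\sigma_i)=\sigma_i^{-1}$, and the automorphism of $\mathrm{PSL}(\mathbf V_{4,\ell})$ that it induces satisfies $\varphi\sigma_i\varphi^{-1}=\sigma_i^{-1}$ in $\mathrm{Aut}(\mathrm{PSL}(\mathbf V_{4,\ell}))$, where $\sigma_i$ acts by conjugation. 3. $\varphi$ preserves $\mathrm{PSL}(\mathbf W_{4,\ell})$ in the following sense. There are a $B_4$-invariant complement $C$ of $\mathbf W_{4,\ell}$ in $\mathbf V_{4,\ell}$ and an automorphism $\psi$ of $\mathrm{PSL}(\mathbf W_{4,\ell})$ such that, whenever $g\in\mathrm{GL}(\mathbf V_{4,\ell})$ preserves $\mathbf W_{4,\ell}$ and $C$ and $A=g|_{\mathbf W_{4,\ell}}$ has determinant $1$, then $\varphi(g)$ preserves $\mathbf W_{4,\ell}$ and $C$, the restriction $B=\varphi(g)|_{\mathbf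 W_{4,\ell}}$ has determinant $1$, and $\psi$ sends the class of $A$ to the class of $B$. The automorphism $\psi$ ("the restriction of $\varphi$ to $\mathrm{PSL}(\mathbf W_{4,\ell})$") satisfies $\psi^2=1$, it is not the identity if $\ell\ge1$, and $\psi\sigma_i\psi^{-1}=\sigma_i^{-1}$ in $\mathrm{Aut}(\mathrm{PSL}(\mathbf W_{4,\ell}))$ for $i=1,2,3$. 4. The action of $B_4/Z(B_4)$ on $\mathrm{PSL}(\mathbf W_{4,\ell})$ by conjugation extends to $\mathrm{Aut}(F_2)$. Namely, let $F_2$ be the free group on $x,y$, let $\pi:B_4\to\mathrm{Aut}(F_2)$ be the homomorphism given by $\sigma_1:(x,y)\mapsto(x,yx^{-1})$, $\sigma_2:(x,y)\mapsto(y,yx^{-1}y)$, $\sigma_3:(x,y)\mapsto(x,x^{-1}y)$ (it is through $\pi$ that $B_4/Z(B_4)$ is identified with $\mathrm{Aut}^+(F_2)$), and let $\iota\in\mathrm{Aut}(F_2)$ be the involution $(x,y)\mapsto(x^{-1},x^{-1}yx^{-1})$. Then there is a homomorphism $\Phi:\mathrm{Aut}(F_2)\to\mathrm{Aut}(\mathrm{PSL}(\mathbf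 W_{4,\ell}))$ such that, for every $\beta\in B_4$, $\Phi(\pi(\beta))$ is conjugation by the action of $\beta$ on $\mathbf W_{4,\ell}$, and $\Phi(\iota)=\psi$. -/

import Mathlib

open scoped TensorProduct

noncomputable section

namespace QuantumBraid

/-! ### The braid group `B₄` and its action on the free group `F₂` -/

/-- The defining relators of `B₄`; `FreeGroup.of 0, 1, 2` stand for `σ₁, σ₂, σ₃`. -/
def braidRels : Set (FreeGroup (Fin 3)) :=
  {(.of 0 * .of 1 * .of 0) * (.of 1 * .of 0 * .of 1)⁻¹,
   (.of 1 * .of 2 * .of 1) * (.of 2 * .of 1 * .of 2)⁻¹,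
   (.of 0 * .of 2) * (.of 2 * .of 0)⁻¹}

/-- The braid group on four strands. -/
abbrev B4 : Type := PresentedGroup braidRels

/-- The standard generators `σ₁, σ₂, σ₃` of `B₄` (indexed by `0, 1, 2`). -/
def sigma (i : Fin 3) : B4 := PresentedGroup.of i

/-- The free group of rank two. -/
abbrev F2 : Type := FreeGroup (Fin 2)

/-- The first free generator of `F₂`. -/
def x : F2 := FreeGroup.of 0

/-- The second free generator of `F₂`. -/
def y : F2 := FreeGroup.of 1

/-- The endomorphism of `F₂` with `x ↦ a`, `y ↦ b`. -/
def endF2 (a b : F2) : F2 →* F2 := FreeGroup.lift ![a, b]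

theorem endF2_x (a b : F2) : endF2 a b x = a := by simp [endF2, x]

theorem endF2_y (a b : F2) : endF2 a b y = b := by simp [endF2, y]

theorem hom_ext_F2 {G : Type*} [Group G] {f g : F2 →* G} (hx : f x = g x) (hy : f y = g y) :
    f = g := by
  ext i
  fin_cases i
  · exact hx
  · exact hy

/-- The automorphism of `F₂` with `x ↦ a`, `y ↦ b`, whose inverse is `x ↦ a'`, `y ↦ b'`. -/
def autF2 (a b a' b' : F2)
    (h₁ : endF2 a' b' a = x) (h₂ : endF2 a' b' b = y)
    (h₃ : endF2 a b a' = x) (h₄ : endF2 a b b' = y) : MulAut F2 :=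
  MonoidHom.toMulEquiv (endF2 a b) (endF2 a' b')
    (hom_ext_F2 (by simpa [endF2_x] using h₁) (by simpa [endF2_y] using h₂))
    (hom_ext_F2 (by simpa [endF2_x] using h₃) (by simpa [endF2_y] using h₄))

theorem autF2_x (a b a' b' : F2) (h₁ h₂ h₃ h₄) : autF2 a b a' b' h₁ h₂ h₃ h₄ x = a :=
  endF2_x a b

theorem autF2_y (a b a' b' : F2) (h₁ h₂ h₃ h₄) : autF2 a b a' b' h₁ h₂ h₃ h₄ y = b :=
  endF2_y a b

/-- `σ₁ : (x, y) ↦ (x, y x⁻¹)`, `σ₂ : (x, y) ↦ (y, y x⁻¹ y)`, `σ₃ : (x, y) ↦ (x, x⁻¹ y)`. -/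
def sigmaAut : Fin 3 → MulAut F2 :=
  ![autF2 x (y * x⁻¹) x (y * x) (by simp [endF2_x]) (by simp [endF2_x, endF2_y])
      (by simp [endF2_x]) (by simp [endF2_x, endF2_y]),
    autF2 y (y * x⁻¹ * y) (x * y⁻¹ * x) x (by simp [endF2_y])
      (by simp [endF2_x, endF2_y, mul_assoc])
      (by simp [endF2_x, endF2_y, mul_assoc]) (by simp [endF2_x]),
    autF2 x (x⁻¹ * y) x (x * y) (by simp [endF2_x]) (by simp [endF2_x, endF2_y])
      (by simp [endF2_x]) (by simp [endF2_x, endF2_y])]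

/-- The orientation reversing involution `ι : (x, y) ↦ (x⁻¹, x⁻¹ y x⁻¹)` of `F₂`; conjugation by
it inverts each of the automorphisms `sigmaAut i`. -/
def iota : MulAut F2 :=
  autF2 x⁻¹ (x⁻¹ * y * x⁻¹) x⁻¹ (x⁻¹ * y * x⁻¹)
    (by simp [endF2_x]) (by simp [endF2_x, endF2_y, mul_assoc])
    (by simp [endF2_x]) (by simp [endF2_x, endF2_y, mul_assoc])

theorem mulAut_ext_F2 {f g : MulAut F2} (hx : f x = g x) (hy : f y = g y) : f = g := by
  apply MulEquiv.toMonoidHom_injective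
  exact hom_ext_F2 hx hy

theorem sigmaAut_rels : ∀ r ∈ braidRels, FreeGroup.lift sigmaAut r = 1 := by
  intro r hr
  rcases hr with rfl | rfl | rfl
  all_goals
    rw [map_mul, map_inv, mul_inv_eq_one]
    apply mulAut_ext_F2 <;>
      simp [sigmaAut, autF2_x, autF2_y, mul_assoc]

/-- The homomorphism `B₄ → Aut(F₂)` given on generators by `sigmaAut`. It induces the isomorphism
of `B₄ / Z(B₄)` with the group of orientation preserving automorphisms of `F₂`. -/
def toAutF2 : B4 →* MulAut F2 := PresentedGroup.toGroup sigmaAut_rels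

theorem iota_conj (i : Fin 3) : iota * sigmaAut i * iota⁻¹ = (sigmaAut i)⁻¹ := by
  rw [mul_inv_eq_iff_eq_mul, eq_inv_mul_iff_mul_eq]
  fin_cases i <;> apply mulAut_ext_F2 <;>
    simp [sigmaAut, iota, autF2_x, autF2_y, mul_assoc]

/-! ### The quantum representation -/

section Rep

variable (F : Type*) [Field F] (q s : F)

/-- The quantum integer `[n]_q`. -/
def qInt (n : ℕ) : F := (q ^ n - (q ^ n)⁻¹) / (q - q⁻¹)

/-- The quantum factorial `[n]_q!`. -/
def qFact (n : ℕ) : F := ∏ k ∈ Finset.range n, qInt F q (k + 1)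

/-- The quantum binomial coefficient. -/
def qBinom (n k : ℕ) : F := qFact F q n / (qFact F q k * qFact F q (n - k))

/-- The Verma module `V`, with basis `v₀, v₁, v₂, …`. -/
abbrev V : Type _ := ℕ →₀ F

/-- The basis vector `v_j`. -/
def v (j : ℕ) : V F := Finsupp.single j 1

/-- `K v_j = s q^{-2j} v_j`. -/
def K : V F →ₗ[F] V F :=
  Finsupp.linearCombination F fun j => (s * (q ^ (2 * j))⁻¹) • v F j

/-- `E v_j = v_{j-1}`, where `v_{-1} = 0`. -/
def E : V F →ₗ[F] V F :=
  Finsupp.linearCombination F fun j => if j = 0 then 0 else v F (j - 1)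

/-- `V ⊗ V`. -/
abbrev V2 : Type _ := V F ⊗[F] V F

/-- `V^{⊗4}`. -/
abbrev V4 : Type _ := V2 F ⊗[F] V2 F

/-- The action of `Δ(K) = K ⊗ K` on `V ⊗ V`. -/
def K2 : V2 F →ₗ[F] V2 F := TensorProduct.map (K F q s) (K F q s)

/-- The action of `Δ(E) = E ⊗ K + 1 ⊗ E` on `V ⊗ V`. -/
def E2 : V2 F →ₗ[F] V2 F :=
  TensorProduct.map (E F) (K F q s) + TensorProduct.map LinearMap.id (E F)

/-- The action of `(Δ ⊗ Δ)(Δ(E))` on `V^{⊗4}`. -/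
def E4 : V4 F →ₗ[F] V4 F :=
  TensorProduct.map (E2 F q s) (K2 F q s) + TensorProduct.map LinearMap.id (E2 F q s)

/-- The basis `v_i ⊗ v_j` of `V ⊗ V`. -/
def basis2 : Module.Basis (ℕ × ℕ) F (V2 F) :=
  Finsupp.basisSingleOne.tensorProduct Finsupp.basisSingleOne

/-- The basis `(v_a ⊗ v_b) ⊗ (v_c ⊗ v_d)` of `V^{⊗4}`. -/
def basis4 : Module.Basis ((ℕ × ℕ) × (ℕ × ℕ)) F (V4 F) :=
  (basis2 F).tensorProduct (basis2 F)

theorem basis4_apply (a b c d : ℕ) :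
    basis4 F ((a, b), (c, d)) = (v F a ⊗ₜ[F] v F b) ⊗ₜ[F] (v F c ⊗ₜ[F] v F d) := by
  simp [basis4, basis2, v]

/-- The `R`-matrix
`R (v_i ⊗ v_j) = s^{-i-j} ∑_{n=0}^{i} q^{2(i-n)(j+n) + n(n-1)/2} [n+j choose j]_q
  ∏_{k=0}^{n-1} (s q^{-k-j} - s⁻¹ q^{k+j}) v_{j+n} ⊗ v_{i-n}`. -/
def R : V2 F →ₗ[F] V2 F :=
  (basis2 F).constr F fun p =>
    ∑ n ∈ Finset.range (p.1 + 1),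
      ((s ^ (p.1 + p.2))⁻¹ * q ^ (2 * (p.1 - n) * (p.2 + n) + n * (n - 1) / 2)
        * qBinom F q (n + p.2) p.2
        * ∏ k ∈ Finset.range n, (s * (q ^ (k + p.2))⁻¹ - s⁻¹ * q ^ (k + p.2))) •
      (v F (p.2 + n) ⊗ₜ[F] v F (p.1 - n))

/-- The endomorphisms `R ⊗ 1 ⊗ 1`, `1 ⊗ R ⊗ 1`, `1 ⊗ 1 ⊗ R` of `V^{⊗4}`, by which
`σ₁, σ₂, σ₃` act. -/
def braidOp : Fin 3 → (V4 F →ₗ[F] V4 F) :=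
  ![TensorProduct.map (R F q s) LinearMap.id,
    (TensorProduct.tensorTensorTensorAssoc F (V F) (V F) (V F) (V F)).symm.toLinearMap ∘ₗ
      TensorProduct.map (TensorProduct.map LinearMap.id (R F q s)) LinearMap.id ∘ₗ
      (TensorProduct.tensorTensorTensorAssoc F (V F) (V F) (V F) (V F)).toLinearMap,
    TensorProduct.map LinearMap.id (R F q s)]

/-- The indices of the pure tensors of coordinate sum `ℓ`. -/
abbrev Idx (ℓ : ℕ) : Type :=
  {a : (ℕ × ℕ) × (ℕ × ℕ) // a.1.1 + a.1.2 + a.2.1 + a.2.2 = ℓ}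

instance (ℓ : ℕ) : Finite (Idx ℓ) := by
  refine Set.Finite.to_subtype (Set.Finite.subset
    (((Set.finite_Iic ℓ).prod (Set.finite_Iic ℓ)).prod
      ((Set.finite_Iic ℓ).prod (Set.finite_Iic ℓ))) ?_)
  rintro ⟨⟨a, b⟩, ⟨c, d⟩⟩ h
  change a + b + c + d = ℓ at h
  simp only [Set.mem_prod, Set.mem_Iic]
  omega

instance (ℓ : ℕ) : Fintype (Idx ℓ) := Fintype.ofFinite _

/-- The weight space `V_{4,ℓ}`: the free module on the pure tensors `v_a ⊗ v_b ⊗ v_c ⊗ v_d` with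
`a + b + c + d = ℓ`. Its elements are given by their coordinates in this basis. -/
abbrev V4l (ℓ : ℕ) : Type _ := Idx ℓ → F

/-- The basis of `V_{4,ℓ}` that consists of the pure tensors; matrices and transposes are taken
with respect to this basis. -/
abbrev basisV4l (ℓ : ℕ) : Module.Basis (Idx ℓ) F (V4l F ℓ) := Pi.basisFun F (Idx ℓ)

/-- The inclusion `V_{4,ℓ} ⊆ V^{⊗4}`. -/
def incl (ℓ : ℕ) : V4l F ℓ →ₗ[F] V4 F :=
  Fintype.linearCombination F fun a : Idx ℓ => basis4 F a.1

theorem incl_injective (ℓ : ℕ) : Function.Injective (incl F ℓ) := by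
  have h : LinearIndependent F fun a : Idx ℓ => basis4 F a.1 :=
    (basis4 F).linearIndependent.comp _ Subtype.val_injective
  exact h.fintypeLinearCombination_injective

/-- The highest weight space `W_{4,ℓ} = ker E ∩ V_{4,ℓ}`, as a subspace of `V_{4,ℓ}`. -/
def W4l (ℓ : ℕ) : Submodule F (V4l F ℓ) := LinearMap.ker (E4 F q s ∘ₗ incl F ℓ)

end Rep

/-! ### Projective special linear groups and their automorphisms -/

section Groups

/-- An automorphism of a group acts on the quotient by the center. -/
def autModCenter (G : Type*) [Group G] : MulAut G →* MulAut (G ⧸ Subgroup.center G) where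
  toFun f := QuotientGroup.congr _ _ f (Subgroup.characteristic_iff_map_eq.mp inferInstance f)
  map_one' := by
    ext a
    induction a using QuotientGroup.induction_on
    rfl
  map_mul' f g := by
    ext a
    induction a using QuotientGroup.induction_on
    rfl

variable (F : Type*) [Field F] (M : Type*) [AddCommGroup M] [Module F M]

/-- `PSL(M)`. -/
abbrev PSL : Type _ := SpecialLinearGroup F M ⧸ Subgroup.center (SpecialLinearGroup F M)

variable {F M}

/-- The class in `PSL(M)` of an element of `SL(M)`. -/
def toPSL : SpecialLinearGroup F M →* PSL F M := QuotientGroup.mk' _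

/-- `GL(M)` acts on `SL(M)` by conjugation. -/
def conjSL : (M ≃ₗ[F] M) →* MulAut (SpecialLinearGroup F M) where
  toFun g :=
    { toFun := fun A => ⟨g * A.1 * g⁻¹, by simp [A.2]⟩
      invFun := fun A => ⟨g⁻¹ * A.1 * g, by simp [A.2]⟩
      left_inv := fun A => Subtype.ext (by simp [mul_assoc])
      right_inv := fun A => Subtype.ext (by simp [mul_assoc])
      map_mul' := fun A B => Subtype.ext (by simp [mul_assoc]) }
  map_one' := by
    refine MulEquiv.ext fun A => Subtype.ext ?_
    change 1 * A.1 * 1⁻¹ = A.1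
    simp
  map_mul' g h := by
    refine MulEquiv.ext fun A => Subtype.ext ?_
    change (g * h) * A.1 * (g * h)⁻¹ = g * (h * A.1 * h⁻¹) * g⁻¹
    simp [mul_assoc]

/-- The conjugation action of `GL(M)`, hence of `PGL(M)`, on `PSL(M)`. -/
def conjPSL : (M ≃ₗ[F] M) →* MulAut (PSL F M) := (autModCenter _).comp conjSL

variable {n : Type*} [Fintype n] [DecidableEq n]

/-- The automorphism `A ↦ (Aᵀ)⁻¹` of `GL_n(F)`. -/
def invTranspose : MulAut (GL n F) where
  toFun A := ⟨(A⁻¹).1.transpose, A.1.transpose,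
    by rw [← Matrix.transpose_mul, Units.mul_inv, Matrix.transpose_one],
    by rw [← Matrix.transpose_mul, Units.inv_mul, Matrix.transpose_one]⟩
  invFun A := ⟨(A⁻¹).1.transpose, A.1.transpose,
    by rw [← Matrix.transpose_mul, Units.mul_inv, Matrix.transpose_one],
    by rw [← Matrix.transpose_mul, Units.inv_mul, Matrix.transpose_one]⟩
  left_inv A := Units.ext (Matrix.transpose_transpose A.1)
  right_inv A := Units.ext (Matrix.transpose_transpose A.1)
  map_mul' A B := Units.ext (by
    change ((A * B)⁻¹).1.transpose = (A⁻¹).1.transpose * (B⁻¹).1.transpose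
    rw [mul_inv_rev, Units.val_mul, Matrix.transpose_mul])

/-- The automorphism `A ↦ J (Aᵀ)⁻¹ J⁻¹` of `GL_n(F)`. -/
def phiMat (J : GL n F) : MulAut (GL n F) := MulAut.conj J * invTranspose

/-- The matrix, with respect to a basis, of an element of `GL(M)`. -/
def toGL (b : Module.Basis n F M) : (M ≃ₗ[F] M) ≃* GL n F :=
  (LinearMap.GeneralLinearGroup.generalLinearEquiv F M).symm.trans
    (Units.mapEquiv (LinearMap.toMatrixAlgEquiv b).toMulEquiv)

theorem toGL_val (b : Module.Basis n F M) (A : M ≃ₗ[F] M) :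
    (toGL b A).1 = LinearMap.toMatrix b b A.toLinearMap := rfl

/-- The automorphism `A ↦ J (Aᵀ)⁻¹ J⁻¹` of `GL(M)`, in matrices with respect to a basis. -/
def phi (b : Module.Basis n F M) (J : GL n F) : MulAut (M ≃ₗ[F] M) :=
  ((toGL b).trans (phiMat J)).trans (toGL b).symm

theorem toGL_phi (b : Module.Basis n F M) (J : GL n F) (A : M ≃ₗ[F] M) :
    toGL b (phi b J A) = J * invTranspose (toGL b A) * J⁻¹ := by
  simp [phi, phiMat]

theorem det_toGL (b : Module.Basis n F M) (A : M ≃ₗ[F] M) :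
    (toGL b A).1.det = (LinearEquiv.det A : Fˣ) := by
  rw [toGL_val, LinearMap.det_toMatrix, LinearEquiv.coe_det]

theorem det_phi (b : Module.Basis n F M) (J : GL n F) (A : M ≃ₗ[F] M) :
    LinearEquiv.det (phi b J A) = (LinearEquiv.det A)⁻¹ := by
  have h : (toGL b (phi b J A)).1.det = (toGL b A⁻¹).1.det := by
    rw [toGL_phi, Units.val_mul, Units.val_mul, Matrix.det_units_conj, map_inv]
    exact Matrix.det_transpose _
  rw [det_toGL, det_toGL] at h
  rw [← map_inv]
  exact Units.ext h

/-- The automorphism of `SL(M)` induced by `phi`. -/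
def phiSL (b : Module.Basis n F M) (J : GL n F) : MulAut (SpecialLinearGroup F M) where
  toFun A := ⟨phi b J A.1, by rw [det_phi, A.2, inv_one]⟩
  invFun A := ⟨(phi b J).symm A.1, by
    have h := det_phi b J ((phi b J).symm A.1)
    rw [MulEquiv.apply_symm_apply, A.2] at h
    exact inv_eq_one.mp h.symm⟩
  left_inv A := Subtype.ext ((phi b J).symm_apply_apply A.1)
  right_inv A := Subtype.ext ((phi b J).apply_symm_apply A.1)
  map_mul' A B := Subtype.ext (map_mul (phi b J) A.1 B.1)

/-- The automorphism of `PSL(M)` induced by `phi`. -/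
def phiPSL (b : Module.Basis n F M) (J : GL n F) : MulAut (PSL F M) :=
  autModCenter _ (phiSL b J)

end Groups

end QuantumBraid

end

/-! The heart of the matter is a symmetric bilinear form on $V_{4,\ell}$ for which every $\sigma_i$
is self-adjoint. Rescaling $v_m$ by the numbers `normV` makes the matrix of $R$ symmetric
(`rEntry_symm`). So $J$ can be taken diagonal, with the products of these numbers as entries, and
the form is the one with Gram matrix $J^{-1}$. Then $\varphi(A)$ is the inverse of the adjoint of
$A$ (`form_phi`). It follows at once that $\varphi$ is an involution and inverts each $\sigma_i$.

For the restriction to $W_{4,\ell}$ the form must stay nondegenerate there. The lowering operator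
`fOp` is adjoint to $E$ up to scalars, so its image is orthogonal to $W_{4,\ell}$
(`formV_fOp_eq_zero`). For generic parameters, highest weight theory gives
$V_{4,\ell}=W_{4,\ell}+\mathrm{im}$ (`exists_sub_fOp_mem_hwSpace`). A vector of $W_{4,\ell}$
orthogonal to $W_{4,\ell}$ is therefore orthogonal to everything. The complement $C$ is the
orthogonal of $W_{4,\ell}$, and $\psi$ is the inverse adjoint for the restricted form. It is not
trivial on PSL once the dimension is at least $2$, because a transvection along a non-isotropic
vector is not a similitude (`phiPSL_ne_one`).

The extension to $\mathrm{Aut}(F_2)$ rests on three facts. The $\sigma_i$ and $\iota$ generate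
$\mathrm{Aut}(F_2)$ (`nielsenGroup_eq_top`, by Nielsen reduction). The kernel of $\pi$ consists of
the powers of the full twist $(\sigma_1\sigma_2\sigma_3)^4$ (`toAutF2_eq_one`, by a normal form over
$\mathrm{SL}_2(\mathbb Z)$). The full twist acts on $W_{4,\ell}$ by a scalar (`coxeterOp_pow_four`),
so it disappears in $\mathrm{Aut}(\mathrm{PSL})$. Since $\iota$ and $\psi$ both invert the
generators, and $\iota$ has determinant $-1$ on the abelianization, the action extends
(`exists_extension`).

That there is a braid action at all is the Yang-Baxter equation. It follows from the hexagon
identity together with the commutation of $R$ with the divided powers of $E$ (`hexagon`,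
`eDiv_rFun`). -/

noncomputable section

namespace QuantumBraid

open Finset.HasAntidiagonal (antidiagonal mem_antidiagonal)

/-! ### Gromov products in free groups -/

section Gromov

variable {α : Type*} [DecidableEq α]

/-- The length of the longest common prefix of two lists. -/
def lcp {β : Type*} [DecidableEq β] : List β → List β → ℕ
  | a :: l, b :: m => if a = b then lcp l m + 1 else 0
  | [], _ => 0
  | _ :: _, [] => 0

theorem lcp_comm {β : Type*} [DecidableEq β] (l m : List β) : lcp l m = lcp m l := by
  induction l generalizing m with
  | nil => cases m <;> rfl
  | cons a l ih =>
    cases m with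
    | nil => rfl
    | cons b m => simp only [lcp, ih m, eq_comm]

theorem lcp_take {β : Type*} [DecidableEq β] (l : List β) (k : ℕ) (hk : k ≤ l.length) :
    lcp (l.take k) l = k := by
  induction l generalizing k with
  | nil => simp_all [lcp]
  | cons a l ih =>
    cases k with
    | zero => simp [lcp]
    | succ k => simpa [lcp] using ih k (by simpa using hk)

/-- The ultrametric inequality of a tree; it is what makes the Gromov product below usable for
cancellation arguments. -/
theorem min_lcp_le {β : Type*} [DecidableEq β] (l m n : List β) :
    min (lcp l m) (lcp m n) ≤ lcp l n := by
  induction l generalizing m n with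
  | nil => simp [lcp]
  | cons a l ih =>
    cases m with
    | nil => simp [lcp]
    | cons b m =>
      cases n with
      | nil => simp [lcp]
      | cons c n =>
        have := ih m n
        simp only [lcp]
        split_ifs <;> simp_all

theorem isReduced_invRev {l : List (α × Bool)} (h : FreeGroup.IsReduced l) :
    FreeGroup.IsReduced (FreeGroup.invRev l) := by
  rw [FreeGroup.isReduced_iff_reduce_eq, FreeGroup.reduce_invRev, h.reduce_eq]

theorem norm_mk_of_isReduced {l : List (α × Bool)} (h : FreeGroup.IsReduced l) :
    (FreeGroup.mk l).norm = l.length := by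
  rw [FreeGroup.norm, FreeGroup.toWord_mk, h.reduce_eq]

/-- In $l^{-1}m$ exactly the common prefix cancels: once the first letters differ, the concatenation
is already reduced. Hence `lcp` is the Gromov product of the word metric. -/
theorem norm_inv_mk_mul_mk {l m : List (α × Bool)} (hl : FreeGroup.IsReduced l)
    (hm : FreeGroup.IsReduced m) :
    ((FreeGroup.mk l)⁻¹ * FreeGroup.mk m).norm + 2 * lcp l m = l.length + m.length := by
  induction l generalizing m with
  | nil => simp [lcp, ← FreeGroup.one_eq_mk, norm_mk_of_isReduced hm]
  | cons a l ih =>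
    cases m with
    | nil => 
      simp only [lcp, ← FreeGroup.one_eq_mk, mul_one, FreeGroup.norm_inv_eq,
        norm_mk_of_isReduced hl]
      simp
    | cons b m =>
      by_cases hab : a = b
      · subst hab
        have h := ih (List.IsChain.tail hl) (List.IsChain.tail hm)
        have e : (FreeGroup.mk (a :: l))⁻¹ * FreeGroup.mk (a :: m) =
            (FreeGroup.mk l)⁻¹ * FreeGroup.mk m := by
          have h1 : ∀ k, FreeGroup.mk (a :: k) = FreeGroup.mk [a] * FreeGroup.mk k := by
            intro k; simp [FreeGroup.mul_mk]
          rw [h1 l, h1 m]; group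
        simp only [List.tail_cons] at h
        simp only [e, lcp, if_true, List.length_cons]
        omega
      · have hr : FreeGroup.IsReduced (FreeGroup.invRev (a :: l) ++ b :: m) := by
          refine List.IsChain.append (isReduced_invRev hl) hm ?_
          intro x hx y hy
          simp only [FreeGroup.invRev, List.map_cons, List.reverse_cons, List.getLast?_append,
            List.getLast?_singleton, Option.some_or, Option.mem_some_iff, List.head?_cons] at hx hy
          subst hx hy
          intro h1
          simp only at h1 ⊢
          by_contra h2
          apply hab
          ext
          · exact h1
          · revert h2
            cases a.2 <;> cases b.2 <;> simp
        have e : (FreeGroup.mk (a :: l))⁻¹ * FreeGroup.mk (b :: m) =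
            FreeGroup.mk (FreeGroup.invRev (a :: l) ++ b :: m) := by
          rw [FreeGroup.inv_mk, FreeGroup.mul_mk]
        rw [e, norm_mk_of_isReduced hr]
        simp [lcp, hab]

/-- The Gromov product of two elements of a free group. -/
def gromov (g h : FreeGroup α) : ℕ := lcp g.toWord h.toWord

theorem norm_inv_mul_add_gromov (g h : FreeGroup α) :
    (g⁻¹ * h).norm + 2 * gromov g h = g.norm + h.norm := by
  have := norm_inv_mk_mul_mk (FreeGroup.isReduced_toWord (x := g))
    (FreeGroup.isReduced_toWord (x := h))
  rwa [FreeGroup.mk_toWord, FreeGroup.mk_toWord] at this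

theorem gromov_comm (g h : FreeGroup α) : gromov g h = gromov h g := lcp_comm _ _

theorem min_gromov_le (g h k : FreeGroup α) : min (gromov g h) (gromov h k) ≤ gromov g k :=
  min_lcp_le _ _ _

theorem exists_prefix (g : FreeGroup α) (k : ℕ) (hk : k ≤ g.norm) :
    ∃ p : FreeGroup α, p.norm = k ∧ gromov p g = k := by
  have hr : FreeGroup.IsReduced (g.toWord.take k) :=
    FreeGroup.isReduced_toWord.infix (List.take_prefix _ _).isInfix
  refine ⟨FreeGroup.mk (g.toWord.take k), ?_, ?_⟩
  · rw [norm_mk_of_isReduced hr, List.length_take]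
    exact min_eq_left hk
  · rw [gromov, FreeGroup.toWord_mk, hr.reduce_eq]
    exact lcp_take _ _ hk

/-- Write $g=cwc^{-1}$ with $w$ cyclically reduced and nonempty; squaring doubles $w$ and leaves $c$
alone. -/
theorem norm_lt_norm_sq {g : FreeGroup α} (hg : g ≠ 1) : g.norm < (g * g).norm := by
  have hr := FreeGroup.isReduced_toWord (x := g)
  have h0 := FreeGroup.reduceCyclically.reduce_flatten_replicate_succ hr 0
  have h1 := FreeGroup.reduceCyclically.reduce_flatten_replicate_succ hr 1
  have hc := FreeGroup.reduceCyclically.conj_conjugator_reduceCyclically g.toWord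
  have e0 : g.norm = (FreeGroup.reduce (List.replicate (0 + 1) g.toWord).flatten).length := by
    simp [FreeGroup.norm]
  have e1 : (g * g).norm = (FreeGroup.reduce (List.replicate (1 + 1) g.toWord).flatten).length := by
    rw [FreeGroup.norm, FreeGroup.toWord_mul]
    simp [List.replicate_succ]
  rw [e0, e1, h0, h1]
  have hne : FreeGroup.reduceCyclically g.toWord ≠ [] := by
    intro h
    rw [h] at hc
    apply hg
    rw [← FreeGroup.mk_toWord (x := g), ← hc]
    simp only [List.append_nil, ← FreeGroup.mul_mk, ← FreeGroup.inv_mk]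
    group
  have := List.length_pos_of_ne_nil hne
  simp [List.replicate_succ]
  omega

theorem two_mul_gromov_inv_lt {g : FreeGroup α} (hg : g ≠ 1) : 2 * gromov g g⁻¹ < g.norm := by
  have h := norm_inv_mul_add_gromov g g⁻¹
  have h2 : (g⁻¹ * g⁻¹).norm = (g * g).norm := by
    rw [← FreeGroup.norm_inv_eq (x := g * g), mul_inv_rev]
  have := norm_lt_norm_sq hg
  rw [FreeGroup.norm_inv_eq, h2] at h
  omega

/-- If `g = p q⁻¹` with `|p| = |q|`, `h` starts with `p` and `h⁻¹` starts with `q`, then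
conjugation by `q` shortens `g⁻¹ h`. -/
theorem exists_conj_shorter {g h : FreeGroup α} {m : ℕ} (hm : 0 < m) (hg : g.norm = 2 * m)
    (h1 : m ≤ gromov g h) (h2 : m ≤ gromov g⁻¹ h⁻¹) (hh : 2 * m ≤ h.norm) :
    ∃ r : FreeGroup α, (r⁻¹ * g * r).norm ≤ g.norm ∧ (r⁻¹ * (g⁻¹ * h) * r).norm < h.norm := by
  obtain ⟨p, hp, hpg⟩ := exists_prefix g m (by omega)
  obtain ⟨r, hr⟩ : ∃ r, r = g⁻¹ * p := ⟨_, rfl⟩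
  have hrn : r.norm = m := by
    have := norm_inv_mul_add_gromov g p
    rw [gromov_comm, ← hr] at this
    omega
  have hgr : gromov r g⁻¹ = m := by
    have := norm_inv_mul_add_gromov r g⁻¹
    have e : r⁻¹ * g⁻¹ = p⁻¹ := by rw [hr]; group
    rw [e, FreeGroup.norm_inv_eq, FreeGroup.norm_inv_eq] at this
    omega
  have hph : m ≤ gromov p h := by
    have := min_gromov_le p g h
    omega
  have hrh : m ≤ gromov r h⁻¹ := by
    have := min_gromov_le r g⁻¹ h⁻¹
    omega
  have hhr : (h * r).norm + m ≤ h.norm := by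
    have := norm_inv_mul_add_gromov r h⁻¹
    rw [← FreeGroup.norm_inv_eq, FreeGroup.norm_inv_eq (x := h)] at this
    have e : (r⁻¹ * h⁻¹)⁻¹ = h * r := by group
    rw [e] at this
    omega
  -- Since $|h|\ge 2m$, cutting off the final $m$ letters of $h$ does not touch its first $m$
  -- letters, so $hr$ still starts with $p$.
  have hhhr : m ≤ gromov h (h * r) := by
    have := norm_inv_mul_add_gromov h (h * r)
    have e : h⁻¹ * (h * r) = r := by group
    rw [e] at this
    have h3 := FreeGroup.norm_mul_le (h * r) r⁻¹
    have e : (h * r) * r⁻¹ = h := by group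
    rw [e, FreeGroup.norm_inv_eq] at h3
    omega
  have h4 : m ≤ gromov p (h * r) := by
    have := min_gromov_le p h (h * r)
    omega
  refine ⟨r, ?_, ?_⟩
  · have e : r⁻¹ * g * r = r⁻¹ * p := by rw [hr]; group
    rw [e]
    have := FreeGroup.norm_mul_le r⁻¹ p
    rw [FreeGroup.norm_inv_eq] at this
    omega
  · have e : r⁻¹ * (g⁻¹ * h) * r = p⁻¹ * (h * r) := by rw [hr]; group
    rw [e]
    have := norm_inv_mul_add_gromov p (h * r)
    omega

end Gromov

/-! ### Nielsen reduced pairs -/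

/-- A letter of the alphabet of `F₂`. -/
abbrev Letter : Type := Fin 2 × Bool

/-- The inverse letter. -/
def Letter.inv (l : Letter) : Letter := (l.1, !l.2)

theorem mk_letter_inv (l : Letter) : (FreeGroup.mk [l.inv] : F2) = (FreeGroup.mk [l])⁻¹ := rfl

theorem Letter.inv_inv (l : Letter) : l.inv.inv = l := by simp [Letter.inv]

theorem Letter.eq_or_eq_inv {k l : Letter} (h : k.1 = l.1) : k = l ∨ k = l.inv := by
  obtain ⟨k1, k2⟩ := k
  obtain ⟨l1, l2⟩ := l
  simp only at h
  subst h
  cases k2 <;> cases l2 <;> simp [Letter.inv]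

section Nielsen

variable {φ : F2 →* F2}

/-- The pair `(φ x, φ y)` cannot be shortened by a Nielsen move followed by a conjugation. -/
def IsShortest (φ : F2 →* F2) : Prop :=
  ∀ k l : Letter, k.1 ≠ l.1 → ∀ r : F2,
    (φ (FreeGroup.mk [k])).norm + (φ (FreeGroup.mk [l])).norm ≤
      (r⁻¹ * φ (FreeGroup.mk [k]) * r).norm +
        (r⁻¹ * ((φ (FreeGroup.mk [k]))⁻¹ * φ (FreeGroup.mk [l])) * r).norm

theorem IsShortest.gromov_le (h : IsShortest φ) {k l : Letter} (hkl : k.1 ≠ l.1) :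
    2 * gromov (φ (FreeGroup.mk [k])) (φ (FreeGroup.mk [l])) ≤ (φ (FreeGroup.mk [k])).norm := by
  have h1 := h k l hkl 1
  have h2 := norm_inv_mul_add_gromov (φ (FreeGroup.mk [k])) (φ (FreeGroup.mk [l]))
  simp only [inv_one, one_mul, mul_one] at h1
  omega

variable (h1 : ∀ k : Letter, φ (FreeGroup.mk [k]) ≠ 1)
include h1

theorem IsShortest.gromov_le' (h : IsShortest φ) {k l : Letter} (hkl : k ≠ l) :
    2 * gromov (φ (FreeGroup.mk [k])) (φ (FreeGroup.mk [l])) ≤ (φ (FreeGroup.mk [k])).norm := by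
  by_cases h2 : k.1 = l.1
  · rcases Letter.eq_or_eq_inv h2.symm with rfl | rfl
    · exact absurd rfl hkl
    · rw [mk_letter_inv, map_inv]
      exact (two_mul_gromov_inv_lt (h1 k)).le
  · exact h.gromov_le h2

/-- Some letter of $\varphi(k)$ survives cancellation from both sides. Each side eats at most half,
so the only danger is that both eat exactly half. If $l$ or $m$ lies over the generator of $k$, this
is excluded by $|g|<|g^2|$; if $l=m$, the ultrametric inequality reduces to that case. If
$l=m^{-1}$, no Nielsen move shortens the pair, but a conjugation after the move does
(`exists_conj_shorter`). This is why `IsShortest` quantifies over $r$. -/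
theorem IsShortest.gromov_add_lt (h : IsShortest φ) {k l m : Letter} (hl : l ≠ k)
    (hm : m ≠ k.inv) :
    gromov (φ (FreeGroup.mk [k])) (φ (FreeGroup.mk [l])) +
      gromov (φ (FreeGroup.mk [k]))⁻¹ (φ (FreeGroup.mk [m])) < (φ (FreeGroup.mk [k])).norm := by
  have hkl := h.gromov_le' h1 hl.symm
  have hkm := h.gromov_le' h1 hm.symm
  rw [mk_letter_inv, map_inv, FreeGroup.norm_inv_eq] at hkm
  by_cases h2 : l.1 = k.1
  · rcases Letter.eq_or_eq_inv h2 with rfl | rfl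
    · exact absurd rfl hl
    · have := two_mul_gromov_inv_lt (h1 k)
      rw [mk_letter_inv, map_inv] at hkl ⊢
      omega
  by_cases h3 : m.1 = k.1
  · rcases Letter.eq_or_eq_inv h3 with rfl | rfl
    · have := two_mul_gromov_inv_lt (h1 m)
      rw [gromov_comm] at this
      omega
    · exact absurd rfl hm
  by_contra hlt
  have h4 : l.1 = m.1 := by omega
  rcases Letter.eq_or_eq_inv h4 with rfl | rfl
  · have := two_mul_gromov_inv_lt (h1 k)
    have := min_gromov_le (φ (FreeGroup.mk [k])) (φ (FreeGroup.mk [l])) (φ (FreeGroup.mk [k]))⁻¹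
    rw [gromov_comm _ (φ (FreeGroup.mk [k]))⁻¹] at this
    omega
  · have hmk := h.gromov_le' h1 hl
    rw [mk_letter_inv, map_inv] at hkl hlt hmk
    rw [gromov_comm, FreeGroup.norm_inv_eq] at hmk
    have hk0 : (φ (FreeGroup.mk [k])).norm ≠ 0 := fun h => h1 k (FreeGroup.norm_eq_zero.mp h)
    obtain ⟨r, hr1, hr2⟩ := exists_conj_shorter (g := φ (FreeGroup.mk [k]))
      (h := (φ (FreeGroup.mk [m]))⁻¹)
      (m := gromov (φ (FreeGroup.mk [k])) (φ (FreeGroup.mk [m]))⁻¹) (by omega) (by omega) le_rfl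
      (by rw [_root_.inv_inv]; omega) (by rw [FreeGroup.norm_inv_eq]; omega)
    have h5 := h k m.inv (by simpa using Ne.symm h2) r
    rw [mk_letter_inv, map_inv] at h5
    omega

/-- By induction, the next factor cancels too little of $\varphi(k)$ to reach the prefix that it
shares with $\varphi(l)$. So cancellations at neighbouring junctions do not interact. -/
theorem IsShortest.gromov_cons (h : IsShortest φ) (k : Letter) (L : List Letter)
    (hL : FreeGroup.IsReduced (k :: L)) {l : Letter} (hl : l ≠ k) :
    gromov (φ (FreeGroup.mk (k :: L))) (φ (FreeGroup.mk [l])) =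
      gromov (φ (FreeGroup.mk [k])) (φ (FreeGroup.mk [l])) := by
  induction L generalizing k l with
  | nil => rfl
  | cons k' L ih =>
    have hk' : k' ≠ k.inv := by
      rintro rfl
      have := (FreeGroup.isReduced_cons_cons.mp hL).1 rfl
      simp [Letter.inv] at this
    have h3 := ih k' (List.IsChain.tail hL) (l := k.inv) hk'.symm
    have e : φ (FreeGroup.mk (k :: k' :: L)) =
        φ (FreeGroup.mk [k]) * φ (FreeGroup.mk (k' :: L)) := by
      rw [← map_mul, FreeGroup.mul_mk]; rfl
    rw [mk_letter_inv, map_inv] at h3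
    have h4 := norm_inv_mul_add_gromov (φ (FreeGroup.mk [k]))⁻¹ (φ (FreeGroup.mk (k' :: L)))
    have h5 := norm_inv_mul_add_gromov (φ (FreeGroup.mk [k])) (φ (FreeGroup.mk (k :: k' :: L)))
    rw [gromov_comm, h3, _root_.inv_inv, ← e, FreeGroup.norm_inv_eq] at h4
    rw [e, inv_mul_cancel_left, ← e] at h5
    have h6 := h.gromov_add_lt h1 hl hk'
    have h7 := min_gromov_le (φ (FreeGroup.mk (k :: k' :: L))) (φ (FreeGroup.mk [k]))
      (φ (FreeGroup.mk [l]))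
    have h8 := min_gromov_le (φ (FreeGroup.mk [k])) (φ (FreeGroup.mk (k :: k' :: L)))
      (φ (FreeGroup.mk [l]))
    rw [gromov_comm _ (φ (FreeGroup.mk [k]))] at h7
    rw [gromov_comm (φ (FreeGroup.mk [k'])) _] at h4
    omega

theorem IsShortest.norm_cons_cons (h : IsShortest φ) (k k' : Letter) (L : List Letter)
    (hL : FreeGroup.IsReduced (k :: k' :: L)) :
    ∃ c, (φ (FreeGroup.mk (k :: k' :: L))).norm + 2 * c =
        (φ (FreeGroup.mk [k])).norm + (φ (FreeGroup.mk (k' :: L))).norm ∧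
      2 * c ≤ (φ (FreeGroup.mk [k])).norm ∧ 2 * c ≤ (φ (FreeGroup.mk [k'])).norm := by
  have hk' : k' ≠ k.inv := by
    rintro rfl
    have := (FreeGroup.isReduced_cons_cons.mp hL).1 rfl
    simp [Letter.inv] at this
  have h3 := h.gromov_cons h1 k' L (List.IsChain.tail hL) hk'.symm
  rw [mk_letter_inv, map_inv] at h3
  have h4 := norm_inv_mul_add_gromov (φ (FreeGroup.mk [k]))⁻¹ (φ (FreeGroup.mk (k' :: L)))
  rw [_root_.inv_inv, ← map_mul, FreeGroup.mul_mk, List.singleton_append, gromov_comm, h3,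
    FreeGroup.norm_inv_eq] at h4
  have h5 := h.gromov_le' h1 hk'
  have h6 := h.gromov_le' h1 hk'.symm
  rw [mk_letter_inv, map_inv] at h5 h6
  rw [gromov_comm, FreeGroup.norm_inv_eq] at h6
  exact ⟨_, h4, h6, h5⟩

/-- Prepending a letter never shortens the image, since $2c\le|\varphi(k)|$. For two letters, either
one image has length at least $2$, or both have length $1$ and $2c\le 1$ forces $c=0$. -/
theorem IsShortest.two_le_norm (h : IsShortest φ) (k k' : Letter) (L : List Letter)
    (hL : FreeGroup.IsReduced (k :: k' :: L)) : 2 ≤ (φ (FreeGroup.mk (k :: k' :: L))).norm := by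
  have hk (k) : (φ (FreeGroup.mk [k])).norm ≠ 0 := fun h => h1 k (FreeGroup.norm_eq_zero.mp h)
  have hk0 := hk k
  have hk1 := hk k'
  obtain ⟨c, h2, h3, h4⟩ := h.norm_cons_cons h1 k k' L hL
  induction L generalizing k k' c with
  | nil => omega
  | cons k'' L ih =>
    have hL' := List.IsChain.tail hL
    obtain ⟨c', h5, h6, h7⟩ := h.norm_cons_cons h1 k' k'' L hL'
    have := ih k' k'' hL' hk1 (hk k'') c' h5 h6 h7
    omega

theorem IsShortest.exists_letter (h : IsShortest φ) {w : F2} (hw : (φ w).norm = 1) :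
    ∃ l : Letter, w = FreeGroup.mk [l] := by
  have hr := FreeGroup.isReduced_toWord (x := w)
  rw [← FreeGroup.mk_toWord (x := w)] at hw ⊢
  match hL : w.toWord with
  | [] =>
    rw [hL, ← FreeGroup.one_eq_mk, map_one, FreeGroup.norm_one] at hw
    omega
  | [l] => exact ⟨l, rfl⟩
  | k :: k' :: L =>
    rw [hL] at hw hr
    have := h.two_le_norm h1 k k' L hr
    omega

end Nielsen

/-! ### Generators of `Aut(F₂)` -/

/-- The subgroup of `Aut(F₂)` generated by the automorphisms `sigmaAut i` and `iota`. -/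
def nielsenGroup : Subgroup (MulAut F2) := Subgroup.closure (insert iota (Set.range sigmaAut))

theorem sigmaAut_mem (i : Fin 3) : sigmaAut i ∈ nielsenGroup :=
  Subgroup.subset_closure (Or.inr ⟨i, rfl⟩)

theorem iota_mem : iota ∈ nielsenGroup := Subgroup.subset_closure (Or.inl rfl)

theorem sigmaAut_x (i : Fin 3) : sigmaAut i x = ![x, y, x] i := by
  fin_cases i <;> simp [sigmaAut, autF2_x]

theorem sigmaAut_y (i : Fin 3) : sigmaAut i y = ![y * x⁻¹, y * x⁻¹ * y, x⁻¹ * y] i := by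
  fin_cases i <;> simp [sigmaAut, autF2_y]

theorem sigmaAut_symm_x (i : Fin 3) : (sigmaAut i).symm x = ![x, x * y⁻¹ * x, x] i := by
  rw [MulEquiv.symm_apply_eq]
  fin_cases i <;> simp [sigmaAut_x, sigmaAut_y, mul_assoc]

theorem sigmaAut_symm_y (i : Fin 3) : (sigmaAut i).symm y = ![y * x, x, x * y] i := by
  rw [MulEquiv.symm_apply_eq]
  fin_cases i <;> simp [sigmaAut_x, sigmaAut_y, mul_assoc]

theorem iota_x : iota x = x⁻¹ := by simp [iota, autF2_x]

theorem iota_y : iota y = x⁻¹ * y * x⁻¹ := by simp [iota, autF2_y]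

theorem conj_x_eq : MulAut.conj x = sigmaAut 0 * (sigmaAut 2)⁻¹ := by
  apply mulAut_ext_F2 <;>
    simp [sigmaAut_x, sigmaAut_y, sigmaAut_symm_x, sigmaAut_symm_y, mul_assoc]

theorem conj_y_eq :
    MulAut.conj y = sigmaAut 1 * sigmaAut 0 * (sigmaAut 2)⁻¹ * (sigmaAut 1)⁻¹ := by
  apply mulAut_ext_F2 <;>
    simp [sigmaAut_x, sigmaAut_y, sigmaAut_symm_x, sigmaAut_symm_y, mul_assoc]

/-- Minimality in the Nielsen argument is taken up to conjugation, so the inner automorphisms must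
be available. -/
theorem conj_mem (g : F2) : MulAut.conj g ∈ nielsenGroup := by
  have h0 := sigmaAut_mem 0
  have h1 := sigmaAut_mem 1
  have h2 := sigmaAut_mem 2
  have hg : g ∈ Subgroup.closure (Set.range (FreeGroup.of : Fin 2 → F2)) := by
    rw [FreeGroup.closure_range_of]; trivial
  induction hg using Subgroup.closure_induction with
  | mem g hg =>
    obtain ⟨i, rfl⟩ := hg
    fin_cases i
    · change MulAut.conj x ∈ _
      rw [conj_x_eq]
      exact mul_mem h0 (inv_mem h2)
    · change MulAut.conj y ∈ _
      rw [conj_y_eq]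
      exact mul_mem (mul_mem (mul_mem h1 h0) (inv_mem h2)) (inv_mem h1)
  | one => rw [map_one]; exact one_mem _
  | mul g h _ _ hg hh => rw [map_mul]; exact mul_mem hg hh
  | inv g _ hg => rw [map_inv]; exact inv_mem hg

/-- The automorphism exchanging `x` and `y`. -/
def swapF2 : MulAut F2 :=
  autF2 y x y x (by simp [endF2_y]) (by simp [endF2_x]) (by simp [endF2_y]) (by simp [endF2_x])

/-- The automorphism inverting `x` and fixing `y`. -/
def invF2 : MulAut F2 :=
  autF2 x⁻¹ y x⁻¹ y (by simp [endF2_x]) (by simp [endF2_y]) (by simp [endF2_x])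
    (by simp [endF2_y])

theorem swapF2_x : swapF2 x = y := by simp [swapF2, autF2_x]

theorem swapF2_y : swapF2 y = x := by simp [swapF2, autF2_y]

theorem invF2_x : invF2 x = x⁻¹ := by simp [invF2, autF2_x]

theorem invF2_y : invF2 y = y := by simp [invF2, autF2_y]

theorem swapF2_mem : swapF2 ∈ nielsenGroup := by
  have h : swapF2 = (sigmaAut 0)⁻¹ * (sigmaAut 1)⁻¹ * (sigmaAut 2)⁻¹ * (sigmaAut 1)⁻¹ *
      (sigmaAut 0)⁻¹ * iota := by
    apply mulAut_ext_F2 <;>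
      simp [sigmaAut_symm_x, sigmaAut_symm_y, iota_x, iota_y, swapF2_x, swapF2_y, mul_assoc]
  rw [h]
  have h0 := inv_mem (sigmaAut_mem 0)
  have h1 := inv_mem (sigmaAut_mem 1)
  have h2 := inv_mem (sigmaAut_mem 2)
  exact mul_mem (mul_mem (mul_mem (mul_mem (mul_mem h0 h1) h2) h1) h0) iota_mem

theorem invF2_mem : invF2 ∈ nielsenGroup := by
  have h : invF2 = (sigmaAut 0)⁻¹ * (sigmaAut 2)⁻¹ * iota := by
    apply mulAut_ext_F2 <;>
      simp [sigmaAut_symm_x, sigmaAut_symm_y, iota_x, iota_y, invF2_x, invF2_y, mul_assoc]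
  rw [h]
  exact mul_mem (mul_mem (inv_mem (sigmaAut_mem 0)) (inv_mem (sigmaAut_mem 2))) iota_mem

/-- For letters `k`, `l` with different underlying generators there is a signed permutation
in `nielsenGroup` with `x ↦ k` and `y ↦ l`. -/
theorem exists_signed_perm {k l : Letter} (hkl : k.1 ≠ l.1) :
    ∃ γ ∈ nielsenGroup, γ x = FreeGroup.mk [k] ∧ γ y = FreeGroup.mk [l] := by
  have hs := swapF2_mem
  have hi := invF2_mem
  have hj : swapF2 * invF2 * swapF2 ∈ nielsenGroup := mul_mem (mul_mem hs hi) hs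
  have ex : (FreeGroup.mk [(0, true)] : F2) = x := rfl
  have ey : (FreeGroup.mk [(1, true)] : F2) = y := rfl
  have ex' : (FreeGroup.mk [(0, false)] : F2) = x⁻¹ := rfl
  have ey' : (FreeGroup.mk [(1, false)] : F2) = y⁻¹ := rfl
  obtain ⟨k1, k2⟩ := k
  obtain ⟨l1, l2⟩ := l
  fin_cases k1 <;> fin_cases l1 <;> (try exact absurd rfl hkl) <;>
    cases k2 <;> cases l2 <;> simp only [Fin.zero_eta, Fin.mk_one, ex, ey, ex', ey']
  · exact ⟨invF2 * (swapF2 * invF2 * swapF2), mul_mem hi hj,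
      by simp [swapF2_x, swapF2_y, invF2_x, invF2_y],
      by simp [swapF2_x, swapF2_y, invF2_x, invF2_y]⟩
  · exact ⟨invF2, hi, invF2_x, invF2_y⟩
  · exact ⟨swapF2 * invF2 * swapF2, hj,
      by simp [swapF2_x, swapF2_y, invF2_y], by simp [swapF2_x, swapF2_y, invF2_x]⟩
  · exact ⟨1, one_mem _, rfl, rfl⟩
  · exact ⟨swapF2 * (invF2 * (swapF2 * invF2 * swapF2)), mul_mem hs (mul_mem hi hj),
      by simp [swapF2_x, swapF2_y, invF2_x, invF2_y],
      by simp [swapF2_x, swapF2_y, invF2_x, invF2_y]⟩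
  · exact ⟨swapF2 * invF2, mul_mem hs hi,
      by simp [swapF2_x, invF2_x], by simp [swapF2_y, invF2_y]⟩
  · exact ⟨swapF2 * (swapF2 * invF2 * swapF2), mul_mem hs hj,
      by simp [swapF2_x, swapF2_y, invF2_y], by simp [swapF2_x, swapF2_y, invF2_x]⟩
  · exact ⟨swapF2, hs, swapF2_x, swapF2_y⟩

theorem map_mk_letter {G : Type*} [Group G] (φ : F2 →* G) (k : Letter) :
    φ (FreeGroup.mk [k]) = cond k.2 (φ (FreeGroup.of k.1)) (φ (FreeGroup.of k.1))⁻¹ := by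
  obtain ⟨k1, k2⟩ := k
  cases k2
  · rw [show (FreeGroup.mk [(k1, false)] : F2) = (FreeGroup.of k1)⁻¹ from rfl, map_inv]
    rfl
  · rfl

/-- The automorphisms `x ↦ y⁻¹ x`, `y ↦ y` up to signed permutations on both sides. -/
theorem exists_move {k l : Letter} (hkl : k.1 ≠ l.1) :
    ∃ γ ∈ nielsenGroup,
      (k.1 = 0 → γ x = x ∧ (γ y = (FreeGroup.mk [k])⁻¹ * FreeGroup.mk [l] ∨
        γ y = ((FreeGroup.mk [k])⁻¹ * FreeGroup.mk [l])⁻¹)) ∧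
      (k.1 = 1 → γ x = y ∧ (γ y = (FreeGroup.mk [k])⁻¹ * FreeGroup.mk [l] ∨
        γ y = ((FreeGroup.mk [k])⁻¹ * FreeGroup.mk [l])⁻¹)) := by
  obtain ⟨δ, hδ, h1, h2⟩ := exists_signed_perm hkl
  refine ⟨δ * sigmaAut 2 * cond k.2 1 invF2, mul_mem (mul_mem hδ (sigmaAut_mem 2)) ?_, ?_, ?_⟩
  · cases k.2
    · exact invF2_mem
    · exact one_mem _
  all_goals
    intro hk
    obtain ⟨k1, k2⟩ := k
    simp only at hk
    subst hk
    cases k2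
    · simp [invF2_x, invF2_y, sigmaAut_x, sigmaAut_y, h1, h2]
      rfl
    · simp [sigmaAut_x, sigmaAut_y, h1, h2]
      rfl

/-- Among the $\alpha\gamma$ with $\gamma$ in the subgroup, take one of minimal total length. It is
shortest in the sense of `IsShortest`, so the preimages of $x$ and $y$ are single letters, and the
automorphism is a signed permutation. -/
theorem nielsenGroup_eq_top : nielsenGroup = ⊤ := by
  rw [eq_top_iff]
  intro α _
  obtain ⟨γ, hγ, hmin⟩ := (measure fun γ : MulAut F2 =>
    (α (γ x)).norm + (α (γ y)).norm).wf.has_min (nielsenGroup : Set (MulAut F2)) ⟨1, one_mem _⟩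
  obtain ⟨β, hβ⟩ : ∃ β, β = α * γ := ⟨_, rfl⟩
  have hs : IsShortest (β : F2 →* F2) := by
    intro k l hkl r
    obtain ⟨μ, hμ, h0, h1⟩ := exists_move hkl
    -- Precomposing with conjugation by $\beta^{-1}(r^{-1})$ amounts to conjugating the images under
    -- $\beta$ by $r^{-1}$.
    have h2 := hmin (γ * (MulAut.conj (β.symm r⁻¹) * μ))
      (mul_mem hγ (mul_mem (conj_mem _) hμ))
    have hinv (g : F2) : (r⁻¹ * (β g)⁻¹ * r).norm = (r⁻¹ * β g * r).norm := by
      rw [← FreeGroup.norm_inv_eq]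
      congr 1
      group
    have h3 (g : F2) : α ((γ * (MulAut.conj (β.symm r⁻¹) * μ)) g) = r⁻¹ * β (μ g) * r := by
      have : α ((γ * (MulAut.conj (β.symm r⁻¹) * μ)) g) =
        β (β.symm r⁻¹ * μ g * (β.symm r⁻¹)⁻¹) := by rw [hβ]; rfl
      rw [this]
      simp
    have hl : (β (FreeGroup.mk [k])).norm + (β (FreeGroup.mk [l])).norm =
        (α (γ x)).norm + (α (γ y)).norm := by
      have e (g) : α (γ g) = β g := by rw [hβ]; rfl
      have e2 (m : Letter) : (β (FreeGroup.mk [m])).norm = (β (FreeGroup.of m.1)).norm := by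
        have := map_mk_letter (β : F2 →* F2) m
        simp only [MonoidHom.coe_coe] at this
        rw [this]
        cases m.2
        · exact FreeGroup.norm_inv_eq
        · rfl
      rw [e, e, e2, e2]
      obtain ⟨k1, k2⟩ := k
      obtain ⟨l1, l2⟩ := l
      fin_cases k1 <;> fin_cases l1 <;> (try exact absurd rfl hkl)
      · rfl
      · exact add_comm _ _
    have hk : (r⁻¹ * β (FreeGroup.mk [k]) * r).norm = (r⁻¹ * β (FreeGroup.of k.1) * r).norm := by
      have := map_mk_letter (β : F2 →* F2) k
      simp only [MonoidHom.coe_coe] at this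
      rw [this]
      cases k.2
      · exact hinv _
      · rfl
    simp only [MonoidHom.coe_coe]
    rw [hl, hk, ← map_inv, ← map_mul]
    refine (not_lt.mp h2).trans (le_of_eq ?_)
    simp only [h3]
    obtain ⟨k1, k2⟩ := k
    fin_cases k1
    · obtain ⟨hx, hy | hy⟩ := h0 rfl
      · rw [hx, hy]; rfl
      · rw [hx, hy, map_inv, hinv]; rfl
    · obtain ⟨hx, hy | hy⟩ := h1 rfl
      · rw [hx, hy]; rfl
      · rw [hx, hy, map_inv, hinv]; rfl
  have hne (k : Letter) : (β : F2 →* F2) (FreeGroup.mk [k]) ≠ 1 := by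
    intro h
    have h2 := β.injective (h.trans (map_one β).symm)
    have := congrArg FreeGroup.norm h2
    rw [norm_mk_of_isReduced FreeGroup.IsReduced.singleton, FreeGroup.norm_one] at this
    simp at this
  obtain ⟨k, hk⟩ := hs.exists_letter hne (w := β.symm x) (by
    rw [MonoidHom.coe_coe, MulEquiv.apply_symm_apply]; exact FreeGroup.norm_of _)
  obtain ⟨l, hl⟩ := hs.exists_letter hne (w := β.symm y) (by
    rw [MonoidHom.coe_coe, MulEquiv.apply_symm_apply]; exact FreeGroup.norm_of _)
  have hkl : k.1 ≠ l.1 := by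
    intro h
    rcases Letter.eq_or_eq_inv h with rfl | rfl
    · exact absurd (β.symm.injective (hk.trans hl.symm)) (by decide)
    · rw [mk_letter_inv, ← hl, ← map_inv] at hk
      exact absurd (β.symm.injective hk) (by decide)
  obtain ⟨δ, hδ, hx, hy⟩ := exists_signed_perm hkl
  have h1 : β * δ = 1 := by
    apply mulAut_ext_F2
    · rw [MulAut.mul_apply, hx, ← hk, MulEquiv.apply_symm_apply]; rfl
    · rw [MulAut.mul_apply, hy, ← hl, MulEquiv.apply_symm_apply]; rfl
  have h2 : α = δ⁻¹ * γ⁻¹ := by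
    rw [eq_mul_inv_iff_mul_eq, ← hβ]
    exact eq_inv_of_mul_eq_one_left h1
  rw [h2]
  exact mul_mem (inv_mem hδ) (inv_mem hγ)

/-! ### The kernel of `B₄ → Aut(F₂)` -/

/-- A normal form for quotients of $B_3$, modelled on $\mathrm{PSL}_2(\mathbb Z)\cong\mathbb
Z/2*\mathbb Z/3$ with $S=aba$ and $U=ab$, where $z=S^2=U^3$ is central. The middle factor is a
positive word in $b$ and $a^{-1}$, the two letters that become nonnegative matrices in `sigmaSL2`.
-/
theorem braid_normal_form {G : Type*} [Group G] (a b : G) (h : a * b * a = b * a * b)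
    (htop : Subgroup.closure {a, b} = ⊤) (g : G) :
    ∃ (e : ℤ) (i f : ℕ) (L : List Bool), i < 3 ∧ f < 2 ∧
      g = (a * b * a * (a * b * a)) ^ e * (a * b) ^ i *
        (L.map fun t => cond t b a⁻¹).prod * (a * b * a) ^ f := by
  obtain ⟨S, hS⟩ : ∃ S, S = a * b * a := ⟨_, rfl⟩
  obtain ⟨U, hU⟩ : ∃ U, U = a * b := ⟨_, rfl⟩
  obtain ⟨z, hz⟩ : ∃ z, z = S * S := ⟨_, rfl⟩
  rw [← hS, ← hU, ← hz]
  have hSa : S * a = b * S := by rw [hS]; nth_rewrite 1 [h]; group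
  have hSb : S * b = a * S := by rw [hS]; nth_rewrite 2 [h]; group
  have hza : Commute z a := by
    rw [Commute, SemiconjBy, hz, mul_assoc, hSa, ← mul_assoc, hSb, mul_assoc]
  have hzb : Commute z b := by
    rw [Commute, SemiconjBy, hz, mul_assoc, hSb, ← mul_assoc, hSa, mul_assoc]
  have hzU : Commute z U := by rw [hU]; exact hza.mul_right hzb
  have hzS : Commute z S := by rw [hz]; exact (Commute.refl S).mul_left (Commute.refl S)
  have hSUa : S = U * a := by rw [hS, hU]
  have hU3 : U * (U * U) = z := by
    have e : S = b * U := by rw [hS, h, hU, mul_assoc]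
    rw [hz]; nth_rewrite 1 [hSUa]; rw [e, hU]; group
  have hSU : S * U = z * a⁻¹ := by
    rw [hz, hSUa]; group
  have hSUU : S * (U * U) = z * b := by
    rw [← mul_assoc, hSU, hU]; group
  -- The letters $a^{\pm1}$, $b^{\pm1}$ are $z^{-1}$ times positive words in $S$ and $U$. So it is
  -- enough that the set of normal forms is stable under left multiplication by powers of $z$, by
  -- $U$ and by $S$.
  let P : G → Prop := fun g => ∃ (e : ℤ) (i f : ℕ) (L : List Bool), i < 3 ∧ f < 2 ∧
      g = z ^ e * U ^ i * (L.map fun t => cond t b a⁻¹).prod * S ^ f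
  have Pz : ∀ (n : ℤ) (g : G), P g → P (z ^ n * g) := by
    rintro n g ⟨e, i, f, L, hi, hf, rfl⟩
    exact ⟨n + e, i, f, L, hi, hf, by rw [zpow_add]; simp only [mul_assoc]⟩
  have PU : ∀ g : G, P g → P (U * g) := by
    rintro g ⟨e, i, f, L, hi, hf, rfl⟩
    have e1 : U * (z ^ e * U ^ i * (L.map fun t => cond t b a⁻¹).prod * S ^ f) =
        z ^ e * (U * U ^ i * (L.map fun t => cond t b a⁻¹).prod * S ^ f) := by
      rw [mul_assoc, mul_assoc, ← mul_assoc, ← (hzU.zpow_left e).eq]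
      simp only [mul_assoc]
    rw [e1]
    apply Pz
    by_cases h2 : i = 2
    · subst h2
      refine ⟨1, 0, f, L, by omega, hf, ?_⟩
      rw [pow_two, hU3, zpow_one, pow_zero, mul_one]
    · exact ⟨0, i + 1, f, L, by omega, hf, by rw [zpow_zero, one_mul, pow_succ']⟩
  have PS : ∀ g : G, P g → P (S * g) := by
    rintro g ⟨e, i, f, L, hi, hf, rfl⟩
    have e1 : S * (z ^ e * U ^ i * (L.map fun t => cond t b a⁻¹).prod * S ^ f) =
        z ^ e * (S * U ^ i * (L.map fun t => cond t b a⁻¹).prod * S ^ f) := by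
      rw [mul_assoc, mul_assoc, ← mul_assoc, ← (hzS.zpow_left e).eq]
      simp only [mul_assoc]
    rw [e1]
    apply Pz
    -- The rewriting rules are $Sa^{-1}=U$, $Sb=U^2$, $SU=za^{-1}$ and $SU^2=zb$.
    interval_cases i
    · cases L with
      | nil =>
        interval_cases f
        · exact ⟨0, 0, 1, [], by omega, by omega, by simp⟩
        · exact ⟨1, 0, 0, [], by omega, by omega, by simp [hz]⟩
      | cons t L =>
        cases t
        · refine ⟨0, 1, f, L, by omega, hf, ?_⟩
          have : S * a⁻¹ = U := by rw [hSUa]; group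
          simp [← mul_assoc, this]
        · refine ⟨0, 2, f, L, by omega, hf, ?_⟩
          have : S * b = U ^ 2 := by
            rw [hSb, hS, h, pow_two, hU]; group
          simp [← mul_assoc, this]
    · refine ⟨1, 0, f, false :: L, by omega, hf, ?_⟩
      simp [← mul_assoc, hSU]
    · refine ⟨1, 0, f, true :: L, by omega, hf, ?_⟩
      simp [← mul_assoc, pow_two]
      rw [mul_assoc S, hSUU]
  have Pa : ∀ g, P g → P (a * g) := by
    intro g hg
    have : a * g = z ^ (-1 : ℤ) * (U * (U * (S * g))) := by
      rw [← hU3, hSUa]; group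
    rw [this]
    exact Pz _ _ (PU _ (PU _ (PS _ hg)))
  have Pa' : ∀ g, P g → P (a⁻¹ * g) := by
    intro g hg
    have : a⁻¹ * g = z ^ (-1 : ℤ) * (S * (U * g)) := by
      rw [← mul_assoc S, hSU]; group
    rw [this]
    exact Pz _ _ (PS _ (PU _ hg))
  have Pb : ∀ g, P g → P (b * g) := by
    intro g hg
    have : b * g = z ^ (-1 : ℤ) * (S * (U * (U * g))) := by
      rw [← mul_assoc U, ← mul_assoc S, hSUU]; group
    rw [this]
    exact Pz _ _ (PS _ (PU _ (PU _ hg)))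
  have Pb' : ∀ g, P g → P (b⁻¹ * g) := by
    intro g hg
    have hUS : U * S = z * b⁻¹ := by
      rw [eq_mul_inv_iff_mul_eq, mul_assoc, hSb, ← hU3, hS, h, hU]; group
    have : b⁻¹ * g = z ^ (-1 : ℤ) * (U * (S * g)) := by
      rw [← mul_assoc U, hUS]; group
    rw [this]
    exact Pz _ _ (PU _ (PS _ hg))
  have hg : g ∈ Subgroup.closure {a, b} := by rw [htop]; trivial
  induction hg using Subgroup.closure_induction_left with
  | one => exact ⟨0, 0, 0, [], by omega, by omega, by simp⟩
  | mul_left c hc d _ hd =>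
    rcases hc with rfl | rfl
    · exact Pa _ hd
    · exact Pb _ hd
  | inv_mul_cancel c hc d _ hd =>
    rcases hc with rfl | rfl
    · exact Pa' _ hd
    · exact Pb' _ hd

/-- The images of `σ₁, σ₂, σ₃` in `SL₂(ℤ)`. -/
def sigmaSL2 : Fin 3 → Matrix.SpecialLinearGroup (Fin 2) ℤ :=
  ![⟨!![1, -1; 0, 1], by decide⟩, ⟨!![1, 0; 1, 1], by decide⟩, ⟨!![1, -1; 0, 1], by decide⟩]

/-- The homomorphism `B₄ → SL₂(ℤ)` with `σ₁, σ₃ ↦ (1, -1; 0, 1)` and `σ₂ ↦ (1, 0; 1, 1)`. -/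
def toSL2 : B4 →* Matrix.SpecialLinearGroup (Fin 2) ℤ :=
  PresentedGroup.toGroup (f := sigmaSL2) (by
    intro r hr
    rcases hr with rfl | rfl | rfl
    all_goals
      rw [map_mul, map_inv, mul_inv_eq_one]
      simp only [map_mul, FreeGroup.lift_apply_of]
      decide)

theorem toSL2_sigma (i : Fin 3) : toSL2 (sigma i) = sigmaSL2 i := PresentedGroup.toGroup.of _

theorem mulVec_fin_two_zero (A : Matrix (Fin 2) (Fin 2) ℤ) (v : Fin 2 → ℤ) :
    A.mulVec v 0 = A 0 0 * v 0 + A 0 1 * v 1 := by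
  simp [Matrix.mulVec, dotProduct, Fin.sum_univ_two]

theorem mulVec_fin_two_one (A : Matrix (Fin 2) (Fin 2) ℤ) (v : Fin 2 → ℤ) :
    A.mulVec v 1 = A 1 0 * v 0 + A 1 1 * v 1 := by
  simp [Matrix.mulVec, dotProduct, Fin.sum_univ_two]

theorem toAutF2_sigma (i : Fin 3) : toAutF2 (sigma i) = sigmaAut i := PresentedGroup.toGroup.of _

/-- The exponent sums of an element of `F₂`, in the basis given by `x` and `y x⁻¹`. -/
def expSum : F2 →* Multiplicative (Fin 2 → ℤ) :=
  FreeGroup.lift ![Multiplicative.ofAdd ![1, 0], Multiplicative.ofAdd ![1, 1]]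

theorem expSum_x : expSum x = Multiplicative.ofAdd ![1, 0] := by simp [expSum, x]

theorem expSum_y : expSum y = Multiplicative.ofAdd ![1, 1] := by simp [expSum, y]

theorem sigma_closure : Subgroup.closure (Set.range sigma) = ⊤ :=
  PresentedGroup.closure_range_of _

/-- `toSL2` is the action on the abelianization of $F_2$; the basis $x$, $yx^{-1}$ is chosen so that
$\sigma_1$ and $\sigma_2$ become the elementary matrices of `sigmaSL2`. -/
theorem expSum_toAutF2 (β : B4) (g : F2) :
    (expSum (toAutF2 β g)).toAdd = (toSL2 β).1.mulVec (expSum g).toAdd := by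
  have h (A : Matrix (Fin 2) (Fin 2) ℤ) (f : F2 →* F2)
      (hx : (expSum (f x)).toAdd = A.mulVec ![1, 0]) (hy : (expSum (f y)).toAdd = A.mulVec ![1, 1])
      (g : F2) : (expSum (f g)).toAdd = A.mulVec (expSum g).toAdd := by
    have : expSum.comp f = (AddMonoidHom.toMultiplicative A.mulVecLin.toAddMonoidHom).comp
        expSum := by
      apply hom_ext_F2
      · apply Multiplicative.toAdd.injective
        simp only [MonoidHom.comp_apply, expSum_x]
        exact hx
      · apply Multiplicative.toAdd.injective
        simp only [MonoidHom.comp_apply, expSum_y]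
        exact hy
    exact congrArg Multiplicative.toAdd (DFunLike.congr_fun this g)
  have hβ : β ∈ Subgroup.closure (Set.range sigma) := by rw [sigma_closure]; trivial
  have hs (i : Fin 3) (g : F2) : (expSum (toAutF2 (sigma i) g)).toAdd =
      (toSL2 (sigma i)).1.mulVec (expSum g).toAdd := by
    apply h _ (toAutF2 (sigma i) : F2 →* F2)
    all_goals
      simp only [MonoidHom.coe_coe]
      rw [toAutF2_sigma, toSL2_sigma]
      apply funext
      intro j
      fin_cases i <;> fin_cases j <;>
        simp [sigmaAut_x, sigmaAut_y, expSum_x, expSum_y, sigmaSL2, mulVec_fin_two_zero,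
          mulVec_fin_two_one]
  induction hβ using Subgroup.closure_induction_left generalizing g with
  | one => simp
  | mul_left c hc d _ hd =>
    obtain ⟨i, rfl⟩ := hc
    rw [map_mul, map_mul, MulAut.mul_apply, hs, hd, Matrix.mulVec_mulVec,
      Matrix.SpecialLinearGroup.coe_mul]
  | inv_mul_cancel c hc d _ hd =>
    obtain ⟨i, rfl⟩ := hc
    rw [map_mul, map_mul, map_inv, map_inv, MulAut.mul_apply]
    have := hs i ((toAutF2 (sigma i))⁻¹ (toAutF2 d g))
    rw [MulAut.apply_inv_self, hd] at this
    rw [Matrix.SpecialLinearGroup.coe_mul, ← Matrix.mulVec_mulVec, this, Matrix.mulVec_mulVec,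
      ← Matrix.SpecialLinearGroup.coe_mul, inv_mul_cancel]
    simp

theorem toSL2_col (β : B4) :
    (expSum (toAutF2 β x)).toAdd = ![(toSL2 β).1 0 0, (toSL2 β).1 1 0] ∧
      (expSum (toAutF2 β y)).toAdd =
        ![(toSL2 β).1 0 0 + (toSL2 β).1 0 1, (toSL2 β).1 1 0 + (toSL2 β).1 1 1] := by
  rw [expSum_toAutF2, expSum_toAutF2, expSum_x, expSum_y]
  constructor
  all_goals
    apply funext
    intro j
    fin_cases j <;> simp [mulVec_fin_two_zero, mulVec_fin_two_one]

theorem toSL2_eq_one {β : B4} (h : toAutF2 β = 1) : toSL2 β = 1 := by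
  obtain ⟨hx, hy⟩ := toSL2_col β
  rw [h, MulAut.one_apply, expSum_x, toAdd_ofAdd] at hx
  rw [h, MulAut.one_apply, expSum_y, toAdd_ofAdd] at hy
  have hx0 := congrFun hx 0
  have hx1 := congrFun hx 1
  have hy0 := congrFun hy 0
  have hy1 := congrFun hy 1
  simp only [Matrix.cons_val_zero, Matrix.cons_val_one] at hx0 hx1 hy0 hy1
  apply Subtype.ext
  ext i j
  fin_cases i <;> fin_cases j <;> simp <;> omega

/-- Braids act on the abelianization with determinant $1$, and `iota` with determinant $-1$. -/
theorem toAutF2_ne_iota (β : B4) : toAutF2 β ≠ iota := by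
  intro h
  obtain ⟨hx, hy⟩ := toSL2_col β
  rw [h, iota_x, map_inv, expSum_x, toAdd_inv, toAdd_ofAdd] at hx
  rw [h, iota_y, map_mul expSum, map_mul expSum, map_inv expSum, expSum_y, expSum_x, toAdd_mul,
    toAdd_mul, toAdd_inv, toAdd_ofAdd, toAdd_ofAdd] at hy
  have hx0 := congrFun hx 0
  have hx1 := congrFun hx 1
  have hy0 := congrFun hy 0
  have hy1 := congrFun hy 1
  simp at hx0 hx1 hy0 hy1
  have hd := (toSL2 β).2
  rw [Matrix.det_fin_two, ← hx0, ← hx1] at hd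
  omega

/-- The monoid generated by the two nonnegative elementary matrices: entries only grow, and any
letter leaves a positive off-diagonal entry. -/
theorem positive_word (L : List Bool) :
    let A := (L.map fun t => cond t (sigmaSL2 1) (sigmaSL2 0)⁻¹).prod.1
    1 ≤ A 0 0 ∧ 0 ≤ A 0 1 ∧ 0 ≤ A 1 0 ∧ 1 ≤ A 1 1 ∧ (L ≠ [] → 1 ≤ A 0 1 + A 1 0) := by
  induction L with
  | nil => simp
  | cons t L ih =>
    intro A
    obtain ⟨B, hB⟩ : ∃ B, B = (L.map fun t => cond t (sigmaSL2 1) (sigmaSL2 0)⁻¹).prod.1 := ⟨_, rfl⟩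
    rw [← hB] at ih
    obtain ⟨h1, h2, h3, h4, -⟩ := ih
    have hA : A = (cond t (sigmaSL2 1) (sigmaSL2 0)⁻¹).1 * B := by
      rw [hB, ← Matrix.SpecialLinearGroup.coe_mul, ← List.prod_cons]
      rfl
    have h00 : (sigmaSL2 1).1 = !![1, 0; 1, 1] := rfl
    have h11 : (sigmaSL2 0)⁻¹.1 = !![1, 1; 0, 1] := by decide
    rw [hA]
    clear_value A
    cases t <;> simp only [cond_true, cond_false, h00, h11, Matrix.mul_apply, Fin.sum_univ_two,
      Matrix.of_apply, Matrix.cons_val', Matrix.cons_val_zero, Matrix.cons_val_one,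
      Matrix.cons_val_fin_one] <;> omega

/-- The kernel of the normal form in `SL₂(ℤ)`. -/
theorem normal_form_eq_one {e : ℤ} {i f : ℕ} {L : List Bool} (hi : i < 3) (hf : f < 2)
    (h : (sigmaSL2 0 * sigmaSL2 1 * sigmaSL2 0 * (sigmaSL2 0 * sigmaSL2 1 * sigmaSL2 0)) ^ e *
      (sigmaSL2 0 * sigmaSL2 1) ^ i * (L.map fun t => cond t (sigmaSL2 1) (sigmaSL2 0)⁻¹).prod *
      (sigmaSL2 0 * sigmaSL2 1 * sigmaSL2 0) ^ f = 1) :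
    i = 0 ∧ f = 0 ∧ L = [] ∧ Even e := by
  have hz : sigmaSL2 0 * sigmaSL2 1 * sigmaSL2 0 * (sigmaSL2 0 * sigmaSL2 1 * sigmaSL2 0) = -1 := by
    decide
  have hS : ((sigmaSL2 0 * sigmaSL2 1 * sigmaSL2 0) ^ 1).1 = !![0, -1; 1, 0] := by decide
  have hU : ((sigmaSL2 0 * sigmaSL2 1) ^ 1).1 = !![0, -1; 1, 1] := by decide
  have hU2 : ((sigmaSL2 0 * sigmaSL2 1) ^ 2).1 = !![-1, -1; 1, 0] := by decide
  obtain ⟨h1, h2, h3, h4, h5⟩ := positive_word L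
  obtain ⟨P, hP⟩ : ∃ P, P = (L.map fun t => cond t (sigmaSL2 1) (sigmaSL2 0)⁻¹).prod := ⟨_, rfl⟩
  rw [← hP] at h h1 h2 h3 h4 h5
  rw [hz] at h
  have key : (sigmaSL2 0 * sigmaSL2 1) ^ i * P * (sigmaSL2 0 * sigmaSL2 1 * sigmaSL2 0) ^ f = 1 ∨
      (sigmaSL2 0 * sigmaSL2 1) ^ i * P * (sigmaSL2 0 * sigmaSL2 1 * sigmaSL2 0) ^ f = -1 := by
    rw [mul_assoc, mul_assoc, ← mul_assoc (_ ^ i)] at h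
    rcases Int.even_or_odd e with he | he
    · rw [he.neg_one_zpow, one_mul] at h
      exact Or.inl h
    · rw [he.neg_one_zpow, neg_one_mul, neg_eq_iff_eq_neg] at h
      exact Or.inr h
  have key' (A : Matrix.SpecialLinearGroup (Fin 2) ℤ) (hA : A = 1 ∨ A = -1) :
      A.1 0 1 = 0 ∧ A.1 1 0 = 0 := by
    rcases hA with rfl | rfl <;> simp
  obtain ⟨k1, k2⟩ := key' _ key
  -- The off-diagonal entries of $U^iPS^f$ must vanish. As $P$ is nonnegative with positive
  -- diagonal, this fails for the five other pairs $(i,f)$.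
  have hL : f = 0 ∧ i = 0 := by
    rw [Matrix.SpecialLinearGroup.coe_mul, Matrix.SpecialLinearGroup.coe_mul] at k1 k2
    interval_cases f <;> interval_cases i
    · simp
    all_goals
      exfalso
      simp only [pow_zero, Matrix.SpecialLinearGroup.coe_one, one_mul, mul_one, hU, hU2, hS,
        Matrix.one_fin_two, Matrix.mul_apply, Fin.sum_univ_two, Matrix.of_apply, Matrix.cons_val',
        Matrix.cons_val_zero, Matrix.cons_val_one, Matrix.cons_val_fin_one] at k1 k2
      omega
  obtain ⟨rfl, rfl⟩ := hL
  simp only [pow_zero, one_mul, mul_one] at h k1 k2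
  have hL : L = [] := by
    by_contra hL
    have := h5 hL
    omega
  subst hL
  refine ⟨rfl, rfl, rfl, ?_⟩
  by_contra he
  rw [Int.not_even_iff_odd] at he
  rw [he.neg_one_zpow, hP] at h
  exact absurd h (by decide)

theorem sigma_rel_of_mem {r s : FreeGroup (Fin 3)} (h : r * s⁻¹ ∈ braidRels) :
    PresentedGroup.mk braidRels r = PresentedGroup.mk braidRels s := by
  rw [← mul_inv_eq_one, ← map_inv, ← map_mul]
  exact PresentedGroup.one_of_mem h

theorem sigma_braid₁ : sigma 0 * sigma 1 * sigma 0 = sigma 1 * sigma 0 * sigma 1 :=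
  sigma_rel_of_mem (Or.inl rfl)

theorem sigma_braid₂ : sigma 1 * sigma 2 * sigma 1 = sigma 2 * sigma 1 * sigma 2 :=
  sigma_rel_of_mem (Or.inr (Or.inl rfl))

theorem sigma_comm : sigma 0 * sigma 2 = sigma 2 * sigma 0 :=
  sigma_rel_of_mem (Or.inr (Or.inr rfl))

/-- The homomorphism `F₂ → B₄` that lifts the inner automorphisms of `F₂`. -/
def innerLift : F2 →* B4 :=
  FreeGroup.lift ![sigma 0 * (sigma 2)⁻¹, sigma 1 * (sigma 0 * (sigma 2)⁻¹) * (sigma 1)⁻¹]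

theorem innerLift_x : innerLift x = sigma 0 * (sigma 2)⁻¹ := by simp [innerLift, x]

theorem innerLift_y : innerLift y = sigma 1 * (sigma 0 * (sigma 2)⁻¹) * (sigma 1)⁻¹ := by
  simp [innerLift, y]

theorem toAutF2_innerLift (f : F2) : toAutF2 (innerLift f) = MulAut.conj f := by
  have : toAutF2.comp innerLift = MulAut.conj := by
    apply hom_ext_F2
    · rw [MonoidHom.comp_apply, innerLift_x, conj_x_eq]
      simp [toAutF2_sigma]
    · rw [MonoidHom.comp_apply, innerLift_y, conj_y_eq]
      simp [toAutF2_sigma, mul_assoc]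
  exact DFunLike.congr_fun this f

/-- The identities behind the normality of the range of `innerLift`. -/
theorem braid_conj {G : Type*} [Group G] {a b c : G} (hab : a * b * a = b * a * b)
    (hbc : b * c * b = c * b * c) (hac : a * c = c * a) :
    a * (b * (a * c⁻¹) * b⁻¹) * a⁻¹ = b * (a * c⁻¹) * b⁻¹ * (a * c⁻¹)⁻¹ ∧
    c * (b * (a * c⁻¹) * b⁻¹) * c⁻¹ = (a * c⁻¹)⁻¹ * (b * (a * c⁻¹) * b⁻¹) ∧
    b * (b * (a * c⁻¹) * b⁻¹) * b⁻¹ =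
      b * (a * c⁻¹) * b⁻¹ * (a * c⁻¹)⁻¹ * (b * (a * c⁻¹) * b⁻¹) ∧
    a * (a * c⁻¹) * a⁻¹ = a * c⁻¹ ∧ c * (a * c⁻¹) * c⁻¹ = a * c⁻¹ := by
  have h1 : c⁻¹ * b⁻¹ * c = b * c⁻¹ * b⁻¹ := by
    rw [eq_mul_inv_iff_mul_eq, eq_mul_inv_iff_mul_eq]
    have : c⁻¹ * b⁻¹ * c * b * c = c⁻¹ * b⁻¹ * (c * b * c) := by group
    rw [this, ← hbc]; group
  have h2 : a⁻¹ * b * a = b * a * b⁻¹ := by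
    rw [eq_mul_inv_iff_mul_eq]
    have : a⁻¹ * b * a * b = a⁻¹ * (b * a * b) := by group
    rw [this, ← hab]; group
  have h3 : a * c⁻¹ = c⁻¹ * a := by
    rw [mul_inv_eq_iff_eq_mul, mul_assoc, hac]; group
  have h4 : c⁻¹ * b⁻¹ * c⁻¹ = b⁻¹ * c⁻¹ * b⁻¹ := by
    have := congrArg (·⁻¹) hbc
    simp only [mul_inv_rev, ← mul_assoc] at this
    exact this.symm
  refine ⟨?_, ?_, ?_, ?_, ?_⟩
  · calc a * (b * (a * c⁻¹) * b⁻¹) * a⁻¹ = (a * b * a) * c⁻¹ * b⁻¹ * a⁻¹ := by group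
      _ = b * a * (b * c⁻¹ * b⁻¹) * a⁻¹ := by rw [hab]; group
      _ = _ := by rw [← h1]; group
  · calc c * (b * (a * c⁻¹) * b⁻¹) * c⁻¹ = c * (b * a * (c⁻¹ * b⁻¹ * c⁻¹)) := by group
      _ = c * (b * a * b⁻¹ * c⁻¹ * b⁻¹) := by rw [h4]; group
      _ = _ := by rw [← h2]; group
  · symm
    calc b * (a * c⁻¹) * b⁻¹ * (a * c⁻¹)⁻¹ * (b * (a * c⁻¹) * b⁻¹) =
          b * a * (c⁻¹ * b⁻¹ * c) * (a⁻¹ * b * a) * c⁻¹ * b⁻¹ := by group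
      _ = b * a * b * (c⁻¹ * a) * (b⁻¹ * c⁻¹ * b⁻¹) := by rw [h1, h2]; group
      _ = b * a * b * a * (c⁻¹ * b⁻¹ * c⁻¹) * b⁻¹ := by rw [← h3]; group
      _ = b * (a * b * a) * b⁻¹ * c⁻¹ * b⁻¹ * b⁻¹ := by rw [h4]; group
      _ = _ := by rw [hab]; group
  · rw [mul_inv_eq_iff_eq_mul, mul_assoc a c⁻¹ a, h3]
  · rw [mul_inv_eq_iff_eq_mul, ← mul_assoc, ← hac, inv_mul_cancel_right]; group

/-- Conjugation by braids on the lifted copy of $F_2$ is the action of $B_4$ on $F_2$; `braid_conj`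
verifies it on generators. Hence the range of `innerLift` is normal. -/
theorem mul_innerLift_mul_inv (β : B4) (f : F2) :
    β * innerLift f * β⁻¹ = innerLift (toAutF2 β f) := by
  have hs (i : Fin 3) (f : F2) :
      sigma i * innerLift f * (sigma i)⁻¹ = innerLift (toAutF2 (sigma i) f) := by
    have : (MulAut.conj (sigma i)).toMonoidHom.comp innerLift =
        innerLift.comp (toAutF2 (sigma i)).toMonoidHom := by
      obtain ⟨h1, h2, h3, h4, h5⟩ := braid_conj sigma_braid₁ sigma_braid₂ sigma_comm
      apply hom_ext_F2
      · simp only [MonoidHom.comp_apply, MulEquiv.coe_toMonoidHom, MulAut.conj_apply,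
          toAutF2_sigma, sigmaAut_x, innerLift_x]
        fin_cases i
        · exact h4.trans innerLift_x.symm
        · exact innerLift_y.symm
        · exact h5.trans innerLift_x.symm
      · simp only [MonoidHom.comp_apply, MulEquiv.coe_toMonoidHom, MulAut.conj_apply,
          toAutF2_sigma, sigmaAut_y, innerLift_y]
        fin_cases i
        · simpa [innerLift_x, innerLift_y, mul_assoc] using h1
        · simpa [innerLift_x, innerLift_y, mul_assoc] using h3
        · simpa [innerLift_x, innerLift_y, mul_assoc] using h2
    exact DFunLike.congr_fun this f
  have hβ : β ∈ Subgroup.closure (Set.range sigma) := by rw [sigma_closure]; trivial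
  induction hβ using Subgroup.closure_induction_left generalizing f with
  | one => simp
  | mul_left c hc d _ hd =>
    obtain ⟨i, rfl⟩ := hc
    rw [map_mul, MulAut.mul_apply, ← hs, ← hd]
    group
  | inv_mul_cancel c hc d _ hd =>
    obtain ⟨i, rfl⟩ := hc
    have := hs i ((toAutF2 (sigma i))⁻¹ (toAutF2 d f))
    rw [MulAut.apply_inv_self, ← hd] at this
    rw [map_mul, map_inv, MulAut.mul_apply]
    rw [mul_inv_eq_iff_eq_mul, ← eq_inv_mul_iff_mul_eq] at this
    rw [this]
    group

/-- Choose a generator $t$ different from the one in the last letter of $f\neq1$. Then $ftf^{-1}$ is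
reduced as written, hence longer than $t$. -/
theorem conj_injective_F2 {f : F2} (h : MulAut.conj f = 1) : f = 1 := by
  by_contra hf
  have hr := FreeGroup.isReduced_toWord (x := f)
  have hne : f.toWord ≠ [] := fun h => hf (FreeGroup.toWord_eq_nil_iff.mp h)
  obtain ⟨L, a, hL⟩ := List.eq_nil_or_concat f.toWord |>.resolve_left hne
  obtain ⟨t, ht⟩ : ∃ t : Fin 2, t ≠ a.1 := exists_ne _
  rw [List.concat_eq_append] at hL
  have hred : FreeGroup.IsReduced (f.toWord ++ (t, true) :: FreeGroup.invRev f.toWord) := by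
    refine List.IsChain.append hr ?_ ?_
    · rw [hL]
      simp only [FreeGroup.invRev, List.map_append, List.reverse_append, List.map_cons,
        List.map_nil, List.reverse_singleton, List.singleton_append]
      have h2 := isReduced_invRev hr
      rw [hL] at h2
      simp only [FreeGroup.invRev, List.map_append, List.reverse_append, List.map_cons,
        List.map_nil, List.reverse_singleton, List.singleton_append] at h2
      exact FreeGroup.isReduced_cons_cons.mpr ⟨fun h => absurd h ht, h2⟩
    · intro x hx y hy
      rw [hL] at hx
      simp at hx hy
      subst hx hy
      exact fun h => absurd h.symm ht
  have h1 : FreeGroup.mk (f.toWord ++ (t, true) :: FreeGroup.invRev f.toWord) =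
      FreeGroup.of t := by
    have h2 : FreeGroup.mk (f.toWord ++ (t, true) :: FreeGroup.invRev f.toWord) =
        f * FreeGroup.of t * f⁻¹ := by
      conv_rhs => rw [← FreeGroup.mk_toWord (x := f)]
      rw [FreeGroup.inv_mk, FreeGroup.of, FreeGroup.mul_mk, FreeGroup.mul_mk]
      simp
    rw [h2, ← MulAut.conj_apply, h]
    rfl
  have h3 := norm_mk_of_isReduced hred
  rw [h1, FreeGroup.norm_of] at h3
  simp [hL] at h3
  omega

theorem toAutF2_delta : toAutF2 ((sigma 0 * sigma 1 * sigma 2) ^ 4) = 1 := by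
  simp only [map_pow, map_mul, toAutF2_sigma]
  apply mulAut_ext_F2 <;>
    simp [pow_succ, sigmaAut_x, sigmaAut_y, mul_assoc]

/-- The kernel of the action of `B₄` on `F₂` consists of the powers of the full twist. -/
theorem toAutF2_eq_one {β : B4} (h : toAutF2 β = 1) :
    ∃ n : ℤ, β = ((sigma 0 * sigma 1 * sigma 2) ^ 4) ^ n := by
  have hN : innerLift.range.Normal := by
    constructor
    rintro _ ⟨f, rfl⟩ β
    exact ⟨_, (mul_innerLift_mul_inv β f).symm⟩
  obtain ⟨p, hp⟩ : ∃ p, p = QuotientGroup.mk' innerLift.range := ⟨_, rfl⟩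
  have hp1 (β : B4) : p β = 1 ↔ ∃ f, innerLift f = β := by
    rw [hp, QuotientGroup.mk'_apply, QuotientGroup.eq_one_iff]; rfl
  have hp02 : p (sigma 2) = p (sigma 0) := by
    rw [eq_comm, ← mul_inv_eq_one, ← map_inv, ← map_mul, hp1]
    exact ⟨x, innerLift_x⟩
  have hbr : p (sigma 0) * p (sigma 1) * p (sigma 0) = p (sigma 1) * p (sigma 0) * p (sigma 1) := by
    simp only [← map_mul, sigma_braid₁]
  -- Modulo the lifted $F_2$ the generators $\sigma_1$ and $\sigma_3$ coincide, so the quotient is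
  -- generated by two elements satisfying the braid relation.
  have htop : Subgroup.closure {p (sigma 0), p (sigma 1)} = ⊤ := by
    have h1 : Subgroup.map p ⊤ = ⊤ := by
      rw [← MonoidHom.range_eq_map, MonoidHom.range_eq_top, hp]
      exact QuotientGroup.mk'_surjective _
    rw [← h1, ← sigma_closure, MonoidHom.map_closure]
    congr 1
    ext g
    constructor
    · rintro (rfl | rfl)
      · exact ⟨_, ⟨0, rfl⟩, rfl⟩
      · exact ⟨_, ⟨1, rfl⟩, rfl⟩
    · rintro ⟨_, ⟨i, rfl⟩, rfl⟩
      fin_cases i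
      · exact Or.inl rfl
      · exact Or.inr rfl
      · exact Or.inl hp02
  obtain ⟨e, i, f, L, hi, hf, hβ⟩ := braid_normal_form _ _ hbr htop (p β)
  obtain ⟨γ, hγ⟩ : ∃ γ, γ =
    (sigma 0 * sigma 1 * sigma 0 * (sigma 0 * sigma 1 * sigma 0)) ^ e *
      (sigma 0 * sigma 1) ^ i * (L.map fun t => cond t (sigma 1) (sigma 0)⁻¹).prod *
      (sigma 0 * sigma 1 * sigma 0) ^ f := ⟨_, rfl⟩
  have hpγ : p γ = p β := by
    rw [hβ, hγ]
    simp only [map_mul, map_zpow, map_pow, map_list_prod, List.map_map]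
    congr 4
    funext t
    cases t <;> simp
  have hSL (f : F2) : toSL2 (innerLift f) = 1 := by
    have : toSL2.comp innerLift = 1 := by
      apply hom_ext_F2
      · rw [MonoidHom.comp_apply, innerLift_x, map_mul, map_inv, toSL2_sigma, toSL2_sigma]
        exact mul_inv_cancel _
      · rw [MonoidHom.comp_apply, innerLift_y]
        simp only [map_mul, map_inv, toSL2_sigma]
        rw [show sigmaSL2 2 = sigmaSL2 0 from rfl]
        simp
    exact DFunLike.congr_fun this f
  obtain ⟨k, hk⟩ := (hp1 (β * γ⁻¹)).mp (by rw [map_mul, map_inv, hpγ, mul_inv_cancel])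
  -- The normal form $\gamma$ differs from $\beta$ by an inner lift, and these die in
  -- $\mathrm{SL}_2(\mathbb Z)$, as does $\beta$. The normal form there then leaves only an even
  -- power of $(\sigma_1\sigma_2\sigma_1)^2$.
  have hγ1 : toSL2 γ = 1 := by
    have h1 : γ = (innerLift k)⁻¹ * β := by rw [hk]; group
    rw [h1, map_mul, map_inv, hSL, toSL2_eq_one h, inv_one, one_mul]
  have hγ2 : (sigmaSL2 0 * sigmaSL2 1 * sigmaSL2 0 *
        (sigmaSL2 0 * sigmaSL2 1 * sigmaSL2 0)) ^ e * (sigmaSL2 0 * sigmaSL2 1) ^ i *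
      (L.map fun t => cond t (sigmaSL2 1) (sigmaSL2 0)⁻¹).prod *
      (sigmaSL2 0 * sigmaSL2 1 * sigmaSL2 0) ^ f = 1 := by
    rw [← hγ1, hγ]
    simp only [map_mul, map_zpow, map_pow, map_list_prod, List.map_map, toSL2_sigma]
    congr 4
    funext t
    cases t <;> simp [toSL2_sigma]
  obtain ⟨rfl, rfl, rfl, n, rfl⟩ := normal_form_eq_one hi hf hγ2
  -- In the quotient the full twist becomes $(\sigma_1\sigma_2\sigma_1)^4$. Hence $\beta$ agrees
  -- with a power of the full twist up to an inner lift, which is trivial because $F_2$ has no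
  -- center.
  have h2 : p (β * (((sigma 0 * sigma 1 * sigma 2) ^ 4) ^ n)⁻¹) = 1 := by
    rw [map_mul, hβ, map_inv, map_zpow, map_pow, map_mul, map_mul, hp02]
    simp only [pow_zero, mul_one, List.map_nil, List.prod_nil]
    rw [← pow_two, ← two_mul, zpow_mul, ← zpow_natCast _ 4, zpow_ofNat, ← pow_mul]
    simp
  obtain ⟨k', hk'⟩ := (hp1 _).mp h2
  have h3 : MulAut.conj k' = 1 := by
    rw [← toAutF2_innerLift, hk', map_mul, h, map_inv, map_zpow, toAutF2_delta]
    simp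
  rw [conj_injective_F2 h3, map_one, eq_comm, mul_inv_eq_one] at hk'
  exact ⟨n, hk'⟩

/-- A central braid fixes every inner lift; by equivariance it fixes every inner automorphism of
$F_2$, hence every element. -/
theorem toAutF2_eq_one_of_mem_center {z : B4} (hz : z ∈ Subgroup.center B4) : toAutF2 z = 1 := by
  apply MulEquiv.ext
  intro f
  have h := mul_innerLift_mul_inv z f
  rw [← Subgroup.mem_center_iff.mp hz, mul_inv_cancel_right] at h
  have h2 := congrArg toAutF2 h
  rw [toAutF2_innerLift, toAutF2_innerLift, eq_comm, ← mul_inv_eq_one, ← map_inv, ← map_mul] at h2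
  exact mul_inv_eq_one.mp (conj_injective_F2 h2)

theorem center_eq_zpow {z : B4} (hz : z ∈ Subgroup.center B4) :
    ∃ n : ℤ, z = ((sigma 0 * sigma 1 * sigma 2) ^ 4) ^ n :=
  toAutF2_eq_one (toAutF2_eq_one_of_mem_center hz)

/-! ### Extending actions of `B₄` to `Aut(F₂)` -/

/-- Every automorphism of `F₂` is, up to `iota`, the image of a braid. -/
theorem exists_braid (α : MulAut F2) : (∃ β, toAutF2 β = α) ∨ ∃ β, toAutF2 β * iota = α := by
  have hα : α ∈ nielsenGroup := by rw [nielsenGroup_eq_top]; trivial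
  have hi : iota * iota = 1 := by
    apply mulAut_ext_F2 <;> simp [iota_x, iota_y, mul_assoc]
  have hi' : iota⁻¹ = iota := inv_eq_of_mul_eq_one_left hi
  have hc (i : Fin 3) : iota * sigmaAut i = (sigmaAut i)⁻¹ * iota := by
    rw [← iota_conj, inv_mul_cancel_right]
  refine Subgroup.closure_induction_right
    (p := fun α _ => (∃ β, toAutF2 β = α) ∨ ∃ β, toAutF2 β * iota = α) ?_ ?_ ?_ hα
  · exact Or.inl ⟨1, map_one _⟩
  · rintro a - b (rfl | ⟨i, rfl⟩) (⟨β, rfl⟩ | ⟨β, rfl⟩)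
    · exact Or.inr ⟨β, rfl⟩
    · exact Or.inl ⟨β, by rw [mul_assoc, hi, mul_one]⟩
    · exact Or.inl ⟨β * sigma i, by rw [map_mul, toAutF2_sigma]⟩
    · exact Or.inr ⟨β * (sigma i)⁻¹, by
        rw [map_mul, map_inv, toAutF2_sigma, mul_assoc, mul_assoc, hc]⟩
  · rintro a - b (rfl | ⟨i, rfl⟩) (⟨β, rfl⟩ | ⟨β, rfl⟩)
    · exact Or.inr ⟨β, by rw [hi']⟩
    · exact Or.inl ⟨β, by rw [hi', mul_assoc, hi, mul_one]⟩
    · exact Or.inl ⟨β * (sigma i)⁻¹, by rw [map_mul, map_inv, toAutF2_sigma]⟩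
    · exact Or.inr ⟨β * sigma i, by
        rw [map_mul, toAutF2_sigma, mul_assoc, mul_assoc, mul_right_inj, eq_mul_inv_iff_mul_eq,
          mul_assoc, hc, mul_inv_cancel_left]⟩

/-- $\mathrm{Aut}(F_2)$ is the disjoint union of the image of $B_4$ and its coset by `iota`. Send
$\pi(\beta)$ to $h(\beta)$ and $\pi(\beta)\iota$ to $h(\beta)\psi$. This is well defined because $h$
kills the full twist, and multiplicative because $\iota$ and $\psi$ induce the same automorphism
$\tau$ of $B_4$, inverting each generator. -/
theorem exists_extension {G : Type*} [Group G] (h : B4 →* G) (ψ : G) (hψ : ψ * ψ = 1)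
    (hz : h ((sigma 0 * sigma 1 * sigma 2) ^ 4) = 1)
    (hi : ∀ i, ψ * h (sigma i) * ψ⁻¹ = (h (sigma i))⁻¹) :
    ∃ Φ : MulAut F2 →* G, (∀ β, Φ (toAutF2 β) = h β) ∧ Φ iota = ψ := by
  have hker (β : B4) (hβ : toAutF2 β = 1) : h β = 1 := by
    obtain ⟨n, rfl⟩ := toAutF2_eq_one hβ
    rw [map_zpow, hz, one_zpow]
  let τ : B4 →* B4 := PresentedGroup.toGroup (f := fun i => (sigma i)⁻¹) (by
    intro r hr
    rcases hr with rfl | rfl | rfl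
    all_goals
      rw [map_mul, map_inv, mul_inv_eq_one]
      simp only [map_mul, FreeGroup.lift_apply_of, ← mul_inv_rev, ← mul_assoc]
    · rw [sigma_braid₁]
    · rw [sigma_braid₂]
    · rw [sigma_comm])
  have hτ (i : Fin 3) : τ (sigma i) = (sigma i)⁻¹ := PresentedGroup.toGroup.of _
  have hτ1 (β : B4) : iota * toAutF2 β = toAutF2 (τ β) * iota := by
    have : (MulAut.conj iota).toMonoidHom.comp toAutF2 = toAutF2.comp τ := by
      apply PresentedGroup.ext
      intro i
      change iota * toAutF2 (sigma i) * iota⁻¹ = toAutF2 (τ (sigma i))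
      rw [hτ, map_inv, toAutF2_sigma, iota_conj]
    rw [← mul_inv_eq_iff_eq_mul]
    exact DFunLike.congr_fun this β
  have hτ2 (β : B4) : ψ * h β = h (τ β) * ψ := by
    have : (MulAut.conj ψ).toMonoidHom.comp h = h.comp τ := by
      apply PresentedGroup.ext
      intro i
      change ψ * h (sigma i) * ψ⁻¹ = h (τ (sigma i))
      rw [hτ, map_inv, hi]
    rw [← mul_inv_eq_iff_eq_mul]
    exact DFunLike.congr_fun this β
  have hii : iota * iota = 1 := by
    apply mulAut_ext_F2 <;> simp [iota_x, iota_y, mul_assoc]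
  have hex (α : MulAut F2) : ∃ g : G, (∃ β, toAutF2 β = α ∧ h β = g) ∨
      ∃ β, toAutF2 β * iota = α ∧ h β * ψ = g := by
    rcases exists_braid α with ⟨β, hβ⟩ | ⟨β, hβ⟩
    · exact ⟨_, Or.inl ⟨β, hβ, rfl⟩⟩
    · exact ⟨_, Or.inr ⟨β, hβ, rfl⟩⟩
  choose Φ hΦ using hex
  have hinj {β γ : B4} (hβγ : toAutF2 β = toAutF2 γ) : h β = h γ := by
    rw [← mul_inv_eq_one, ← map_inv, ← map_mul]
    apply hker
    rw [map_mul, map_inv, hβγ, mul_inv_cancel]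
  have h1 (β : B4) : Φ (toAutF2 β) = h β := by
    rcases hΦ (toAutF2 β) with ⟨γ, h1, h2⟩ | ⟨γ, h1, -⟩
    · rw [← h2, hinj h1]
    · refine absurd ?_ (toAutF2_ne_iota (γ⁻¹ * β))
      rw [map_mul, map_inv, ← h1, inv_mul_cancel_left]
  have h2 (β : B4) : Φ (toAutF2 β * iota) = h β * ψ := by
    rcases hΦ (toAutF2 β * iota) with ⟨γ, h1, -⟩ | ⟨γ, h1, h2⟩
    · refine absurd ?_ (toAutF2_ne_iota (β⁻¹ * γ))
      rw [map_mul, map_inv, h1, inv_mul_cancel_left]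
    · rw [← h2, hinj (mul_right_cancel h1)]
  refine ⟨⟨⟨Φ, ?_⟩, ?_⟩, h1, ?_⟩
  · rw [← map_one toAutF2, h1, map_one]
  · intro α α'
    rcases exists_braid α with ⟨β, rfl⟩ | ⟨β, rfl⟩ <;>
      rcases exists_braid α' with ⟨γ, rfl⟩ | ⟨γ, rfl⟩ <;> dsimp only
    · rw [← map_mul, h1, h1, h1, map_mul]
    · rw [← mul_assoc, ← map_mul, h1, h2, h2, map_mul, mul_assoc]
    · rw [mul_assoc, hτ1, ← mul_assoc, ← map_mul, h1, h2, h2, map_mul, mul_assoc, mul_assoc, hτ2]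
    · have : toAutF2 β * iota * (toAutF2 γ * iota) = toAutF2 (β * τ γ) := by
        rw [mul_assoc, ← mul_assoc iota, hτ1, mul_assoc _ iota, hii, mul_one, map_mul]
      rw [this, h1, h2, h2, map_mul, mul_assoc, ← mul_assoc ψ, hτ2, mul_assoc _ ψ, hψ, mul_one]
  · have := h2 1
    rwa [map_one, map_one, one_mul, one_mul] at this

/-! ### Generic parameters and quantum numbers -/

section Scalars

variable {F : Type*} [Field F]

/-- The monomials in `q` and `s` are distinct. -/
def IsGeneric (q s : F) : Prop :=
  ∀ a b c d : ℕ, s ^ a * q ^ b = s ^ c * q ^ d → a = c ∧ b = d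

/-- Algebraic independence enters the argument only through the distinctness of monomials, which
keeps all the needed denominators nonzero. -/
theorem isGeneric_of_algebraicIndependent [CharZero F] {q s : F}
    (h : AlgebraicIndependent ℚ ![q, s]) : IsGeneric q s := by
  intro a b c d he
  have h1 : MvPolynomial.aeval ![q, s]
      (MvPolynomial.X 1 ^ a * MvPolynomial.X 0 ^ b : MvPolynomial (Fin 2) ℚ) =
      MvPolynomial.aeval ![q, s]
      (MvPolynomial.X 1 ^ c * MvPolynomial.X 0 ^ d : MvPolynomial (Fin 2) ℚ) := by
    simpa using he
  have h2 := h h1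
  rw [MvPolynomial.X_pow_eq_monomial, MvPolynomial.X_pow_eq_monomial,
    MvPolynomial.X_pow_eq_monomial, MvPolynomial.X_pow_eq_monomial, MvPolynomial.monomial_mul,
    MvPolynomial.monomial_mul, MvPolynomial.monomial_eq_monomial_iff] at h2
  rcases h2 with ⟨h2, -⟩ | ⟨h2, -⟩
  · have e0 := DFunLike.congr_fun h2 0
    have e1 := DFunLike.congr_fun h2 1
    simp at e0 e1
    exact ⟨e1, e0⟩
  · simp at h2

variable {q s : F}

theorem IsGeneric.q_ne_zero (h : IsGeneric q s) : q ≠ 0 := by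
  rintro rfl
  have := h 0 1 0 2 (by simp)
  omega

theorem IsGeneric.s_ne_zero (h : IsGeneric q s) : s ≠ 0 := by
  rintro rfl
  have := h 1 0 2 0 (by simp)
  omega

theorem IsGeneric.sub_inv_ne_zero (h : IsGeneric q s) {a b c : ℕ} (hac : a ≠ 0 ∨ b ≠ c) :
    s ^ a * q ^ b * (q ^ c)⁻¹ - (s ^ a)⁻¹ * (q ^ b)⁻¹ * q ^ c ≠ 0 := by
  have hq := h.q_ne_zero
  have hs := h.s_ne_zero
  intro h0
  have h1 : s ^ (2 * a) * q ^ (2 * b) = s ^ 0 * q ^ (2 * c) := by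
    rw [sub_eq_zero] at h0
    field_simp at h0
    rw [pow_zero, one_mul, mul_comm 2 a, mul_comm 2 b, mul_comm 2 c, pow_mul, pow_mul, pow_mul]
    linear_combination h0
  have := h _ _ _ _ h1
  omega

theorem IsGeneric.q_sub_inv_ne_zero (h : IsGeneric q s) : q - q⁻¹ ≠ 0 := by
  have := h.sub_inv_ne_zero (a := 0) (b := 1) (c := 0) (by omega)
  simpa using this

theorem qInt_zero : qInt F q 0 = 0 := by simp [qInt]

theorem IsGeneric.qInt_ne_zero (h : IsGeneric q s) (n : ℕ) : qInt F q (n + 1) ≠ 0 := by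
  have := h.sub_inv_ne_zero (a := 0) (b := n + 1) (c := 0) (by omega)
  exact div_ne_zero (by simpa using this) h.q_sub_inv_ne_zero

theorem qFact_zero : qFact F q 0 = 1 := by simp [qFact]

theorem qFact_succ (n : ℕ) : qFact F q (n + 1) = qFact F q n * qInt F q (n + 1) := by
  simp [qFact, Finset.prod_range_succ]

theorem IsGeneric.qFact_ne_zero (h : IsGeneric q s) (n : ℕ) : qFact F q n ≠ 0 :=
  Finset.prod_ne_zero_iff.mpr fun _ _ => h.qInt_ne_zero _

theorem qInt_add (hq : q ≠ 0) (m n : ℕ) :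
    qInt F q (m + n) = q ^ n * qInt F q m + (q ^ m)⁻¹ * qInt F q n := by
  simp only [qInt, pow_add]
  field_simp
  ring

variable (q s)

/-- The factor `[m]_q (s q^{1-m} - s⁻¹ q^{m-1})` by which `F` acts. -/
def fCoef (m : ℕ) : F := qInt F q m * (s * q * (q ^ m)⁻¹ - s⁻¹ * q⁻¹ * q ^ m)

/-- The factor by which `F^m` acts on `v₀`. -/
def fFact (m : ℕ) : F := ∏ k ∈ Finset.range m, fCoef q s (k + 1)

theorem fCoef_zero : fCoef q s 0 = 0 := by simp [fCoef, qInt_zero]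

theorem fFact_zero : fFact q s 0 = 1 := by simp [fFact]

theorem fFact_succ (m : ℕ) : fFact q s (m + 1) = fFact q s m * fCoef q s (m + 1) := by
  simp [fFact, Finset.prod_range_succ]

variable {q s}

theorem fCoef_succ (hq : q ≠ 0) (m : ℕ) :
    fCoef q s (m + 1) = qInt F q (m + 1) * (s * (q ^ m)⁻¹ - s⁻¹ * q ^ m) := by
  rw [fCoef, pow_succ]
  field_simp

theorem IsGeneric.fCoef_ne_zero (h : IsGeneric q s) (m : ℕ) : fCoef q s (m + 1) ≠ 0 := by
  rw [fCoef_succ h.q_ne_zero]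
  refine mul_ne_zero (h.qInt_ne_zero m) ?_
  have := h.sub_inv_ne_zero (a := 1) (b := 0) (c := m) (by omega)
  simpa using this

theorem IsGeneric.fFact_ne_zero (h : IsGeneric q s) (m : ℕ) : fFact q s m ≠ 0 :=
  Finset.prod_ne_zero_iff.mpr fun _ _ => h.fCoef_ne_zero _

theorem fFact_eq (hq : q ≠ 0) (m : ℕ) : fFact q s m =
    qFact F q m * ∏ k ∈ Finset.range m, (s * (q ^ k)⁻¹ - s⁻¹ * q ^ k) := by
  simp only [fFact, fCoef_succ hq, Finset.prod_mul_distrib, qFact]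

/-- The commutator $[E,F]$ on a single Verma module, read off on a basis vector. -/
theorem fCoef_succ_sub (h : IsGeneric q s) (m : ℕ) :
    fCoef q s (m + 1) - fCoef q s m = s * (q ^ (2 * m))⁻¹ - s⁻¹ * q ^ (2 * m) := by
  have hq := h.q_ne_zero
  have hs := h.s_ne_zero
  have h1 : q ^ 2 - 1 ≠ 0 := by
    have := h.q_sub_inv_ne_zero
    intro h2
    apply this
    field_simp
    rw [h2, mul_zero]
  rw [fCoef_succ hq, fCoef, qInt, qInt, pow_succ, mul_comm 2 m, pow_mul]
  field_simp
  ring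

end Scalars

/-! ### The `R`-matrix in coordinates -/

section TwoFold

variable {F : Type*} [Field F] (q s : F)

/-- The entry of the `R`-matrix that takes `v_{b+n} ⊗ v_k` to `v_{n+k} ⊗ v_b`. -/
def rCoef (n k b : ℕ) : F :=
  (s ^ (n + k + b))⁻¹ * q ^ (2 * b * (n + k) + n.choose 2) * fFact q s (n + k) /
    (fFact q s k * qFact F q n)

/-- The `R`-matrix, on coordinate functions. -/
def rFun : (ℕ → ℕ → F) →ₗ[F] (ℕ → ℕ → F) where
  toFun w a b := ∑ p ∈ antidiagonal a, rCoef q s p.1 p.2 b * w (b + p.1) p.2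
  map_add' w w' := by
    funext a b
    simp [mul_add, Finset.sum_add_distrib]
  map_smul' c w := by
    funext a b
    simp only [Pi.smul_apply, smul_eq_mul, RingHom.id_apply, Finset.mul_sum]
    exact Finset.sum_congr rfl fun _ _ => by ring

theorem rFun_apply (w : ℕ → ℕ → F) (a b : ℕ) :
    rFun q s w a b = ∑ p ∈ antidiagonal a, rCoef q s p.1 p.2 b * w (b + p.1) p.2 := rfl

/-- The action of `E` on `V ⊗ V`, on coordinate functions. -/
def eFun : (ℕ → ℕ → F) →ₗ[F] (ℕ → ℕ → F) where
  toFun w a b := s * (q ^ (2 * b))⁻¹ * w (a + 1) b + w a (b + 1)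
  map_add' w w' := by
    funext a b
    simp only [Pi.add_apply]
    ring
  map_smul' c w := by
    funext a b
    simp only [Pi.smul_apply, smul_eq_mul, RingHom.id_apply]
    ring

theorem eFun_apply (w : ℕ → ℕ → F) (a b : ℕ) :
    eFun q s w a b = s * (q ^ (2 * b))⁻¹ * w (a + 1) b + w a (b + 1) := rfl

theorem rFun_diag (f : ℕ → F) (w : ℕ → ℕ → F) (a b : ℕ) :
    rFun q s (fun i j => f (i + j) * w i j) a b = f (a + b) * rFun q s w a b := by
  rw [rFun_apply, rFun_apply, Finset.mul_sum]
  refine Finset.sum_congr rfl fun p hp => ?_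
  rw [mem_antidiagonal] at hp
  have : b + p.1 + p.2 = a + b := by omega
  rw [this]
  ring

variable {q s}

theorem rCoef_succ_right (h : IsGeneric q s) (n k b : ℕ) :
    rCoef q s n k b = s * (q ^ (2 * (n + k)))⁻¹ * rCoef q s n k (b + 1) := by
  have hq := h.q_ne_zero
  have hs := h.s_ne_zero
  have := h.fFact_ne_zero k
  have := h.qFact_ne_zero n
  rw [rCoef, rCoef]
  have e1 : 2 * (b + 1) * (n + k) + n.choose 2 = 2 * (n + k) + (2 * b * (n + k) + n.choose 2) := by
    ring
  have e2 : n + k + (b + 1) = n + k + b + 1 := by ring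
  rw [e1, e2, pow_add q (2 * (n + k)), pow_succ]
  field_simp

/-- This is $R(E\otimes1)=(K\otimes E)R$, one half of the commutation of $R$ with the coproduct of
$E$. It later moves lowering of one index to the next. -/
theorem rFun_shift (h : IsGeneric q s) (w : ℕ → ℕ → F) (a b : ℕ) :
    rFun q s (fun i j => w (i + 1) j) a b = s * (q ^ (2 * a))⁻¹ * rFun q s w a (b + 1) := by
  rw [rFun_apply, rFun_apply, Finset.mul_sum]
  refine Finset.sum_congr rfl fun p hp => ?_
  rw [mem_antidiagonal] at hp
  rw [rCoef_succ_right h, hp, add_right_comm b 1]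
  ring

theorem rFun_zero_left (w : ℕ → ℕ → F) (b : ℕ) : rFun q s w 0 b = (s ^ b)⁻¹ * w b 0 := by
  rw [rFun_apply]
  simp [rCoef, fFact_zero, qFact_zero]

theorem rCoef_zero_ne_zero (h : IsGeneric q s) (k b : ℕ) : rCoef q s 0 k b ≠ 0 := by
  rw [rCoef]
  refine div_ne_zero (mul_ne_zero (mul_ne_zero (inv_ne_zero (pow_ne_zero _ h.s_ne_zero))
    (pow_ne_zero _ h.q_ne_zero)) (h.fFact_ne_zero _))
    (mul_ne_zero (h.fFact_ne_zero _) (h.qFact_ne_zero _))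

/-- $R$ is triangular with respect to the second index, with nonzero leading coefficients `rCoef q s
0 k b`. -/
theorem rFun_injective (h : IsGeneric q s) : Function.Injective (rFun q s) := by
  rw [← LinearMap.ker_eq_bot, LinearMap.ker_eq_bot']
  intro w hw
  have key (k : ℕ) : ∀ b, w b k = 0 := by
    induction k using Nat.strong_induction_on with
    | _ k ih =>
      intro b
      have h1 := congrFun (congrFun hw k) b
      rw [rFun_apply, Finset.sum_eq_single (0, k)] at h1
      · simpa [rCoef_zero_ne_zero h] using h1
      · rintro ⟨n, k'⟩ hp hne
        rw [mem_antidiagonal] at hp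
        simp only at hp ⊢
        rw [ih k' (by
          rcases Nat.eq_zero_or_pos n with rfl | hn
          · exact absurd (by simp [← hp]) hne
          · omega), mul_zero]
      · simp
  funext b k
  exact key k b

theorem choose_two_succ (n : ℕ) : (n + 1).choose 2 = n + n.choose 2 := by
  rw [Nat.choose_succ_succ, Nat.choose_one_right]

theorem qInt_fCoef_identity (h : IsGeneric q s) (n k : ℕ) :
    q ^ n * fCoef q s (n + k + 1) + s⁻¹ * q ^ (2 * (n + k)) * qInt F q (n + 1) =
      s * (q ^ (2 * k))⁻¹ * qInt F q (n + 1) + q ^ n * fCoef q s k := by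
  have hq := h.q_ne_zero
  have hs := h.s_ne_zero
  have h1 : q ^ 2 - 1 ≠ 0 := by
    have := h.q_sub_inv_ne_zero
    intro h2
    apply this
    field_simp
    rw [h2, mul_zero]
  rw [fCoef, fCoef, qInt, qInt, qInt, mul_comm 2, pow_mul, mul_comm 2, pow_mul]
  simp only [pow_succ, pow_add]
  field_simp
  ring

/-- The four-term relation behind the commutation of `R` with `E`. -/
theorem rCoef_four_term (h : IsGeneric q s) (n k b : ℕ) :
    s * (q ^ (2 * b))⁻¹ * rCoef q s (n + 1) (k + 1) b + rCoef q s n (k + 1) (b + 1) =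
      s * (q ^ (2 * (k + 1)))⁻¹ * rCoef q s n (k + 1) b + rCoef q s (n + 1) k b := by
  have hq := h.q_ne_zero
  have hs := h.s_ne_zero
  have h1 := h.fFact_ne_zero k
  have h2 := h.fCoef_ne_zero k
  have h3 := h.qFact_ne_zero n
  have h4 := h.qInt_ne_zero n
  have key := qInt_fCoef_identity h n (k + 1)
  have e1 : n + 1 + (k + 1) = n + (k + 1) + 1 := by ring
  have e2 : n + 1 + k = n + (k + 1) := by ring
  simp only [rCoef, e1, e2, fFact_succ _ _ (n + (k + 1)), fFact_succ _ _ k, qFact_succ,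
    choose_two_succ]
  obtain ⟨m, hm⟩ : ∃ m, m = n + (k + 1) := ⟨_, rfl⟩
  rw [← hm] at key ⊢
  have e3 : 2 * b * (m + 1) + (n + n.choose 2) = 2 * b * m + 2 * b + n + n.choose 2 := by ring
  have e4 : 2 * (b + 1) * m + n.choose 2 = 2 * b * m + 2 * m + n.choose 2 := by ring
  have e5 : 2 * b * m + (n + n.choose 2) = 2 * b * m + n + n.choose 2 := by ring
  have e6 : m + 1 + b = m + b + 1 := by ring
  have e7 : m + (b + 1) = m + b + 1 := by ring
  rw [e3, e4, e5, e6, e7]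
  simp only [pow_add q, pow_succ s]
  generalize fCoef q s (m + 1) = x1 at *
  generalize fCoef q s (k + 1) = x2 at *
  generalize qInt F q (n + 1) = x3 at *
  generalize fFact q s m = y1 at *
  generalize fFact q s k = y2 at *
  generalize qFact F q n = y3 at *
  have hA : q ^ (2 * b) ≠ 0 := pow_ne_zero _ hq
  generalize q ^ (2 * b) = A at *
  generalize q ^ (2 * b * m) = A2
  have hB : s ^ (m + b) ≠ 0 := pow_ne_zero _ hs
  generalize s ^ (m + b) = B at *
  generalize q ^ (n.choose 2) = C
  generalize q ^ (2 * m) = D at *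
  have hN : q ^ (2 * (k + 1)) ≠ 0 := pow_ne_zero _ hq
  have hK : q ^ (2 * (k + 1)) = q ^ (2 * k) * q ^ (2 * 1) := by rw [← pow_add]; congr 1
  generalize q ^ (2 * (k + 1)) = N at *
  generalize q ^ n = Q at *
  -- The four-term relation is `qInt_fCoef_identity` times this common factor; powers are turned
  -- into independent variables so that `field_simp` sees a rational identity.
  have key2 : (B * s)⁻¹ * s * A2 * C * y1 / (y2 * x2 * y3 * x3) *
      (Q * x1 + s⁻¹ * D * x3) = (B * s)⁻¹ * s * A2 * C * y1 / (y2 * x2 * y3 * x3) *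
      (s * N⁻¹ * x3 + Q * x2) := by rw [key]
  clear key
  field_simp at key2 ⊢
  linear_combination key2

theorem rCoef_four_term_zero (h : IsGeneric q s) (n b : ℕ) :
    s * (q ^ (2 * b))⁻¹ * rCoef q s (n + 1) 0 b + rCoef q s n 0 (b + 1) =
      s * rCoef q s n 0 b := by
  have hq := h.q_ne_zero
  have hs := h.s_ne_zero
  have h3 := h.qFact_ne_zero n
  have h4 := h.qInt_ne_zero n
  have key := qInt_fCoef_identity h n 0
  simp only [rCoef, add_zero, fFact_succ _ _ n, fFact_zero, qFact_succ, choose_two_succ,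
    fCoef_zero, mul_zero, pow_zero, inv_one, mul_one, one_mul] at key ⊢
  have e3 : 2 * b * (n + 1) + (n + n.choose 2) = 2 * b * n + 2 * b + n + n.choose 2 := by ring
  have e4 : 2 * (b + 1) * n + n.choose 2 = 2 * b * n + 2 * n + n.choose 2 := by ring
  have e6 : n + 1 + b = n + b + 1 := by ring
  have e7 : n + (b + 1) = n + b + 1 := by ring
  rw [e3, e4, e6, e7]
  simp only [pow_add q, pow_succ s]
  generalize fCoef q s (n + 1) = x1 at *
  generalize qInt F q (n + 1) = x3 at *
  generalize fFact q s n = y1 at *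
  generalize qFact F q n = y3 at *
  have hA : q ^ (2 * b) ≠ 0 := pow_ne_zero _ hq
  generalize q ^ (2 * b) = A at *
  generalize q ^ (2 * b * n) = A2
  have hB : s ^ (n + b) ≠ 0 := pow_ne_zero _ hs
  generalize s ^ (n + b) = B at *
  generalize q ^ (n.choose 2) = C
  generalize q ^ (2 * n) = D at *
  generalize q ^ n = Q at *
  have key2 : (B * s)⁻¹ * s * A2 * C * y1 / (y3 * x3) * (Q * x1 + s⁻¹ * D * x3) =
      (B * s)⁻¹ * s * A2 * C * y1 / (y3 * x3) * (s * x3) := by rw [key]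
  clear key
  field_simp at key2 ⊢
  linear_combination key2

/-- $R$ is an intertwiner for $\Delta(E)$. Comparing the coefficients of $w(b+n+1,k)$ gives the
four-term relations; the leftover boundary coefficient, that of $w(b,a+1)$, is `h0`. -/
theorem eFun_rFun (h : IsGeneric q s) (w : ℕ → ℕ → F) :
    eFun q s (rFun q s w) = rFun q s (eFun q s w) := by
  have hq := h.q_ne_zero
  have hs := h.s_ne_zero
  funext a b
  simp only [eFun_apply, rFun_apply, mul_add, Finset.sum_add_distrib, Finset.mul_sum]
  -- The terms containing $w(\cdot,k+1)$, indexed by $k+1$ and padded by $0$ at $0$, so that the two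
  -- versions of `sum_antidiagonal_succ` shift one index into the other.
  let f : ℕ × ℕ → F := fun p =>
    Nat.casesOn p.2 0 fun k => rCoef q s p.1 k b * w (b + p.1) (k + 1)
  have h1 := Finset.Nat.sum_antidiagonal_succ (n := a) (f := f)
  have h2 := Finset.Nat.sum_antidiagonal_succ' (n := a) (f := f)
  have h3 : ∑ p ∈ antidiagonal a, rCoef q s p.1 p.2 b * w (b + p.1) (p.2 + 1) =
      f (0, a + 1) + ∑ p ∈ antidiagonal a, f (p.1 + 1, p.2) := by
    rw [← h1, h2]
    exact (zero_add _).symm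
  have h0 : s * (q ^ (2 * b))⁻¹ * (rCoef q s 0 (a + 1) b * w b (a + 1)) = f (0, a + 1) := by
    change _ = rCoef q s 0 a b * w (b + 0) (a + 1)
    have e : 2 * b * (a + 1) = 2 * b * a + 2 * b := by ring
    have e' : a + 1 + b = a + b + 1 := by ring
    have h4 := h.fFact_ne_zero a
    have h5 := h.fCoef_ne_zero a
    simp only [rCoef, zero_add, e, pow_add q, e', pow_succ s, fFact_succ, qFact_zero,
      Nat.choose_zero_succ, pow_zero, mul_one, add_zero]
    field_simp
  rw [h3, Finset.Nat.sum_antidiagonal_succ, ← h0, add_zero]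
  have h4 : ∀ p : ℕ × ℕ, f (p.1 + 1, p.2) =
      s * (q ^ (2 * b))⁻¹ * (rCoef q s (p.1 + 1) p.2 b * w (b + (p.1 + 1)) p.2) +
        rCoef q s p.1 p.2 (b + 1) * w (b + 1 + p.1) p.2 -
        rCoef q s p.1 p.2 b * (s * (q ^ (2 * p.2))⁻¹ * w (b + p.1 + 1) p.2) := by
    rintro ⟨n, k⟩
    have e1 : b + (n + 1) = b + n + 1 := by ring
    have e2 : b + 1 + n = b + n + 1 := by ring
    obtain _ | k := k
    · change 0 = _
      simp only [e1, e2]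
      have := rCoef_four_term_zero h n b
      simp only [mul_zero, pow_zero, inv_one, mul_one]
      linear_combination (-w (b + n + 1) 0) * this
    · change rCoef q s (n + 1) k b * w (b + (n + 1)) (k + 1) = _
      simp only [e1, e2]
      have := rCoef_four_term h n k b
      linear_combination (-w (b + n + 1) (k + 1)) * this
  rw [Finset.sum_congr rfl fun p _ => h4 p, Finset.sum_sub_distrib, Finset.sum_add_distrib]
  ring

/-! ### The hexagon and the braid relation -/

variable (q s) in
/-- The divided powers of `E`, up to a power of `q`, on `V ⊗ V`. -/
def eDiv (N : ℕ) : (ℕ → ℕ → F) →ₗ[F] (ℕ → ℕ → F) where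
  toFun w b c := ∑ p ∈ antidiagonal N, s ^ p.1 * (q ^ (2 * c * p.1))⁻¹ *
    q ^ (p.1.choose 2 + p.2.choose 2) / (qFact F q p.1 * qFact F q p.2) * w (b + p.1) (c + p.2)
  map_add' w w' := by
    funext a b
    simp [mul_add, Finset.sum_add_distrib]
  map_smul' c w := by
    funext a b
    simp only [Pi.smul_apply, smul_eq_mul, RingHom.id_apply, Finset.mul_sum]
    exact Finset.sum_congr rfl fun _ _ => by ring

theorem eDiv_apply (N : ℕ) (w : ℕ → ℕ → F) (b c : ℕ) : eDiv q s N w b c =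
    ∑ p ∈ antidiagonal N, s ^ p.1 * (q ^ (2 * c * p.1))⁻¹ *
      q ^ (p.1.choose 2 + p.2.choose 2) / (qFact F q p.1 * qFact F q p.2) *
      w (b + p.1) (c + p.2) := rfl

theorem eDiv_zero (w : ℕ → ℕ → F) : eDiv q s 0 w = w := by
  funext b c
  simp [eDiv_apply, qFact_zero]

/-- The $q$-Pascal rule: split $[n+m]=q^m[n]+q^{-n}[m]$ and let each summand absorb one application
of $E$. -/
theorem eFun_eDiv (h : IsGeneric q s) (N : ℕ) (w : ℕ → ℕ → F) :
    q ^ N • eFun q s (eDiv q s N w) = qInt F q (N + 1) • eDiv q s (N + 1) w := by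
  have hq := h.q_ne_zero
  have hs := h.s_ne_zero
  funext b c
  simp only [Pi.smul_apply, smul_eq_mul]
  let f : ℕ × ℕ → F := fun p => s ^ p.1 * (q ^ (2 * c * p.1))⁻¹ *
    q ^ (p.1.choose 2 + p.2.choose 2) / (qFact F q p.1 * qFact F q p.2) * w (b + p.1) (c + p.2)
  have h1 : qInt F q (N + 1) * eDiv q s (N + 1) w b c =
      ∑ p ∈ antidiagonal (N + 1), q ^ p.2 * qInt F q p.1 * f p +
      ∑ p ∈ antidiagonal (N + 1), (q ^ p.1)⁻¹ * qInt F q p.2 * f p := by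
    rw [eDiv_apply, Finset.mul_sum, ← Finset.sum_add_distrib]
    refine Finset.sum_congr rfl fun p hp => ?_
    rw [mem_antidiagonal] at hp
    rw [← hp, qInt_add hq]
    ring
  rw [h1, Finset.Nat.sum_antidiagonal_succ, Finset.Nat.sum_antidiagonal_succ', qInt_zero,
    eFun_apply, eDiv_apply, eDiv_apply]
  simp only [mul_zero, zero_mul, zero_add, add_zero]
  rw [mul_add, Finset.mul_sum, Finset.mul_sum, Finset.mul_sum]
  congr 1
  · refine Finset.sum_congr rfl fun p hp => ?_
    rw [mem_antidiagonal] at hp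
    obtain ⟨n, m⟩ := p
    simp only at hp
    have h2 := h.qFact_ne_zero n
    have h3 := h.qFact_ne_zero m
    have h4 := h.qInt_ne_zero n
    have e1 : b + (n + 1) = b + 1 + n := by ring
    have e2 : 2 * c * (n + 1) = 2 * c * n + 2 * c := by ring
    simp only [f, ← hp, qFact_succ, choose_two_succ, e1, e2, pow_succ s, pow_add q]
    field_simp
  · refine Finset.sum_congr rfl fun p hp => ?_
    rw [mem_antidiagonal] at hp
    obtain ⟨n, m⟩ := p
    simp only at hp
    have h2 := h.qFact_ne_zero n
    have h3 := h.qFact_ne_zero m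
    have h4 := h.qInt_ne_zero m
    have e1 : c + (m + 1) = c + 1 + m := by ring
    have e2 : 2 * (c + 1) * n = 2 * c * n + n + n := by ring
    simp only [f, ← hp, qFact_succ, choose_two_succ, e1, e2, pow_add q]
    field_simp

/-- Up to nonzero factors `eDiv q s N` is a power of $E$, so it inherits the commutation with $R$.
-/
theorem eDiv_rFun (h : IsGeneric q s) (N : ℕ) (w : ℕ → ℕ → F) :
    eDiv q s N (rFun q s w) = rFun q s (eDiv q s N w) := by
  induction N with
  | zero => rw [eDiv_zero, eDiv_zero]
  | succ N ih =>
    have h1 := eFun_eDiv h N (rFun q s w)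
    rw [ih, eFun_rFun h, ← map_smul, eFun_eDiv h N w, map_smul] at h1
    exact (smul_right_injective _ (h.qInt_ne_zero N) h1).symm

theorem sum_antidiagonal_assoc {M : Type*} [AddCommMonoid M] (f : ℕ → ℕ → ℕ → M) (a : ℕ) :
    ∑ p ∈ antidiagonal a, ∑ r ∈ antidiagonal p.2, f p.1 r.1 r.2 =
      ∑ p ∈ antidiagonal a, ∑ r ∈ antidiagonal p.1, f r.1 r.2 p.2 := by
  rw [Finset.sum_sigma', Finset.sum_sigma']
  refine Finset.sum_nbij' (fun x => ⟨(x.1.1 + x.2.1, x.2.2), (x.1.1, x.2.1)⟩)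
    (fun x => ⟨(x.2.1, x.2.2 + x.1.2), (x.2.2, x.1.2)⟩) ?_ ?_ ?_ ?_ ?_
  all_goals
    rintro ⟨⟨a1, a2⟩, ⟨b1, b2⟩⟩ hx
    simp only [Finset.mem_sigma, mem_antidiagonal] at hx
    obtain ⟨h1, h2⟩ := hx
  · refine Finset.mem_sigma.2 ⟨mem_antidiagonal.2 ?_, mem_antidiagonal.2 ?_⟩ <;>
      simp only at h1 h2 ⊢ <;> omega
  · refine Finset.mem_sigma.2 ⟨mem_antidiagonal.2 ?_, mem_antidiagonal.2 ?_⟩ <;>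
      simp only at h1 h2 ⊢ <;> omega
  all_goals
    subst h2
    rfl

/-- `R ⊗ 1` after `1 ⊗ R`. -/
theorem hexagon (h : IsGeneric q s) (w : ℕ → ℕ → ℕ → F) (a b c : ℕ) :
    rFun q s (fun i j => rFun q s (w i) j c) a b =
      (s ^ (2 * a + (b + c)))⁻¹ * q ^ (2 * a * (b + c)) * ∑ p ∈ antidiagonal a,
        fFact q s a / fFact q s p.2 * eDiv q s p.1 (fun i j => w i j p.2) b c := by
  have hq := h.q_ne_zero
  have hs := h.s_ne_zero
  simp only [rFun_apply, eDiv_apply, Finset.mul_sum]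
  have h1 : ∀ p ∈ antidiagonal a, ∑ r ∈ antidiagonal p.2, rCoef q s p.1 p.2 b *
      (rCoef q s r.1 r.2 c * w (b + p.1) (c + r.1) r.2) =
      ∑ r ∈ antidiagonal p.2, rCoef q s p.1 (r.1 + r.2) b *
      (rCoef q s r.1 r.2 c * w (b + p.1) (c + r.1) r.2) := by
    intro p _
    refine Finset.sum_congr rfl fun r hr => ?_
    rw [mem_antidiagonal.mp hr]
  rw [Finset.sum_congr rfl h1, sum_antidiagonal_assoc (fun n m k => rCoef q s n (m + k) b *
    (rCoef q s m k c * w (b + n) (c + m) k)) a]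
  refine Finset.sum_congr rfl fun p hp => Finset.sum_congr rfl fun r hr => ?_
  rw [mem_antidiagonal] at hp hr
  obtain ⟨N, k⟩ := p
  obtain ⟨n, m⟩ := r
  simp only at hp hr ⊢
  subst hr
  subst hp
  have h2 := h.qFact_ne_zero n
  have h3 := h.qFact_ne_zero m
  have h4 := h.fFact_ne_zero k
  have h5 := h.fFact_ne_zero (m + k)
  have e1 : n + (m + k) = n + m + k := by ring
  have e2 : s ^ (2 * (n + m + k) + (b + c)) = s ^ (n + m + k + b) * s ^ (m + k + c) * s ^ n := by
    rw [← pow_add, ← pow_add]; congr 1; ring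
  have e3 : q ^ (2 * (n + m + k) * (b + c)) =
      q ^ (2 * b * (n + m + k)) * q ^ (2 * c * (m + k)) * q ^ (2 * c * n) := by
    rw [← pow_add, ← pow_add]; congr 1; ring
  simp only [rCoef, e1, e2, e3, pow_add q _ (Nat.choose _ _)]
  field_simp

/-- The Yang-Baxter equation. -/
theorem yang_baxter (h : IsGeneric q s) (w : ℕ → ℕ → ℕ → F) (a b c : ℕ) :
    rFun q s (fun i j => rFun q s (fun i' j' => rFun q s (fun i'' j'' => w i'' j'' j') i i') j c)
      a b =
    rFun q s (fun b' c' => rFun q s (fun i j => rFun q s (w i) j c') a b') b c := by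
  have h1 := hexagon h (fun i i' j' => rFun q s (fun i'' j'' => w i'' j'' j') i i') a b c
  rw [h1]
  -- By the hexagon, moving the first factor past the other two is a combination of divided powers
  -- of $E$ on these two, scaled by a function of $b+c$. Both ingredients commute with $R$ on the
  -- pair.
  have h2 : (fun b' c' => rFun q s (fun i j => rFun q s (w i) j c') a b') = fun b' c' =>
      (fun m => (s ^ (2 * a + m))⁻¹ * q ^ (2 * a * m)) (b' + c') * (∑ p ∈ antidiagonal a,
        (fFact q s a / fFact q s p.2) • eDiv q s p.1 (fun i j => w i j p.2)) b' c' := by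
    funext b' c'
    rw [hexagon h]
    simp [Finset.sum_apply]
  have h3 (p : ℕ × ℕ) : (fun i j => rFun q s (fun i'' j'' => w i'' j'' p.2) i j) =
      rFun q s fun i j => w i j p.2 := rfl
  rw [h2]
  refine Eq.trans ?_ (rFun_diag q s (fun m => (s ^ (2 * a + m))⁻¹ * q ^ (2 * a * m))
    (∑ p ∈ antidiagonal a, (fFact q s a / fFact q s p.2) •
      eDiv q s p.1 (fun i j => w i j p.2)) b c).symm
  simp only [h3, eDiv_rFun h, map_sum, map_smul, Finset.sum_apply, Pi.smul_apply, smul_eq_mul]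

end TwoFold

/-! ### Coordinate functions on the fourfold tensor power -/

section FourFold

variable {F : Type*} [Field F]

variable (F) in
/-- Functions on the index set of the basis of `V^{⊗4}`. -/
abbrev X4 : Type _ := ℕ → ℕ → ℕ → ℕ → F

variable (q s : F)

/-- `R ⊗ 1 ⊗ 1` on coordinate functions. -/
def rFun₁ : X4 F →ₗ[F] X4 F where
  toFun w a b c d := rFun q s (fun i j => w i j c d) a b
  map_add' w w' := by
    funext a b c d
    exact congrFun₂ (map_add (rFun q s) (fun i j => w i j c d) fun i j => w' i j c d) a b
  map_smul' t w := by
    funext a b c d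
    exact congrFun₂ (map_smul (rFun q s) t fun i j => w i j c d) a b

/-- `1 ⊗ R ⊗ 1` on coordinate functions. -/
def rFun₂ : X4 F →ₗ[F] X4 F where
  toFun w a b c d := rFun q s (fun i j => w a i j d) b c
  map_add' w w' := by
    funext a b c d
    exact congrFun₂ (map_add (rFun q s) (fun i j => w a i j d) fun i j => w' a i j d) b c
  map_smul' t w := by
    funext a b c d
    exact congrFun₂ (map_smul (rFun q s) t fun i j => w a i j d) b c

/-- `1 ⊗ 1 ⊗ R` on coordinate functions. -/
def rFun₃ : X4 F →ₗ[F] X4 F where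
  toFun w a b c d := rFun q s (w a b) c d
  map_add' w w' := by
    funext a b c d
    exact congrFun₂ (map_add (rFun q s) (w a b) (w' a b)) c d
  map_smul' t w := by
    funext a b c d
    exact congrFun₂ (map_smul (rFun q s) t (w a b)) c d

/-- The three operators `R ⊗ 1 ⊗ 1`, `1 ⊗ R ⊗ 1`, `1 ⊗ 1 ⊗ R` on coordinate functions. -/
def rOp : Fin 3 → (X4 F →ₗ[F] X4 F) := ![rFun₁ q s, rFun₂ q s, rFun₃ q s]

/-- The action of `E` on coordinate functions. -/
def eOp : X4 F →ₗ[F] X4 F where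
  toFun w a b c d := s ^ 3 * (q ^ (2 * (b + c + d)))⁻¹ * w (a + 1) b c d +
    s ^ 2 * (q ^ (2 * (c + d)))⁻¹ * w a (b + 1) c d +
    s * (q ^ (2 * d))⁻¹ * w a b (c + 1) d + w a b c (d + 1)
  map_add' w w' := by
    funext a b c d
    simp only [Pi.add_apply]
    ring
  map_smul' t w := by
    funext a b c d
    simp only [Pi.smul_apply, smul_eq_mul, RingHom.id_apply]
    ring

variable {q s}

theorem rFun₁_apply (w : X4 F) (a b c d : ℕ) :
    rFun₁ q s w a b c d = rFun q s (fun i j => w i j c d) a b := rfl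

theorem rFun₂_apply (w : X4 F) (a b c d : ℕ) :
    rFun₂ q s w a b c d = rFun q s (fun i j => w a i j d) b c := rfl

theorem rFun₃_apply (w : X4 F) (a b c d : ℕ) :
    rFun₃ q s w a b c d = rFun q s (w a b) c d := rfl

theorem eOp_apply (w : X4 F) (a b c d : ℕ) :
    eOp q s w a b c d = s ^ 3 * (q ^ (2 * (b + c + d)))⁻¹ * w (a + 1) b c d +
      s ^ 2 * (q ^ (2 * (c + d)))⁻¹ * w a (b + 1) c d +
      s * (q ^ (2 * d))⁻¹ * w a b (c + 1) d + w a b c (d + 1) := rfl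

theorem rFun₁_braid (h : IsGeneric q s) (w : X4 F) :
    rFun₁ q s (rFun₂ q s (rFun₁ q s w)) = rFun₂ q s (rFun₁ q s (rFun₂ q s w)) := by
  funext a b c d
  exact yang_baxter h (fun i j k => w i j k d) a b c

theorem rFun₂_braid (h : IsGeneric q s) (w : X4 F) :
    rFun₂ q s (rFun₃ q s (rFun₂ q s w)) = rFun₃ q s (rFun₂ q s (rFun₃ q s w)) := by
  funext a b c d
  exact yang_baxter h (w a) b c d

theorem rFun₁_comm (w : X4 F) : rFun₁ q s (rFun₃ q s w) = rFun₃ q s (rFun₁ q s w) := by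
  funext a b c d
  simp only [rFun₁_apply, rFun₃_apply, rFun_apply, Finset.mul_sum]
  rw [Finset.sum_comm]
  refine Finset.sum_congr rfl fun _ _ => Finset.sum_congr rfl fun _ _ => ?_
  ring

theorem rOp_injective (h : IsGeneric q s) (i : Fin 3) : Function.Injective (rOp q s i) := by
  fin_cases i <;> intro w w' hw <;> funext a b c d
  · have : (fun i j => w i j c d) = fun i j => w' i j c d :=
      rFun_injective h (funext₂ fun i j => congrFun₂ (congrFun₂ hw i j) c d)
    exact congrFun₂ this a b
  · have : (fun i j => w a i j d) = fun i j => w' a i j d :=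
      rFun_injective h (funext₂ fun i j => congrFun₂ (congrFun₂ hw a i) j d)
    exact congrFun₂ this b c
  · have : w a b = w' a b :=
      rFun_injective h (funext₂ fun i j => congrFun₂ (congrFun₂ hw a b) i j)
    exact congrFun₂ this c d

/-- Here and in the next two lemmas $E$ splits into `eFun` on the two indices where $R$ acts and
terms that see these indices only through their sum, or not at all. -/
theorem eOp_rFun₁ (h : IsGeneric q s) (w : X4 F) :
    eOp q s (rFun₁ q s w) = rFun₁ q s (eOp q s w) := by
  funext a b c d
  have h1 : (fun i j => eOp q s w i j c d) =
      (s ^ 2 * (q ^ (2 * (c + d)))⁻¹) • eFun q s (fun i j => w i j c d) +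
      (s * (q ^ (2 * d))⁻¹) • (fun i j => w i j (c + 1) d) + fun i j => w i j c (d + 1) := by
    funext i j
    simp only [eOp_apply, eFun_apply, Pi.add_apply, Pi.smul_apply, smul_eq_mul, add_assoc,
      mul_add 2 j, pow_add q]
    have := h.q_ne_zero
    field_simp
    ring
  rw [rFun₁_apply, h1, map_add, map_add, map_smul, map_smul, ← eFun_rFun h]
  simp only [eOp_apply, eFun_apply, rFun₁_apply, Pi.add_apply, Pi.smul_apply, smul_eq_mul,
    add_assoc, mul_add 2 b, pow_add q]
  have := h.q_ne_zero
  field_simp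
  ring

theorem eOp_rFun₂ (h : IsGeneric q s) (w : X4 F) :
    eOp q s (rFun₂ q s w) = rFun₂ q s (eOp q s w) := by
  funext a b c d
  have h1 : (fun i j => eOp q s w a i j d) =
      (fun i j => (fun m => s ^ 3 * (q ^ (2 * (m + d)))⁻¹) (i + j) * w (a + 1) i j d) +
      (s * (q ^ (2 * d))⁻¹) • eFun q s (fun i j => w a i j d) + fun i j => w a i j (d + 1) := by
    funext i j
    simp only [eOp_apply, eFun_apply, Pi.add_apply, Pi.smul_apply, smul_eq_mul,
      mul_add 2 j, pow_add q]
    have := h.q_ne_zero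
    field_simp
    ring
  rw [rFun₂_apply, h1, map_add, map_add, map_smul, ← eFun_rFun h, Pi.add_apply, Pi.add_apply,
    Pi.add_apply, Pi.add_apply, rFun_diag q s (fun m => s ^ 3 * (q ^ (2 * (m + d)))⁻¹)]
  simp only [eOp_apply, eFun_apply, rFun₂_apply, Pi.smul_apply, smul_eq_mul,
    mul_add 2 c, pow_add q]
  have := h.q_ne_zero
  field_simp
  ring

theorem eOp_rFun₃ (h : IsGeneric q s) (w : X4 F) :
    eOp q s (rFun₃ q s w) = rFun₃ q s (eOp q s w) := by
  funext a b c d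
  have h1 : eOp q s w a b =
      (fun i j => (fun m => s ^ 3 * (q ^ (2 * (b + m)))⁻¹) (i + j) * w (a + 1) b i j) +
      (fun i j => (fun m => s ^ 2 * (q ^ (2 * m))⁻¹) (i + j) * w a (b + 1) i j) +
      eFun q s (w a b) := by
    funext i j
    simp only [eOp_apply, eFun_apply, Pi.add_apply, add_assoc]
  rw [rFun₃_apply, h1, map_add, map_add, ← eFun_rFun h, Pi.add_apply, Pi.add_apply,
    Pi.add_apply, Pi.add_apply, rFun_diag q s (fun m => s ^ 3 * (q ^ (2 * (b + m)))⁻¹),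
    rFun_diag q s (fun m => s ^ 2 * (q ^ (2 * m))⁻¹)]
  simp only [eOp_apply, eFun_apply, rFun₃_apply, add_assoc]

theorem eOp_rOp (h : IsGeneric q s) (i : Fin 3) (w : X4 F) :
    eOp q s (rOp q s i w) = rOp q s i (eOp q s w) := by
  fin_cases i
  exacts [eOp_rFun₁ h w, eOp_rFun₂ h w, eOp_rFun₃ h w]

/-! ### Weight spaces -/

variable (F) in
/-- The functions of weight `N`. -/
def weightSpace (N : ℕ) : Submodule F (X4 F) where
  carrier := {w | ∀ a b c d, a + b + c + d ≠ N → w a b c d = 0}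
  add_mem' {w w'} hw hw' a b c d hN := by simp [hw a b c d hN, hw' a b c d hN]
  zero_mem' a b c d _ := rfl
  smul_mem' t w hw a b c d hN := by simp [hw a b c d hN]

theorem rFun_eq_zero {w : ℕ → ℕ → F} {a b : ℕ} (hw : ∀ i j, i + j = a + b → w i j = 0) :
    rFun q s w a b = 0 := by
  rw [rFun_apply]
  refine Finset.sum_eq_zero fun p hp => ?_
  rw [mem_antidiagonal] at hp
  rw [hw _ _ (by omega), mul_zero]

theorem rOp_mem_weightSpace (i : Fin 3) {N : ℕ} {w : X4 F} (hw : w ∈ weightSpace F N) :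
    rOp q s i w ∈ weightSpace F N := by
  intro a b c d hN
  fin_cases i
  · exact rFun_eq_zero (w := fun i j => w i j c d) fun i j hij => hw _ _ _ _ (by omega)
  · exact rFun_eq_zero (w := fun i j => w a i j d) fun i j hij => hw _ _ _ _ (by omega)
  · exact rFun_eq_zero (w := w a b) fun i j hij => hw _ _ _ _ (by omega)

variable (q s) in
/-- The highest weight functions of weight `N`. -/
def hwSpace (N : ℕ) : Submodule F (X4 F) := weightSpace F N ⊓ LinearMap.ker (eOp q s)

theorem mem_hwSpace {N : ℕ} {w : X4 F} :
    w ∈ hwSpace q s N ↔ w ∈ weightSpace F N ∧ eOp q s w = 0 := Iff.rfl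

theorem rOp_mem_hwSpace (h : IsGeneric q s) (i : Fin 3) {N : ℕ} {w : X4 F}
    (hw : w ∈ hwSpace q s N) : rOp q s i w ∈ hwSpace q s N :=
  ⟨rOp_mem_weightSpace i hw.1, by
    change eOp q s _ = 0
    rw [eOp_rOp h, (mem_hwSpace.1 hw).2]
    exact (rOp q s i).map_zero⟩

/-- The equation $Eu=0$ expresses $u(a+1,\cdot)$ through $u(a,\cdot)$. So highest weight functions
can be compared on the slice $a=0$. -/
theorem eq_zero_of_eOp_eq_zero (h : IsGeneric q s) {u : X4 F} (hu : eOp q s u = 0)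
    (h0 : ∀ b c d, u 0 b c d = 0) : u = 0 := by
  have key (a : ℕ) : ∀ b c d, u a b c d = 0 := by
    induction a with
    | zero => exact h0
    | succ a ih =>
      intro b c d
      have h1 := congrFun₂ (congrFun₂ hu a b) c d
      rw [eOp_apply, ih, ih, ih] at h1
      have hq := h.q_ne_zero
      have hs := h.s_ne_zero
      simpa [hq, hs] using h1
  funext a b c d
  exact key a b c d

/-! ### The full twist acts by scalars on highest weight functions -/

variable (q s)

/-- Lowering of the first index. -/
def dOp₁ : X4 F →ₗ[F] X4 F where
  toFun w a b c d := w (a + 1) b c d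
  map_add' w w' := rfl
  map_smul' t w := rfl

/-- Twisted lowering of the second index. -/
def dOp₂ : X4 F →ₗ[F] X4 F where
  toFun w a b c d := (q ^ (2 * a))⁻¹ * w a (b + 1) c d
  map_add' w w' := by funext a b c d; exact mul_add _ _ _
  map_smul' t w := by funext a b c d; exact mul_left_comm _ _ _

/-- Twisted lowering of the third index. -/
def dOp₃ : X4 F →ₗ[F] X4 F where
  toFun w a b c d := (q ^ (2 * (a + b)))⁻¹ * w a b (c + 1) d
  map_add' w w' := by funext a b c d; exact mul_add _ _ _
  map_smul' t w := by funext a b c d; exact mul_left_comm _ _ _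

/-- Twisted lowering of the fourth index. -/
def dOp₄ : X4 F →ₗ[F] X4 F where
  toFun w a b c d := (q ^ (2 * (a + b + c)))⁻¹ * w a b c (d + 1)
  map_add' w w' := by funext a b c d; exact mul_add _ _ _
  map_smul' t w := by funext a b c d; exact mul_left_comm _ _ _

/-- The action of `σ₁σ₂σ₃` on coordinate functions. -/
def coxeterOp : X4 F →ₗ[F] X4 F := rFun₁ q s ∘ₗ rFun₂ q s ∘ₗ rFun₃ q s

variable {q s}

theorem dOp₁_apply (w : X4 F) (a b c d : ℕ) : dOp₁ w a b c d = w (a + 1) b c d := rfl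

theorem dOp₂_apply (w : X4 F) (a b c d : ℕ) :
    dOp₂ q w a b c d = (q ^ (2 * a))⁻¹ * w a (b + 1) c d := rfl

theorem dOp₃_apply (w : X4 F) (a b c d : ℕ) :
    dOp₃ q w a b c d = (q ^ (2 * (a + b)))⁻¹ * w a b (c + 1) d := rfl

theorem dOp₄_apply (w : X4 F) (a b c d : ℕ) :
    dOp₄ q w a b c d = (q ^ (2 * (a + b + c)))⁻¹ * w a b c (d + 1) := rfl

theorem coxeterOp_apply (w : X4 F) :
    coxeterOp q s w = rFun₁ q s (rFun₂ q s (rFun₃ q s w)) := rfl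

theorem rFun_mul_left (t : F) (w : ℕ → ℕ → F) (a b : ℕ) :
    rFun q s (fun i j => t * w i j) a b = t * rFun q s w a b :=
  congrFun₂ (map_smul (rFun q s) t w) a b

theorem rFun₁_dOp₁ (h : IsGeneric q s) (w : X4 F) :
    rFun₁ q s (dOp₁ w) = s • dOp₂ q (rFun₁ q s w) := by
  funext a b c d
  refine (rFun_shift h (fun i j => w i j c d) a b).trans ?_
  simp only [Pi.smul_apply, smul_eq_mul, dOp₂_apply, rFun₁_apply, mul_assoc]

theorem rFun₂_dOp₂ (h : IsGeneric q s) (w : X4 F) :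
    rFun₂ q s (dOp₂ q w) = s • dOp₃ q (rFun₂ q s w) := by
  funext a b c d
  refine (rFun_mul_left _ (fun i j => w a (i + 1) j d) b c).trans ?_
  rw [rFun_shift h fun i j => w a i j d]
  simp only [Pi.smul_apply, smul_eq_mul, dOp₃_apply, rFun₂_apply, mul_add, pow_add, mul_inv]
  ring

theorem rFun₃_dOp₃ (h : IsGeneric q s) (w : X4 F) :
    rFun₃ q s (dOp₃ q w) = s • dOp₄ q (rFun₃ q s w) := by
  funext a b c d
  refine (rFun_mul_left _ (fun i j => w a b (i + 1) j) c d).trans ?_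
  rw [rFun_shift h (w a b)]
  simp only [Pi.smul_apply, smul_eq_mul, dOp₄_apply, rFun₃_apply, mul_add, pow_add, mul_inv]
  ring

theorem rFun₁_dOp₃ (w : X4 F) : rFun₁ q s (dOp₃ q w) = dOp₃ q (rFun₁ q s w) := by
  funext a b c d
  exact rFun_diag q s (fun m => (q ^ (2 * m))⁻¹) (fun i j => w i j (c + 1) d) a b

theorem rFun₁_dOp₄ (w : X4 F) : rFun₁ q s (dOp₄ q w) = dOp₄ q (rFun₁ q s w) := by
  funext a b c d
  exact rFun_diag q s (fun m => (q ^ (2 * (m + c)))⁻¹) (fun i j => w i j c (d + 1)) a b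

theorem rFun₂_dOp₁ (w : X4 F) : rFun₂ q s (dOp₁ w) = dOp₁ (rFun₂ q s w) := rfl

theorem rFun₃_dOp₁ (w : X4 F) : rFun₃ q s (dOp₁ w) = dOp₁ (rFun₃ q s w) := rfl

theorem rFun₂_dOp₄ (w : X4 F) : rFun₂ q s (dOp₄ q w) = dOp₄ q (rFun₂ q s w) := by
  funext a b c d
  have := rFun_diag q s (fun m => (q ^ (2 * (a + m)))⁻¹) (fun i j => w a i j (d + 1)) b c
  simp only [rFun₂_apply, dOp₄_apply, add_assoc] at this ⊢
  exact this

theorem rFun₃_dOp₂ (w : X4 F) : rFun₃ q s (dOp₂ q w) = dOp₂ q (rFun₃ q s w) := by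
  funext a b c d
  exact rFun_mul_left _ (w a (b + 1)) c d

theorem coxeterOp_dOp₁ (h : IsGeneric q s) (w : X4 F) :
    coxeterOp q s (dOp₁ w) = s • dOp₂ q (coxeterOp q s w) := by
  rw [coxeterOp_apply, rFun₃_dOp₁, rFun₂_dOp₁, rFun₁_dOp₁ h, coxeterOp_apply]

theorem coxeterOp_dOp₂ (h : IsGeneric q s) (w : X4 F) :
    coxeterOp q s (dOp₂ q w) = s • dOp₃ q (coxeterOp q s w) := by
  rw [coxeterOp_apply, rFun₃_dOp₂, rFun₂_dOp₂ h, map_smul, rFun₁_dOp₃, coxeterOp_apply]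

theorem coxeterOp_dOp₃ (h : IsGeneric q s) (w : X4 F) :
    coxeterOp q s (dOp₃ q w) = s • dOp₄ q (coxeterOp q s w) := by
  rw [coxeterOp_apply, rFun₃_dOp₃ h, map_smul, map_smul, rFun₂_dOp₄, rFun₁_dOp₄, coxeterOp_apply]

/-- On the slice $a=0$ each $R$ has a single term, and $\sigma_1\sigma_2\sigma_3$ is a cyclic
rotation of the indices up to a power of $s$. -/
theorem coxeterOp_zero (w : X4 F) (b c d : ℕ) :
    coxeterOp q s w 0 b c d = (s ^ (b + c + d))⁻¹ * w b c d 0 := by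
  rw [coxeterOp_apply, rFun₁_apply, rFun_zero_left, rFun₂_apply, rFun_zero_left, rFun₃_apply,
    rFun_zero_left, pow_add, pow_add]
  simp only [mul_inv]
  ring

theorem coxeterOp_mem_hwSpace (h : IsGeneric q s) {N : ℕ} {w : X4 F}
    (hw : w ∈ hwSpace q s N) : coxeterOp q s w ∈ hwSpace q s N :=
  rOp_mem_hwSpace h 0 (rOp_mem_hwSpace h 1 (rOp_mem_hwSpace h 2 hw))

theorem dOp₁_mem_hwSpace {N : ℕ} {w : X4 F}
    (hw : w ∈ hwSpace q s (N + 1)) : dOp₁ w ∈ hwSpace q s N := by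
  refine ⟨fun a b c d hN => hw.1 _ _ _ _ (by omega), ?_⟩
  change eOp q s _ = 0
  funext a b c d
  exact congrFun₂ (congrFun₂ hw.2 (a + 1) b) c d

theorem dOp₂_mem_hwSpace (h : IsGeneric q s) {N : ℕ} {w : X4 F}
    (hw : w ∈ hwSpace q s (N + 1)) : dOp₂ q w ∈ hwSpace q s N := by
  refine ⟨fun a b c d hN => ?_, ?_⟩
  · rw [dOp₂_apply, hw.1 _ _ _ _ (by omega), mul_zero]
  · change eOp q s _ = 0
    funext a b c d
    have := congrFun₂ (congrFun₂ hw.2 a (b + 1)) c d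
    have hq := h.q_ne_zero
    rw [eOp_apply] at this
    simp only [eOp_apply, dOp₂_apply]
    refine Eq.trans ?_ ((congrArg ((q ^ (2 * a))⁻¹ * ·) this).trans (mul_zero _))
    simp only [mul_add, pow_add]
    field_simp

theorem dOp₃_mem_hwSpace (h : IsGeneric q s) {N : ℕ} {w : X4 F}
    (hw : w ∈ hwSpace q s (N + 1)) : dOp₃ q w ∈ hwSpace q s N := by
  refine ⟨fun a b c d hN => ?_, ?_⟩
  · rw [dOp₃_apply, hw.1 _ _ _ _ (by omega), mul_zero]
  · change eOp q s _ = 0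
    funext a b c d
    have := congrFun₂ (congrFun₂ hw.2 a b) (c + 1) d
    have hq := h.q_ne_zero
    rw [eOp_apply] at this
    simp only [eOp_apply, dOp₃_apply]
    refine Eq.trans ?_ ((congrArg ((q ^ (2 * (a + b)))⁻¹ * ·) this).trans (mul_zero _))
    simp only [mul_add, pow_add]
    field_simp

theorem dOp₄_mem_hwSpace (h : IsGeneric q s) {N : ℕ} {w : X4 F}
    (hw : w ∈ hwSpace q s (N + 1)) : dOp₄ q w ∈ hwSpace q s N := by
  refine ⟨fun a b c d hN => ?_, ?_⟩
  · rw [dOp₄_apply, hw.1 _ _ _ _ (by omega), mul_zero]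
  · change eOp q s _ = 0
    funext a b c d
    have := congrFun₂ (congrFun₂ hw.2 a b) c (d + 1)
    have hq := h.q_ne_zero
    rw [eOp_apply] at this
    simp only [eOp_apply, dOp₄_apply]
    refine Eq.trans ?_ ((congrArg ((q ^ (2 * (a + b + c)))⁻¹ * ·) this).trans (mul_zero _))
    simp only [mul_add, pow_add]
    field_simp

/-- This closes the cycle of the four lowering operators, but only on highest weight functions. Both
sides are highest weight, so the slice $a=0$ suffices. There $Ew=0$ and
$E(\sigma_1\sigma_2\sigma_3w)=0$ determine the scalar. -/
theorem coxeterOp_dOp₄ (h : IsGeneric q s) {N : ℕ} {w : X4 F} (hw : w ∈ hwSpace q s (N + 1)) :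
    coxeterOp q s (dOp₄ q w) = (s ^ 5 * (q ^ (4 * N))⁻¹) • dOp₁ (coxeterOp q s w) := by
  have hq := h.q_ne_zero
  have hs := h.s_ne_zero
  have hu : coxeterOp q s (dOp₄ q w) - (s ^ 5 * (q ^ (4 * N))⁻¹) • dOp₁ (coxeterOp q s w) ∈
      hwSpace q s N :=
    Submodule.sub_mem _ (coxeterOp_mem_hwSpace h (dOp₄_mem_hwSpace h hw))
      (Submodule.smul_mem _ _ (dOp₁_mem_hwSpace (coxeterOp_mem_hwSpace h hw)))
  rw [← sub_eq_zero]
  refine eq_zero_of_eOp_eq_zero h hu.2 fun b c d => ?_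
  by_cases hN : b + c + d = N
  · have h1 := congrFun₂ (congrFun₂ (coxeterOp_mem_hwSpace h hw).2 0 b) c d
    have h2 := congrFun₂ (congrFun₂ hw.2 b c) d 0
    rw [eOp_apply, coxeterOp_zero, coxeterOp_zero, coxeterOp_zero] at h1
    rw [eOp_apply] at h2
    simp only [Pi.zero_apply] at h1 h2
    simp only [Pi.sub_apply, Pi.smul_apply, smul_eq_mul, dOp₁_apply, coxeterOp_zero, dOp₄_apply]
    subst hN
    generalize coxeterOp q s w (0 + 1) b c d = X at *
    have e4 : 4 * (b + c + d) = 2 * (b + c + d) + 2 * (b + c + d) := by ring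
    simp only [e4, mul_add 2, pow_add, mul_zero, add_zero, pow_zero, pow_one, inv_one,
      mul_one] at h1 h2 ⊢
    have hb := pow_ne_zero (2 * b) hq
    have hc := pow_ne_zero (2 * c) hq
    have hd := pow_ne_zero (2 * d) hq
    have sb := pow_ne_zero b hs
    have sc := pow_ne_zero c hs
    have sd := pow_ne_zero d hs
    generalize q ^ (2 * b) = B at *
    generalize q ^ (2 * c) = C at *
    generalize q ^ (2 * d) = D at *
    generalize s ^ b = sB at *
    generalize s ^ c = sC at *
    generalize s ^ d = sD at *
    field_simp at h1 h2 ⊢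
    linear_combination (-s) * h1 + B * h2
  · exact hu.1 _ _ _ _ (by omega)

/-- The Coxeter element permutes the four lowering operators cyclically up to scalars, so its fourth
power commutes with each of them up to the same factor $s^3k$. Since a function of positive weight
is determined by its four lowerings, the scalar is found by induction on the weight. -/
theorem coxeterOp_pow_four (h : IsGeneric q s) (N : ℕ) : ∃ t : F, t ≠ 0 ∧
    ∀ w ∈ hwSpace q s N,
      coxeterOp q s (coxeterOp q s (coxeterOp q s (coxeterOp q s w))) = t • w := by
  have hq := h.q_ne_zero
  have hs := h.s_ne_zero
  induction N with
  | zero =>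
    refine ⟨1, one_ne_zero, fun w hw => ?_⟩
    have h1 := coxeterOp_mem_hwSpace h hw
    have h2 := coxeterOp_mem_hwSpace h h1
    have h3 := coxeterOp_mem_hwSpace h h2
    have h4 := coxeterOp_mem_hwSpace h h3
    rw [one_smul]
    funext a b c d
    by_cases h0 : a + b + c + d = 0
    · obtain ⟨rfl, rfl, rfl, rfl⟩ : a = 0 ∧ b = 0 ∧ c = 0 ∧ d = 0 := by omega
      simp [coxeterOp_zero]
    · rw [hw.1 _ _ _ _ h0, h4.1 _ _ _ _ h0]
  | succ N ih =>
    obtain ⟨t, ht, ih⟩ := ih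
    set k := s ^ 5 * (q ^ (4 * N))⁻¹ with hk
    have hk0 : k ≠ 0 := mul_ne_zero (pow_ne_zero _ hs) (inv_ne_zero (pow_ne_zero _ hq))
    have hr0 : s ^ 3 * k ≠ 0 := mul_ne_zero (pow_ne_zero _ hs) hk0
    refine ⟨t / (s ^ 3 * k), div_ne_zero ht hr0, fun w hw => ?_⟩
    have h1 := coxeterOp_mem_hwSpace h hw
    have h2 := coxeterOp_mem_hwSpace h h1
    have h3 := coxeterOp_mem_hwSpace h h2
    have h4 := coxeterOp_mem_hwSpace h h3
    have hr (x y : X4 F) (hxy : t • x = (s ^ 3 * k) • y) : y = (t / (s ^ 3 * k)) • x := by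
      rw [div_eq_inv_mul, mul_smul, hxy, smul_smul, inv_mul_cancel₀ hr0, one_smul]
    have e1 := ih _ (dOp₁_mem_hwSpace hw)
    have e2 := ih _ (dOp₂_mem_hwSpace h hw)
    have e3 := ih _ (dOp₃_mem_hwSpace h hw)
    have e4 := ih _ (dOp₄_mem_hwSpace h hw)
    simp only [coxeterOp_dOp₁ h, coxeterOp_dOp₂ h, coxeterOp_dOp₃ h, map_smul, coxeterOp_dOp₄ h hw,
      coxeterOp_dOp₄ h h1, coxeterOp_dOp₄ h h2, coxeterOp_dOp₄ h h3, smul_smul, ← hk] at e1 e2 e3 e4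
    have f1 := hr _ _ (e1.symm.trans (by congr 1; ring))
    have f2 := hr _ _ (e2.symm.trans (by congr 1; ring))
    have f3 := hr _ _ (e3.symm.trans (by congr 1; ring))
    have f4 := hr _ _ (e4.symm.trans (by congr 1; ring))
    funext a b c d
    rcases a with _ | a
    · rcases b with _ | b
      · rcases c with _ | c
        · rcases d with _ | d
          · rw [h4.1 _ _ _ _ (by omega), Pi.smul_apply, Pi.smul_apply, Pi.smul_apply,
              Pi.smul_apply, hw.1 _ _ _ _ (by omega), smul_zero]
          · simpa [dOp₄_apply] using congrFun₂ (congrFun₂ f4 0 0) 0 d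
        · simpa [dOp₃_apply] using congrFun₂ (congrFun₂ f3 0 0) c d
      · simpa [dOp₂_apply] using congrFun₂ (congrFun₂ f2 0 b) c d
    · exact congrFun₂ (congrFun₂ f1 a b) c d

end FourFold

/-! ### Comparison of the operators with their action on coordinate functions -/

section Coordinates

variable {F : Type*} [Field F]

/-- The coordinates of an element of `V ⊗ V`. -/
def coord₂ : V2 F →ₗ[F] (ℕ → ℕ → F) where
  toFun t a b := (basis2 F).repr t (a, b)
  map_add' _ _ := by funext a b; simp
  map_smul' _ _ := by funext a b; simp

/-- The coordinates of an element of `V^{⊗4}`. -/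
def coord : V4 F →ₗ[F] X4 F where
  toFun t a b c d := (basis4 F).repr t ((a, b), (c, d))
  map_add' _ _ := by funext a b c d; simp
  map_smul' _ _ := by funext a b c d; simp

theorem coord₂_tmul (f g : V F) (a b : ℕ) : coord₂ (f ⊗ₜ[F] g) a b = f a * g b := by
  simp [coord₂, basis2, mul_comm]

theorem coord_tmul (t u : V2 F) (a b c d : ℕ) :
    coord (t ⊗ₜ[F] u) a b c d = coord₂ t a b * coord₂ u c d := by
  simp [coord, coord₂, basis4, mul_comm]

theorem coord_injective : Function.Injective (coord (F := F)) := by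
  intro t u htu
  refine (basis4 F).repr.injective (Finsupp.ext ?_)
  rintro ⟨⟨a, b⟩, ⟨c, d⟩⟩
  exact congrFun₂ (congrFun₂ htu a b) c d

variable {q s : F}

theorem rFun_single (i j a b : ℕ) :
    rFun q s (fun i' j' => if (i, j) = (i', j') then 1 else 0) a b =
      if a + b = i + j ∧ b ≤ i then rCoef q s (i - b) j b else 0 := by
  rw [rFun_apply]
  split_ifs with hab
  · rw [Finset.sum_eq_single (i - b, j)]
    · rw [if_pos (by rw [Prod.mk.injEq]; omega), mul_one]
    · rintro ⟨n, k⟩ - hne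
      rw [if_neg, mul_zero]
      intro h
      rw [Prod.mk.injEq] at h
      exact hne (by rw [Prod.mk.injEq]; omega)
    · intro hn
      exact absurd (mem_antidiagonal.2 (by simp only; omega)) hn
  · refine Finset.sum_eq_zero ?_
    rintro ⟨n, k⟩ hp
    rw [mem_antidiagonal] at hp
    rw [if_neg, mul_zero]
    intro h
    rw [Prod.mk.injEq] at h
    simp only at hp h
    omega

theorem coord₂_basis2 (i j : ℕ) :
    coord₂ (basis2 F (i, j)) = fun i' j' => if (i, j) = (i', j') then 1 else 0 := by
  funext a b
  change (basis2 F).repr (basis2 F (i, j)) (a, b) = _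
  rw [Module.Basis.repr_self, Finsupp.single_apply]

theorem basis2_apply (i j : ℕ) : basis2 F (i, j) = v F i ⊗ₜ[F] v F j := by
  simp [basis2, v]

/-- The product in $R$ is a quotient of two products starting at $0$. Absorbing the binomial then
turns it into a ratio of `fFact`, the form in which composition and symmetry are visible. -/
theorem R_coef_eq (h : IsGeneric q s) (n k b : ℕ) :
    (s ^ (b + n + k))⁻¹ * q ^ (2 * (b + n - n) * (k + n) + n * (n - 1) / 2)
        * qBinom F q (n + k) k
        * ∏ k' ∈ Finset.range n, (s * (q ^ (k' + k))⁻¹ - s⁻¹ * q ^ (k' + k)) =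
      rCoef q s n k b := by
  have hq := h.q_ne_zero
  have h1 := h.qFact_ne_zero n
  have h2 := h.qFact_ne_zero k
  have h3 : ∏ x ∈ Finset.range k, (s * (q ^ x)⁻¹ - s⁻¹ * q ^ x) ≠ 0 := by
    have := h.fFact_ne_zero k
    rw [fFact_eq hq] at this
    exact right_ne_zero_of_mul this
  rw [rCoef, fFact_eq hq, fFact_eq hq, qBinom, Nat.add_sub_cancel, Nat.add_sub_cancel,
    ← Nat.choose_two_right, add_comm n k, Finset.prod_range_add, add_comm b n, add_right_comm]
  simp only [add_comm k]
  generalize ∏ x ∈ Finset.range k, (s * (q ^ x)⁻¹ - s⁻¹ * q ^ x) = A at *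
  generalize ∏ x ∈ Finset.range n, (s * (q ^ (x + k))⁻¹ - s⁻¹ * q ^ (x + k)) = B
  field_simp

theorem coord₂_R (h : IsGeneric q s) (t : V2 F) : coord₂ (R F q s t) = rFun q s (coord₂ t) := by
  suffices coord₂ ∘ₗ R F q s = rFun q s ∘ₗ coord₂ from LinearMap.congr_fun this t
  refine (basis2 F).ext ?_
  rintro ⟨i, j⟩
  rw [LinearMap.comp_apply, LinearMap.comp_apply, coord₂_basis2, R, Module.Basis.constr_basis]
  funext a b
  rw [rFun_single]
  simp only [← basis2_apply, map_sum, map_smul, coord₂_basis2, Finset.sum_apply, Pi.smul_apply,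
    smul_eq_mul]
  split_ifs with hab
  · rw [Finset.sum_eq_single (i - b)]
    · obtain ⟨n, rfl⟩ := Nat.exists_eq_add_of_le hab.2
      rw [Nat.add_sub_cancel_left, if_pos (by rw [Prod.mk.injEq]; omega), mul_one]
      exact R_coef_eq h n j b
    · intro n hn hne
      rw [Finset.mem_range] at hn
      rw [if_neg, mul_zero]
      rw [Prod.mk.injEq]
      omega
    · intro hn
      rw [Finset.mem_range] at hn
      omega
  · refine Finset.sum_eq_zero fun n hn => ?_
    rw [Finset.mem_range] at hn
    rw [if_neg, mul_zero]
    rw [Prod.mk.injEq]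
    omega

theorem E_apply (f : V F) (a : ℕ) : E F f a = f (a + 1) := by
  induction f using Finsupp.induction_linear with
  | zero => simp
  | add f g hf hg => rw [map_add, Finsupp.add_apply, hf, hg, Finsupp.add_apply]
  | single j x =>
    rw [E, Finsupp.linearCombination_single]
    rcases j with _ | j
    · simp
    · simp [v, Finsupp.single_apply]

theorem K_apply (f : V F) (a : ℕ) : K F q s f a = s * (q ^ (2 * a))⁻¹ * f a := by
  induction f using Finsupp.induction_linear with
  | zero => simp
  | add f g hf hg => rw [map_add, Finsupp.add_apply, hf, hg, Finsupp.add_apply, mul_add]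
  | single j x =>
    rw [K, Finsupp.linearCombination_single]
    by_cases hj : j = a
    · subst hj
      simp [v, mul_comm]
    · simp [v, hj]

theorem coord₂_E2 (t : V2 F) : coord₂ (E2 F q s t) = eFun q s (coord₂ t) := by
  induction t using TensorProduct.induction_on with
  | zero => simp
  | add t u ht hu => simp only [map_add, ht, hu]
  | tmul f g =>
    funext a b
    simp only [E2, LinearMap.add_apply, TensorProduct.map_tmul, map_add, Pi.add_apply,
      coord₂_tmul, eFun_apply, E_apply, K_apply, LinearMap.id_apply]
    ring

theorem coord₂_K2 (t : V2 F) (a b : ℕ) :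
    coord₂ (K2 F q s t) a b = s ^ 2 * (q ^ (2 * (a + b)))⁻¹ * coord₂ t a b := by
  induction t using TensorProduct.induction_on with
  | zero => simp
  | add t u ht hu => simp only [map_add, Pi.add_apply, ht, hu, mul_add]
  | tmul f g =>
    simp only [K2, TensorProduct.map_tmul, coord₂_tmul, K_apply, mul_add, pow_add, mul_inv]
    ring

theorem coord_E4 (h : IsGeneric q s) (t : V4 F) : coord (E4 F q s t) = eOp q s (coord t) := by
  have hq := h.q_ne_zero
  induction t using TensorProduct.induction_on with
  | zero => simp only [LinearMap.map_zero]
  | add t u ht hu => simp only [LinearMap.map_add, ht, hu]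
  | tmul t u =>
    funext a b c d
    simp only [E4, LinearMap.add_apply, TensorProduct.map_tmul, LinearMap.map_add, Pi.add_apply,
      coord_tmul, eOp_apply, coord₂_E2, coord₂_K2, eFun_apply, LinearMap.id_apply, mul_add,
      pow_add]
    field_simp
    ring

theorem coord_assoc_symm (f g : V F) (t : V2 F) (a b c d : ℕ) :
    coord ((TensorProduct.tensorTensorTensorAssoc F (V F) (V F) (V F) (V F)).symm
      ((f ⊗ₜ[F] t) ⊗ₜ[F] g)) a b c d = f a * coord₂ t b c * g d := by
  induction t using TensorProduct.induction_on with
  | zero => simp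
  | add t u ht hu =>
    simp only [TensorProduct.tmul_add, TensorProduct.add_tmul, map_add, LinearMap.map_add,
      Pi.add_apply, ht, hu]
    ring
  | tmul f' g' =>
    rw [TensorProduct.tensorTensorTensorAssoc_symm_tmul, coord_tmul, coord₂_tmul, coord₂_tmul,
      coord₂_tmul]
    ring

theorem coord_braidOp (h : IsGeneric q s) (i : Fin 3) (t : V4 F) :
    coord (braidOp F q s i t) = rOp q s i (coord t) := by
  fin_cases i
  · change coord (TensorProduct.map (R F q s) LinearMap.id t) = rFun₁ q s (coord t)
    induction t using TensorProduct.induction_on with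
    | zero => simp only [LinearMap.map_zero]
    | add t u ht hu => simp only [LinearMap.map_add, ht, hu]
    | tmul t u =>
      funext a b c d
      rw [TensorProduct.map_tmul, coord_tmul, coord₂_R h, rFun₁_apply]
      simp only [coord_tmul, LinearMap.id_apply, mul_comm _ (coord₂ u c d)]
      exact (rFun_mul_left _ _ _ _).symm
  · change coord ((TensorProduct.tensorTensorTensorAssoc F (V F) (V F) (V F) (V F)).symm
      (TensorProduct.map (TensorProduct.map LinearMap.id (R F q s)) LinearMap.id
      (TensorProduct.tensorTensorTensorAssoc F (V F) (V F) (V F) (V F) t))) = rFun₂ q s (coord t)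
    induction t using TensorProduct.induction_on with
    | zero => simp only [LinearMap.map_zero, map_zero]
    | add t u ht hu => simp only [LinearMap.map_add, map_add, ht, hu]
    | tmul t u =>
      induction t using TensorProduct.induction_on with
      | zero => simp only [LinearMap.map_zero, map_zero, TensorProduct.zero_tmul]
      | add t t' ht hu => simp only [TensorProduct.add_tmul, LinearMap.map_add, map_add, ht, hu]
      | tmul f g =>
        induction u using TensorProduct.induction_on with
        | zero => simp only [LinearMap.map_zero, map_zero, TensorProduct.tmul_zero]
        | add t t' ht hu => simp only [TensorProduct.tmul_add, LinearMap.map_add, map_add, ht, hu]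
        | tmul f' g' =>
          funext a b c d
          rw [TensorProduct.tensorTensorTensorAssoc_tmul, TensorProduct.map_tmul,
            TensorProduct.map_tmul, coord_assoc_symm, coord₂_R h, rFun₂_apply]
          have h1 : (fun i j => coord ((f ⊗ₜ[F] g) ⊗ₜ[F] (f' ⊗ₜ[F] g')) a i j d) =
              fun i j => (f a * g' d) * coord₂ (g ⊗ₜ[F] f') i j := by
            funext i j
            simp only [coord_tmul, coord₂_tmul]
            ring
          rw [h1, rFun_mul_left]
          simp only [LinearMap.id_apply]
          ring
  · change coord (TensorProduct.map LinearMap.id (R F q s) t) = rFun₃ q s (coord t)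
    induction t using TensorProduct.induction_on with
    | zero => simp only [LinearMap.map_zero]
    | add t u ht hu => simp only [LinearMap.map_add, ht, hu]
    | tmul t u =>
      funext a b c d
      rw [TensorProduct.map_tmul, coord_tmul, coord₂_R h, rFun₃_apply]
      have h1 : coord (t ⊗ₜ[F] u) a b = fun i j => coord₂ t a b * coord₂ u i j := by
        funext i j
        exact coord_tmul _ _ _ _ _ _
      rw [h1, rFun_mul_left, LinearMap.id_apply]

/-! ### The weight spaces `V_{4,ℓ}` and `W_{4,ℓ}` -/

variable (F) in
/-- Extension of coordinates by zero. -/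
def extend (ℓ : ℕ) : V4l F ℓ →ₗ[F] X4 F where
  toFun u a b c d := if h : a + b + c + d = ℓ then u ⟨((a, b), (c, d)), h⟩ else 0
  map_add' u u' := by
    funext a b c d
    simp only [Pi.add_apply]
    split_ifs <;> simp
  map_smul' t u := by
    funext a b c d
    simp only [Pi.smul_apply, RingHom.id_apply]
    split_ifs <;> simp

theorem extend_apply {ℓ : ℕ} (u : V4l F ℓ) (a b c d : ℕ) :
    extend F ℓ u a b c d = if h : a + b + c + d = ℓ then u ⟨((a, b), (c, d)), h⟩ else 0 := rfl

theorem extend_idx {ℓ : ℕ} (u : V4l F ℓ) (x : Idx ℓ) :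
    extend F ℓ u x.1.1.1 x.1.1.2 x.1.2.1 x.1.2.2 = u x := dif_pos x.2

theorem coord_incl (ℓ : ℕ) (u : V4l F ℓ) : coord (incl F ℓ u) = extend F ℓ u := by
  funext a b c d
  change (basis4 F).repr (incl F ℓ u) ((a, b), (c, d)) = _
  rw [incl, Fintype.linearCombination_apply, map_sum, Finsupp.finsetSum_apply, extend_apply]
  simp only [map_smul, Module.Basis.repr_self, Finsupp.smul_apply, Finsupp.single_apply,
    smul_eq_mul, mul_ite, mul_one, mul_zero]
  split_ifs with h
  · rw [Finset.sum_eq_single ⟨((a, b), (c, d)), h⟩]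
    · rw [if_pos rfl]
    · intro x _ hx
      exact if_neg fun h' => hx (Subtype.ext h')
    · intro hx
      exact absurd (Finset.mem_univ _) hx
  · refine Finset.sum_eq_zero fun x _ => if_neg fun h' => h ?_
    have := x.2
    rw [h'] at this
    exact this

theorem extend_mem_weightSpace {ℓ : ℕ} (u : V4l F ℓ) : extend F ℓ u ∈ weightSpace F ℓ :=
  fun _ _ _ _ h => dif_neg h

theorem extend_injective (ℓ : ℕ) : Function.Injective (extend F ℓ) := by
  intro u u' h
  funext x
  rw [← extend_idx u x, h, extend_idx]

variable (F) in
/-- Restriction of a function to the indices of weight `ℓ`. -/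
def restrictIdx (ℓ : ℕ) : X4 F →ₗ[F] V4l F ℓ where
  toFun w x := w x.1.1.1 x.1.1.2 x.1.2.1 x.1.2.2
  map_add' _ _ := rfl
  map_smul' _ _ := rfl

theorem extend_restrictIdx {ℓ : ℕ} {w : X4 F} (hw : w ∈ weightSpace F ℓ) :
    extend F ℓ (restrictIdx F ℓ w) = w := by
  funext a b c d
  rw [extend_apply]
  split_ifs with h
  · rfl
  · exact (hw _ _ _ _ h).symm

theorem mem_W4l_iff (h : IsGeneric q s) {ℓ : ℕ} {u : V4l F ℓ} :
    u ∈ W4l F q s ℓ ↔ eOp q s (extend F ℓ u) = 0 := by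
  rw [W4l, LinearMap.mem_ker, LinearMap.comp_apply, ← coord_incl, ← coord_E4 h]
  exact (map_eq_zero_iff (coord (F := F)).toAddMonoidHom coord_injective).symm

theorem mem_W4l_iff_hwSpace (h : IsGeneric q s) {ℓ : ℕ} {u : V4l F ℓ} :
    u ∈ W4l F q s ℓ ↔ extend F ℓ u ∈ hwSpace q s ℓ := by
  rw [mem_W4l_iff h, mem_hwSpace]
  exact (and_iff_right (extend_mem_weightSpace u)).symm

/-! ### The representations of `B₄` -/

variable (q s) in
/-- The action of `σ_i` on `V_{4,ℓ}`. -/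
def rOpV (ℓ : ℕ) (i : Fin 3) : V4l F ℓ →ₗ[F] V4l F ℓ :=
  restrictIdx F ℓ ∘ₗ rOp q s i ∘ₗ extend F ℓ

theorem extend_rOpV (ℓ : ℕ) (i : Fin 3) (u : V4l F ℓ) :
    extend F ℓ (rOpV q s ℓ i u) = rOp q s i (extend F ℓ u) :=
  extend_restrictIdx (rOp_mem_weightSpace i (extend_mem_weightSpace u))

theorem rOpV_injective (h : IsGeneric q s) (ℓ : ℕ) (i : Fin 3) :
    Function.Injective (rOpV q s ℓ i) := by
  intro u u' hu
  apply extend_injective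
  apply rOp_injective h i
  rw [← extend_rOpV, hu, extend_rOpV]

/-- The action of `σ_i` on `V_{4,ℓ}`, as an element of `GL(V_{4,ℓ})`. -/
def sigmaV (h : IsGeneric q s) (ℓ : ℕ) (i : Fin 3) : V4l F ℓ ≃ₗ[F] V4l F ℓ :=
  LinearEquiv.ofInjectiveEndo (rOpV q s ℓ i) (rOpV_injective h ℓ i)

theorem extend_sigmaV (h : IsGeneric q s) (ℓ : ℕ) (i : Fin 3) (u : V4l F ℓ) :
    extend F ℓ (sigmaV h ℓ i u) = rOp q s i (extend F ℓ u) :=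
  extend_rOpV ℓ i u

theorem sigmaV_rels (h : IsGeneric q s) (ℓ : ℕ) :
    ∀ r ∈ braidRels, FreeGroup.lift (sigmaV h ℓ) r = 1 := by
  intro r hr
  rcases hr with rfl | rfl | rfl
  all_goals
    rw [map_mul, map_inv, mul_inv_eq_one]
    refine LinearEquiv.ext fun u => extend_injective ℓ ?_
    simp only [map_mul, FreeGroup.lift_apply_of, LinearEquiv.mul_apply, extend_sigmaV]
  exacts [rFun₁_braid h _, rFun₂_braid h _, rFun₁_comm _]

/-- The representation of `B₄` on `V_{4,ℓ}`. -/
def repV (h : IsGeneric q s) (ℓ : ℕ) : B4 →* (V4l F ℓ ≃ₗ[F] V4l F ℓ) :=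
  PresentedGroup.toGroup (sigmaV_rels h ℓ)

theorem repV_sigma (h : IsGeneric q s) (ℓ : ℕ) (i : Fin 3) :
    repV h ℓ (sigma i) = sigmaV h ℓ i := PresentedGroup.toGroup.of _

theorem incl_repV_sigma (h : IsGeneric q s) (ℓ : ℕ) (i : Fin 3) (u : V4l F ℓ) :
    incl F ℓ (repV h ℓ (sigma i) u) = braidOp F q s i (incl F ℓ u) := by
  apply coord_injective
  rw [coord_incl, repV_sigma, extend_sigmaV, coord_braidOp h, coord_incl]

theorem LinearEquiv.inv_mem_of_forall_mem {M : Type*} [AddCommGroup M] [Module F M]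
    [FiniteDimensional F M] {W : Submodule F M} {g : M ≃ₗ[F] M} (hg : ∀ w ∈ W, g w ∈ W) :
    ∀ w ∈ W, g⁻¹ w ∈ W := by
  intro w hw
  have h1 : W.map g.toLinearMap = W :=
    Submodule.eq_of_le_of_finrank_eq (Submodule.map_le_iff_le_comap.2 hg)
      (LinearEquiv.finrank_map_eq g W)
  rw [← h1] at hw
  obtain ⟨w', hw', rfl⟩ := hw
  change g⁻¹ (g w') ∈ W
  rw [← LinearEquiv.mul_apply, inv_mul_cancel]
  exact hw'

theorem rep_mem_of_sigma_mem {M : Type*} [AddCommGroup M] [Module F M]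
    [FiniteDimensional F M] {W : Submodule F M} (ρ : B4 →* (M ≃ₗ[F] M))
    (hW : ∀ i, ∀ w ∈ W, ρ (sigma i) w ∈ W) (β : B4) : ∀ w ∈ W, ρ β w ∈ W := by
  have hβ : β ∈ Subgroup.closure (Set.range sigma) := sigma_closure ▸ Subgroup.mem_top β
  induction hβ using Subgroup.closure_induction with
  | mem _ h =>
    obtain ⟨i, rfl⟩ := h
    exact hW i
  | one =>
    intro w hw
    rw [map_one]
    exact hw
  | mul a b _ _ ha hb =>
    intro w hw
    rw [map_mul]
    exact ha _ (hb _ hw)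
  | inv a _ ha =>
    rw [map_inv]
    exact LinearEquiv.inv_mem_of_forall_mem ha

/-- The restriction of a representation to an invariant subspace. -/
def subrep {G M : Type*} [Group G] [AddCommGroup M] [Module F M] (ρ : G →* (M ≃ₗ[F] M))
    (W : Submodule F M) (hW : ∀ g, ∀ w ∈ W, ρ g w ∈ W) : G →* (W ≃ₗ[F] W) where
  toFun g := LinearEquiv.ofLinearMap ((ρ g).toLinearMap.restrict (hW g))
    ((ρ g⁻¹).toLinearMap.restrict (hW g⁻¹))
    (by
      ext w
      change ρ g (ρ g⁻¹ w) = w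
      rw [← LinearEquiv.mul_apply, ← map_mul, mul_inv_cancel, map_one]
      rfl)
    (by
      ext w
      change ρ g⁻¹ (ρ g w) = w
      rw [← LinearEquiv.mul_apply, ← map_mul, inv_mul_cancel, map_one]
      rfl)
  map_one' := by
    ext w
    change ρ 1 w = w
    rw [map_one]
    rfl
  map_mul' g g' := by
    ext w
    change ρ (g * g') w = ρ g (ρ g' w)
    rw [map_mul]
    rfl

theorem repV_mem_W4l (h : IsGeneric q s) (ℓ : ℕ) (β : B4) :
    ∀ w ∈ W4l F q s ℓ, repV h ℓ β w ∈ W4l F q s ℓ := by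
  refine rep_mem_of_sigma_mem _ (fun i w hw => ?_) β
  rw [mem_W4l_iff_hwSpace h] at hw ⊢
  rw [repV_sigma, extend_sigmaV]
  exact rOp_mem_hwSpace h i hw

/-- The representation of `B₄` on `W_{4,ℓ}`. -/
def repW (h : IsGeneric q s) (ℓ : ℕ) : B4 →* (W4l F q s ℓ ≃ₗ[F] W4l F q s ℓ) :=
  subrep (repV h ℓ) _ (repV_mem_W4l h ℓ)

theorem coe_repW (h : IsGeneric q s) (ℓ : ℕ) (β : B4) (w : W4l F q s ℓ) :
    (repW h ℓ β w : V4l F ℓ) = repV h ℓ β w := rfl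

theorem repW_full_twist (h : IsGeneric q s) (ℓ : ℕ) : ∃ t : F, t ≠ 0 ∧
    ∀ w : W4l F q s ℓ, repW h ℓ ((sigma 0 * sigma 1 * sigma 2) ^ 4) w = t • w := by
  obtain ⟨t, ht, hw⟩ := coxeterOp_pow_four h ℓ
  refine ⟨t, ht, fun w => Subtype.ext (extend_injective ℓ ?_)⟩
  rw [coe_repW]
  simp only [pow_succ, pow_zero, one_mul, map_mul, LinearEquiv.mul_apply, repV_sigma,
    extend_sigmaV, Submodule.coe_smul, LinearMap.map_smul]
  exact hw _ ((mem_W4l_iff_hwSpace h).1 w.2)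

theorem zpow_apply_eq_smul {M : Type*} [AddCommGroup M] [Module F M] {g : M ≃ₗ[F] M} {t : F}
    (ht : t ≠ 0) (hg : ∀ w, g w = t • w) (n : ℤ) : ∀ w, (g ^ n) w = t ^ n • w := by
  have h1 : g = LinearEquiv.smulOfNeZero F M t ht := LinearEquiv.ext hg
  have h2 (w : M) : g⁻¹ w = t⁻¹ • w := by
    apply g.injective
    rw [← LinearEquiv.mul_apply, mul_inv_cancel, hg, smul_smul, mul_inv_cancel₀ ht, one_smul]
    rfl
  induction n using Int.induction_on with
  | zero => intro w; simp
  | succ n ih =>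
    intro w
    rw [zpow_add_one, LinearEquiv.mul_apply, hg, ih, smul_smul, zpow_add_one₀ ht]
  | pred n ih =>
    intro w
    rw [zpow_sub_one, LinearEquiv.mul_apply, h2, ih, smul_smul, zpow_sub_one₀ ht]

theorem repW_center (h : IsGeneric q s) (ℓ : ℕ) {z : B4} (hz : z ∈ Subgroup.center B4) :
    ∃ t : F, ∀ w : W4l F q s ℓ, repW h ℓ z w = t • w := by
  obtain ⟨n, rfl⟩ := center_eq_zpow hz
  obtain ⟨t, ht, hw⟩ := repW_full_twist h ℓ
  refine ⟨t ^ n, fun w => ?_⟩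
  rw [map_zpow]
  exact zpow_apply_eq_smul ht hw n w

end Coordinates

/-! ### The inverse transpose with respect to a bilinear form -/

section Form

variable {F : Type*} [Field F] {M : Type*} [AddCommGroup M] [Module F M]
variable {n : Type*} [Fintype n] [DecidableEq n] {b : Module.Basis n F M} {J : GL n F}
variable {B : LinearMap.BilinForm F M}

theorem transpose_eq_of_toMatrix_eq (hJ : LinearMap.BilinForm.toMatrix b B = (J⁻¹).1)
    (hB : B.IsSymm) : J.1.transpose = J.1 := by
  have h1 : (J⁻¹).1.transpose = (J⁻¹).1 := by
    rw [← hJ]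
    exact LinearMap.BilinForm.isSymm_toMatrix_iff_isSymm b |>.2 hB
  have h2 : J.1.transpose * (J⁻¹).1 = 1 := by
    rw [← h1, ← Matrix.transpose_mul, Units.inv_mul, Matrix.transpose_one]
  calc J.1.transpose = J.1.transpose * (J⁻¹).1 * J.1 := by rw [mul_assoc, Units.inv_mul, mul_one]
    _ = J.1 := by rw [h2, one_mul]

/-- When the Gram matrix is $J^{-1}$, the automorphism `phi` is the inverse of the adjoint. From
here on no matrices are needed. -/
theorem form_phi (hJ : LinearMap.BilinForm.toMatrix b B = (J⁻¹).1) (hB : B.IsSymm) (A : M ≃ₗ[F] M)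
    (u v : M) : B (phi b J A u) (A v) = B u v := by
  have hJt := transpose_eq_of_toMatrix_eq hJ hB
  have hJt' : (J⁻¹).1.transpose = (J⁻¹).1 := by
    rw [← hJ]
    exact LinearMap.BilinForm.isSymm_toMatrix_iff_isSymm b |>.2 hB
  have h1 : B.comp (phi b J A).toLinearMap A.toLinearMap = B := by
    apply (LinearMap.BilinForm.toMatrix b).injective
    refine (LinearMap.BilinForm.toMatrix_comp b b B _ _).trans ?_
    rw [← toGL_val, ← toGL_val, toGL_phi, hJ]
    have h2 : (invTranspose (toGL b A)).1 = ((toGL b A)⁻¹).1.transpose := rfl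
    rw [Units.val_mul, Units.val_mul, h2, Matrix.transpose_mul, Matrix.transpose_mul, hJt, hJt',
      Matrix.transpose_transpose, mul_assoc, mul_assoc, mul_assoc, ← mul_assoc J.1,
      Units.mul_inv, one_mul, Units.inv_mul, mul_one]
  exact LinearMap.congr_fun₂ h1 u v

theorem eq_of_form_eq (hnd : B.SeparatingLeft) {A g g' : M ≃ₗ[F] M}
    (h : ∀ u v, B (g u) (A v) = B (g' u) (A v)) : g = g' := by
  refine LinearEquiv.ext fun u => sub_eq_zero.1 (hnd _ fun v => ?_)
  obtain ⟨v, rfl⟩ := A.surjective v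
  rw [map_sub, LinearMap.sub_apply, h, sub_self]

theorem eq_phi (hJ : LinearMap.BilinForm.toMatrix b B = (J⁻¹).1)
    (hB : B.IsSymm) (hnd : B.SeparatingLeft) {A g : M ≃ₗ[F] M} (h : ∀ u v, B (g u) (A v) = B u v) :
    phi b J A = g :=
  eq_of_form_eq hnd (A := A) fun u v => by rw [form_phi hJ hB, h]

theorem phi_phi (hJ : LinearMap.BilinForm.toMatrix b B = (J⁻¹).1)
    (hB : B.IsSymm) (hnd : B.SeparatingLeft) (A : M ≃ₗ[F] M) : phi b J (phi b J A) = A :=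
  eq_phi hJ hB hnd fun u v => by rw [hB.eq, form_phi hJ hB, hB.eq]

theorem phi_eq_inv (hJ : LinearMap.BilinForm.toMatrix b B = (J⁻¹).1) (hB : B.IsSymm)
    (hnd : B.SeparatingLeft) {A : M ≃ₗ[F] M} (h : ∀ u v, B (A u) v = B u (A v)) :
    phi b J A = A⁻¹ :=
  eq_phi hJ hB hnd fun u v => by
    rw [← h, ← LinearEquiv.mul_apply, mul_inv_cancel]
    rfl

theorem phiPSL_toPSL (A : SpecialLinearGroup F M) :
    phiPSL b J (toPSL A) = toPSL (phiSL b J A) := rfl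

theorem phiPSL_mul_self (hJ : LinearMap.BilinForm.toMatrix b B = (J⁻¹).1) (hB : B.IsSymm)
    (hnd : B.SeparatingLeft) : phiPSL b J * phiPSL b J = 1 := by
  have h1 : phiSL b J * phiSL b J = 1 :=
    MulEquiv.ext fun A => Subtype.ext (phi_phi hJ hB hnd A.1)
  rw [phiPSL, ← map_mul, h1, map_one]

theorem phiPSL_conj (b : Module.Basis n F M) (J : GL n F) (g : M ≃ₗ[F] M) :
    phiPSL b J * conjPSL g * (phiPSL b J)⁻¹ = conjPSL (phi b J g) := by
  have h1 : phiSL b J * conjSL g = conjSL (phi b J g) * phiSL b J := by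
    refine MulEquiv.ext fun A => Subtype.ext ?_
    change phi b J (g * A.1 * g⁻¹) = phi b J g * phi b J A.1 * (phi b J g)⁻¹
    rw [map_mul, map_mul, map_inv]
  rw [mul_inv_eq_iff_eq_mul, phiPSL, conjPSL, MonoidHom.comp_apply, MonoidHom.comp_apply,
    ← map_mul, h1, map_mul]

theorem conjPSL_eq_one {g : M ≃ₗ[F] M} {t : F} (hg : ∀ w, g w = t • w) : conjPSL g = 1 := by
  have h1 : conjSL g = 1 := by
    refine MulEquiv.ext fun A => Subtype.ext ?_
    change g * A.1 * g⁻¹ = A.1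
    rw [mul_inv_eq_iff_eq_mul]
    refine LinearEquiv.ext fun w => ?_
    change g (A.1 w) = A.1 (g w)
    rw [hg, hg, map_smul]
  rw [conjPSL, MonoidHom.comp_apply, h1, map_one]

/-- Take $x$ with $B(x,x)\ne0$ and a transvection $A=1+f(\cdot)x$ with $f(x)=0$, $f(y)\neq0$. If
$\varphi(A)=rA$, then $rB(Au,Av)=B(u,v)$. The pair $(x,x)$ gives $r=1$, and $(x,y)$ gives
$f(y)B(x,x)=0$. -/
theorem phiPSL_ne_one [CharZero F] [FiniteDimensional F M]
    (hJ : LinearMap.BilinForm.toMatrix b B = (J⁻¹).1) (hB : B.IsSymm) (hnd : B.SeparatingLeft)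
    (hM : 2 ≤ Module.finrank F M) : phiPSL b J ≠ 1 := by
  intro h1
  have hB0 : B ≠ 0 := by
    rintro rfl
    obtain ⟨v, hv⟩ : ∃ v : M, v ≠ 0 := by
      have : Nontrivial M := Module.nontrivial_of_finrank_pos (R := F) (by omega)
      exact exists_ne 0
    exact hv (hnd v fun _ => rfl)
  have : Invertible (2 : F) := invertibleOfNonzero two_ne_zero
  obtain ⟨x, hx⟩ := LinearMap.BilinForm.exists_bilinForm_self_ne_zero hB0 ⟨hB.eq⟩
  obtain ⟨y, hy⟩ : ∃ y, y ∉ Submodule.span F {x} := by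
    by_contra! hc
    have h2 : Submodule.span F {x} = ⊤ := eq_top_iff.2 fun y _ => hc y
    have h3 := finrank_span_le_card (R := F) ({x} : Set M)
    rw [h2, finrank_top] at h3
    simp at h3
    omega
  obtain ⟨f, hfy, hfx⟩ : ∃ f : Module.Dual F M, f y ≠ 0 ∧ f x = 0 := by
    obtain ⟨f, hf, hfx⟩ := Submodule.exists_le_ker_of_notMem hy
    exact ⟨f, hf, hfx (Submodule.mem_span_singleton_self x)⟩
  let A : SpecialLinearGroup F M := ⟨LinearEquiv.transvection hfx, by simp⟩
  have hA (v : M) : A.1 v = v + f v • x := rfl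
  have h2 : toPSL (phiSL b J A) = toPSL A := by
    rw [← phiPSL_toPSL, h1]
    rfl
  obtain ⟨r, -, hr⟩ := SpecialLinearGroup.mem_center_iff.1 (QuotientGroup.eq.1 h2.symm)
  have h3 (u : M) : phi b J A.1 u = r • A.1 u := by
    have h4 : phiSL b J A = A * (A⁻¹ * phiSL b J A) := by group
    have h5 : (A⁻¹ * phiSL b J A).1 u = r • u := LinearMap.congr_fun hr u
    have h6 : phi b J A.1 = A.1 * (A⁻¹ * phiSL b J A).1 := congrArg Subtype.val h4
    rw [h6, LinearEquiv.mul_apply, h5, map_smul]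
  have h4 (u v : M) : r * B (A.1 u) (A.1 v) = B u v := by
    rw [← form_phi hJ hB A.1 u v, h3, map_smul, LinearMap.smul_apply, smul_eq_mul]
  have h5 : r = 1 := by
    have := h4 x x
    rw [hA, hfx, zero_smul, add_zero] at this
    exact (mul_eq_right₀ hx).1 this
  have h6 := h4 x y
  rw [h5, one_mul, hA, hA, hfx, zero_smul, add_zero, map_add, map_smul, smul_eq_mul] at h6
  exact mul_ne_zero hfy hx (by linear_combination h6)

/-- The orthogonal complement of a subspace is preserved by `φ(g)` if the subspace is preserved
by `g`. -/
theorem phi_mem_orthogonal [FiniteDimensional F M] (hJ : LinearMap.BilinForm.toMatrix b B = (J⁻¹).1)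
    (hB : B.IsSymm) {W : Submodule F M} {g : M ≃ₗ[F] M} (hg : ∀ w ∈ W, g w ∈ W) :
    ∀ c ∈ B.orthogonal W, phi b J g c ∈ B.orthogonal W := by
  intro c hc
  rw [LinearMap.BilinForm.mem_orthogonal_iff] at hc ⊢
  intro w hw
  have h1 := hc _ (LinearEquiv.inv_mem_of_forall_mem hg w hw)
  have h2 := form_phi hJ hB g c (g⁻¹ w)
  rw [← LinearEquiv.mul_apply, mul_inv_cancel] at h2
  exact (hB.eq _ _).trans (h2.trans ((hB.eq _ _).trans h1))

/-- $\varphi(g)$ preserves $W=W^{\perp\perp}$ because $g$ preserves $W^\perp$. On $W$ it satisfies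
the equation that characterizes the inverse adjoint of $A$ for the restricted form. -/
theorem phi_restrict [FiniteDimensional F M] (hJ : LinearMap.BilinForm.toMatrix b B = (J⁻¹).1)
    (hB : B.IsSymm) (hnd : B.Nondegenerate) {W : Submodule F M}
    {m : Type*} [Fintype m] [DecidableEq m] {bW : Module.Basis m F W} {JW : GL m F}
    (hJW : LinearMap.BilinForm.toMatrix bW (B.restrict W) = (JW⁻¹).1)
    (hndW : (B.restrict W).SeparatingLeft)
    {g : M ≃ₗ[F] M} {A : W ≃ₗ[F] W} (hA : ∀ w : W, g w = A w)
    (hg : ∀ c ∈ B.orthogonal W, g c ∈ B.orthogonal W) (w : W) :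
    phi b J g w = phi bW JW A w := by
  have h1 : phi b J g w ∈ W := by
    refine (LinearMap.BilinForm.orthogonal_orthogonal hnd hB.isRefl W).le ?_
    exact phi_mem_orthogonal hJ hB hg _ (LinearMap.BilinForm.le_orthogonal_orthogonal hB.isRefl w.2)
  have h2 : (⟨_, h1⟩ : W) = phi bW JW A w := by
    refine sub_eq_zero.1 (hndW _ fun v => ?_)
    obtain ⟨v, rfl⟩ := A.surjective v
    rw [map_sub, LinearMap.sub_apply, form_phi hJW (hB.restrict W)]
    change B (phi b J g w) (A v : M) - B w v = 0
    rw [← hA, form_phi hJ hB, sub_self]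
  rw [← h2]

end Form

/-! ### The lowering operator -/

section Lowering

variable {F : Type*} [Field F] (q s : F)

/-- The action of `F` on coordinate functions. -/
def fOp : X4 F →ₗ[F] X4 F where
  toFun w a b c d := fCoef q s a * w (a - 1) b c d +
    s⁻¹ * q ^ (2 * a) * fCoef q s b * w a (b - 1) c d +
    (s ^ 2)⁻¹ * q ^ (2 * (a + b)) * fCoef q s c * w a b (c - 1) d +
    (s ^ 3)⁻¹ * q ^ (2 * (a + b + c)) * fCoef q s d * w a b c (d - 1)
  map_add' w w' := by
    funext a b c d
    simp only [Pi.add_apply]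
    ring
  map_smul' t w := by
    funext a b c d
    simp only [Pi.smul_apply, smul_eq_mul, RingHom.id_apply]
    ring

variable {q s}

theorem fOp_apply (w : X4 F) (a b c d : ℕ) : fOp q s w a b c d =
    fCoef q s a * w (a - 1) b c d +
    s⁻¹ * q ^ (2 * a) * fCoef q s b * w a (b - 1) c d +
    (s ^ 2)⁻¹ * q ^ (2 * (a + b)) * fCoef q s c * w a b (c - 1) d +
    (s ^ 3)⁻¹ * q ^ (2 * (a + b + c)) * fCoef q s d * w a b c (d - 1) := rfl

/-- The relation for $[E,F]$ on the fourfold tensor product: the single-factor commutators telescope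
to a function of the total weight. -/
theorem eOp_fOp (h : IsGeneric q s) (w : X4 F) (a b c d : ℕ) :
    eOp q s (fOp q s w) a b c d = fOp q s (eOp q s w) a b c d +
      (s ^ 4 * (q ^ (2 * (a + b + c + d)))⁻¹ - (s ^ 4)⁻¹ * q ^ (2 * (a + b + c + d))) *
        w a b c d := by
  have hq := h.q_ne_zero
  have hs := h.s_ne_zero
  have key (m : ℕ) : fCoef q s (m + 1) =
      fCoef q s m + (s * (q ^ (2 * m))⁻¹ - s⁻¹ * q ^ (2 * m)) := by
    rw [← fCoef_succ_sub h, add_sub_cancel]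
  simp only [eOp_apply, fOp_apply, Nat.add_sub_cancel, key]
  -- The cases only serve the truncated index $a-1$, which is harmless because `fCoef q s 0 = 0`.
  rcases a with _ | a <;> rcases b with _ | b <;> rcases c with _ | c <;> rcases d with _ | d <;>
    simp only [fCoef_zero, Nat.add_sub_cancel, mul_zero, zero_mul, add_zero, zero_add] <;>
    field_simp <;> ring

end Lowering

/-! ### Operators on indicator functions of indices -/

section Delta

variable {F : Type*} [Field F]

variable (F) in
/-- The indicator function of an index. -/
def delta (a b c d : ℕ) : X4 F := fun a' b' c' d' =>
  if a' = a ∧ b' = b ∧ c' = c ∧ d' = d then 1 else 0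

theorem extend_single {ℓ : ℕ} (x : Idx ℓ) :
    extend F ℓ (Pi.single x 1) = delta F x.1.1.1 x.1.1.2 x.1.2.1 x.1.2.2 := by
  obtain ⟨⟨⟨a, b⟩, ⟨c, d⟩⟩, hx⟩ := x
  change a + b + c + d = ℓ at hx
  funext a' b' c' d'
  rw [extend_apply, delta]
  simp only [Pi.single_apply, Subtype.mk.injEq, Prod.mk.injEq, and_assoc]
  split_ifs with h1 h2
  · rfl
  · rfl
  · omega
  · rfl

variable {q s : F}

theorem fCoef_mul_ite (m n : ℕ) (p : Prop) [Decidable p] :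
    fCoef q s m * (if m - 1 = n ∧ p then 1 else 0) =
      fCoef q s (n + 1) * if m = n + 1 ∧ p then 1 else 0 := by
  rcases m with _ | m
  · rw [fCoef_zero, zero_mul, if_neg (by omega), mul_zero]
  · rw [Nat.add_sub_cancel]
    by_cases hp : m = n ∧ p
    · rw [if_pos hp, if_pos ⟨congrArg (· + 1) hp.1, hp.2⟩, hp.1]
    · rw [if_neg hp, if_neg fun h => hp ⟨Nat.succ.inj h.1, h.2⟩, mul_zero, mul_zero]

theorem fOp_delta (a b c d : ℕ) : fOp q s (delta F a b c d) =
    fCoef q s (a + 1) • delta F (a + 1) b c d +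
    (s⁻¹ * q ^ (2 * a) * fCoef q s (b + 1)) • delta F a (b + 1) c d +
    ((s ^ 2)⁻¹ * q ^ (2 * (a + b)) * fCoef q s (c + 1)) • delta F a b (c + 1) d +
    ((s ^ 3)⁻¹ * q ^ (2 * (a + b + c)) * fCoef q s (d + 1)) • delta F a b c (d + 1) := by
  funext a' b' c' d'
  simp only [fOp_apply, Pi.add_apply, Pi.smul_apply, smul_eq_mul]
  congr 1
  · congr 1
    · congr 1
      · exact fCoef_mul_ite a' a _
      · simp only [delta, and_left_comm (a := a' = a), mul_assoc]
        rw [fCoef_mul_ite b' b]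
        by_cases ha : a' = a
        · rw [ha]
        · simp [ha]
    · simp only [delta, and_left_comm (b := c' - 1 = c), and_left_comm (b := c' = c + 1), mul_assoc]
      rw [fCoef_mul_ite c' c]
      by_cases ha : a' = a ∧ b' = b
      · rw [ha.1, ha.2]
      · rw [if_neg (by tauto)]
        ring
  · simp only [delta, mul_assoc]
    have e (p : Prop) : (a' = a ∧ b' = b ∧ c' = c ∧ p) ↔ (p ∧ a' = a ∧ b' = b ∧ c' = c) := by
      tauto
    simp only [e (d' - 1 = d), e (d' = d + 1)]
    rw [fCoef_mul_ite d' d]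
    by_cases ha : a' = a ∧ b' = b ∧ c' = c
    · rw [ha.1, ha.2.1, ha.2.2]
    · rw [if_neg (by tauto)]
      ring

end Delta

/-! ### Decomposition into images of highest weight functions -/

section Decomposition

variable {F : Type*} [Field F] {q s : F}

theorem fOp_mem_weightSpace {N : ℕ} {w : X4 F} (hw : w ∈ weightSpace F N) :
    fOp q s w ∈ weightSpace F (N + 1) := by
  have key (m : ℕ) (x : F) (hx : m ≠ 0 → x = 0) : fCoef q s m * x = 0 := by
    rcases m with _ | m
    · rw [fCoef_zero, zero_mul]
    · rw [hx (by omega), mul_zero]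
  intro a b c d hN
  rw [fOp_apply, mul_assoc (s⁻¹ * _), mul_assoc ((s ^ 2)⁻¹ * _), mul_assoc ((s ^ 3)⁻¹ * _),
    key a _ fun h0 => hw _ _ _ _ (by omega), key b _ fun h0 => hw _ _ _ _ (by omega),
    key c _ fun h0 => hw _ _ _ _ (by omega), key d _ fun h0 => hw _ _ _ _ (by omega)]
  simp

theorem eOp_mem_weightSpace {N : ℕ} {w : X4 F} (hw : w ∈ weightSpace F (N + 1)) :
    eOp q s w ∈ weightSpace F N := by
  intro a b c d hN
  rw [eOp_apply, hw _ _ _ _ (by omega), hw _ _ _ _ (by omega), hw _ _ _ _ (by omega),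
    hw _ _ _ _ (by omega)]
  simp

theorem weightSpace_zero_le : weightSpace F 0 ≤ hwSpace q s 0 := by
  refine fun w hw => mem_hwSpace.2 ⟨hw, ?_⟩
  funext a b c d
  rw [eOp_apply, hw _ _ _ _ (by omega), hw _ _ _ _ (by omega), hw _ _ _ _ (by omega),
    hw _ _ _ _ (by omega)]
  simp

theorem fOp_pow_mem_weightSpace {j : ℕ} {w : X4 F} (hw : w ∈ weightSpace F j) (k : ℕ) :
    (fOp q s ^ k) w ∈ weightSpace F (j + k) := by
  induction k with
  | zero => exact hw
  | succ k ih =>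
    rw [pow_succ', Module.End.mul_apply]
    exact fOp_mem_weightSpace ih

theorem eOp_fOp_of_mem (h : IsGeneric q s) {N : ℕ} {w : X4 F} (hw : w ∈ weightSpace F N) :
    eOp q s (fOp q s w) = fOp q s (eOp q s w) +
      (s ^ 4 * (q ^ (2 * N))⁻¹ - (s ^ 4)⁻¹ * q ^ (2 * N)) • w := by
  funext a b c d
  rw [eOp_fOp h]
  change _ = fOp q s (eOp q s w) a b c d + _ * w a b c d
  by_cases hN : a + b + c + d = N
  · rw [hN]
  · rw [hw _ _ _ _ hN, mul_zero, mul_zero]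

/-- The induction step in summing the commutators of $E$ with the factors of $F^{k+1}$. -/
theorem qInt_weight_identity (h : IsGeneric q s) (j k : ℕ) :
    qInt F q (k + 1) * (s ^ 4 * (q ^ (2 * j + k))⁻¹ - (s ^ 4)⁻¹ * q ^ (2 * j + k)) +
      (s ^ 4 * (q ^ (2 * (j + (k + 1))))⁻¹ - (s ^ 4)⁻¹ * q ^ (2 * (j + (k + 1)))) =
    qInt F q (k + 1 + 1) *
      (s ^ 4 * (q ^ (2 * j + (k + 1)))⁻¹ - (s ^ 4)⁻¹ * q ^ (2 * j + (k + 1))) := by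
  have hq := h.q_ne_zero
  have hs := h.s_ne_zero
  have h1 : q ^ 2 - 1 ≠ 0 := by
    have := h.q_sub_inv_ne_zero
    intro h2
    apply this
    rw [sub_eq_zero] at h2 ⊢
    exact eq_inv_of_mul_eq_one_left (by rw [← h2, pow_two])
  simp only [qInt, mul_add, pow_add, mul_one, two_mul, pow_one]
  field_simp
  ring

theorem eOp_fOp_pow (h : IsGeneric q s) {j : ℕ} {w : X4 F} (hw : w ∈ hwSpace q s j) (k : ℕ) :
    eOp q s ((fOp q s ^ (k + 1)) w) =
      (qInt F q (k + 1) * (s ^ 4 * (q ^ (2 * j + k))⁻¹ - (s ^ 4)⁻¹ * q ^ (2 * j + k))) •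
        (fOp q s ^ k) w := by
  induction k with
  | zero =>
    have h1 : qInt F q 1 = 1 := by
      rw [qInt, pow_one, div_self h.q_sub_inv_ne_zero]
    rw [zero_add, pow_one, pow_zero, Module.End.one_apply, eOp_fOp_of_mem h hw.1,
      (mem_hwSpace.1 hw).2, LinearMap.map_zero, zero_add, h1, one_mul, add_zero]
  | succ k ih =>
    rw [pow_succ' _ (k + 1), Module.End.mul_apply,
      eOp_fOp_of_mem h (fOp_pow_mem_weightSpace hw.1 _), ih, LinearMap.map_smul,
      ← Module.End.mul_apply, ← pow_succ', ← add_smul, qInt_weight_identity h]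

theorem weight_coef_ne_zero (h : IsGeneric q s) (j k : ℕ) :
    qInt F q (k + 1) * (s ^ 4 * (q ^ (2 * j + k))⁻¹ - (s ^ 4)⁻¹ * q ^ (2 * j + k)) ≠ 0 := by
  refine mul_ne_zero (h.qInt_ne_zero k) ?_
  have := h.sub_inv_ne_zero (a := 4) (b := 0) (c := 2 * j + k) (by omega)
  simpa using this

variable (q s) in
/-- The span of the images of highest weight functions under powers of `F`. -/
def descendants (N : ℕ) : Submodule F (X4 F) :=
  Submodule.span F {u | ∃ j k, j + k = N ∧ ∃ w ∈ hwSpace q s j, u = (fOp q s ^ k) w}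

theorem descendants_le (N : ℕ) : descendants q s N ≤ weightSpace F N := by
  rw [descendants, Submodule.span_le]
  rintro u ⟨j, k, rfl, w, hw, rfl⟩
  exact fOp_pow_mem_weightSpace hw.1 k

theorem fOp_mem_descendants {N : ℕ} {u : X4 F} (hu : u ∈ descendants q s N) :
    fOp q s u ∈ descendants q s (N + 1) := by
  revert u
  change descendants q s N ≤ (descendants q s (N + 1)).comap (fOp q s)
  rw [descendants, Submodule.span_le]
  rintro u ⟨j, k, rfl, w, hw, rfl⟩
  refine Submodule.subset_span ⟨j, k + 1, by ring, w, hw, ?_⟩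
  rw [pow_succ', Module.End.mul_apply]

/-- On each spanning vector $F^kw$ the operator $EF$ is a scalar, nonzero for generic parameters;
hence $EF$ is onto. -/
theorem exists_eOp_fOp_eq (h : IsGeneric q s) {N : ℕ} {u : X4 F} (hu : u ∈ descendants q s N) :
    ∃ u' ∈ descendants q s N, eOp q s (fOp q s u') = u := by
  revert u
  change descendants q s N ≤ (descendants q s N).map (eOp q s ∘ₗ fOp q s)
  conv_lhs => rw [descendants]
  rw [Submodule.span_le]
  rintro u ⟨j, k, rfl, w, hw, rfl⟩
  refine ⟨(qInt F q (k + 1) * (s ^ 4 * (q ^ (2 * j + k))⁻¹ - (s ^ 4)⁻¹ * q ^ (2 * j + k)))⁻¹ •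
    (fOp q s ^ k) w, Submodule.smul_mem _ _ (Submodule.subset_span ⟨j, k, rfl, w, hw, rfl⟩), ?_⟩
  have e : fOp q s ((fOp q s ^ k) w) = (fOp q s ^ (k + 1)) w := by
    rw [pow_succ', Module.End.mul_apply]
  rw [LinearMap.map_smul, LinearMap.comp_apply, e, eOp_fOp_pow h hw, smul_smul,
    inv_mul_cancel₀ (weight_coef_ne_zero h j k), one_smul]

theorem hwSpace_le_descendants (N : ℕ) : hwSpace q s N ≤ descendants q s N :=
  fun w hw => Submodule.subset_span ⟨N, 0, rfl, w, hw, rfl⟩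

/-- Given $v$, choose $u$ of one weight less with $EFu=Ev$. Then $v-Fu$ is highest weight. -/
theorem weightSpace_le_descendants (h : IsGeneric q s) (N : ℕ) :
    weightSpace F N ≤ descendants q s N := by
  induction N with
  | zero => exact weightSpace_zero_le.trans (hwSpace_le_descendants 0)
  | succ N ih =>
    intro v hv
    obtain ⟨u, hu, he⟩ := exists_eOp_fOp_eq h (ih (eOp_mem_weightSpace (q := q) (s := s) hv))
    have h1 : v - fOp q s u ∈ hwSpace q s (N + 1) :=
      mem_hwSpace.2 ⟨Submodule.sub_mem _ hv (fOp_mem_weightSpace (descendants_le N hu)), by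
        rw [LinearMap.map_sub, he, sub_self]⟩
    rw [← sub_add_cancel v (fOp q s u)]
    exact Submodule.add_mem _ (hwSpace_le_descendants _ h1) (fOp_mem_descendants hu)

theorem exists_sub_fOp_mem_hwSpace (h : IsGeneric q s) {N : ℕ} {v : X4 F}
    (hv : v ∈ weightSpace F (N + 1)) :
    ∃ u ∈ weightSpace F N, v - fOp q s u ∈ hwSpace q s (N + 1) := by
  obtain ⟨u, hu, he⟩ := exists_eOp_fOp_eq h
    (weightSpace_le_descendants h N (eOp_mem_weightSpace (q := q) (s := s) hv))
  exact ⟨u, descendants_le N hu, mem_hwSpace.2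
    ⟨Submodule.sub_mem _ hv (fOp_mem_weightSpace (descendants_le N hu)), by
      rw [LinearMap.map_sub, he, sub_self]⟩⟩

end Decomposition

/-! ### The invariant bilinear form -/

section DiagonalForm

variable {F : Type*} [Field F] {n : Type*} [Fintype n] [DecidableEq n]

/-- An invertible diagonal matrix. -/
def diagGL (D : n → F) (hD : ∀ x, D x ≠ 0) : GL n F where
  val := Matrix.diagonal D
  inv := Matrix.diagonal fun x => (D x)⁻¹
  val_inv := by
    rw [Matrix.diagonal_mul_diagonal, ← Matrix.diagonal_one]
    exact congrArg _ (funext fun x => mul_inv_cancel₀ (hD x))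
  inv_val := by
    rw [Matrix.diagonal_mul_diagonal, ← Matrix.diagonal_one]
    exact congrArg _ (funext fun x => inv_mul_cancel₀ (hD x))

/-- The bilinear form of which the Gram matrix is inverse to a diagonal matrix. -/
def diagForm (D : n → F) : LinearMap.BilinForm F (n → F) :=
  Matrix.toBilin (Pi.basisFun F n) (Matrix.diagonal fun x => (D x)⁻¹)

theorem toMatrix_diagForm (D : n → F) (hD : ∀ x, D x ≠ 0) :
    LinearMap.BilinForm.toMatrix (Pi.basisFun F n) (diagForm D) = ((diagGL D hD)⁻¹).1 :=
  LinearMap.BilinForm.toMatrix_toBilin _ _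

theorem diagForm_apply (D : n → F) (u v : n → F) :
    diagForm D u v = ∑ x, (D x)⁻¹ * u x * v x := by
  rw [diagForm, Matrix.toBilin_apply]
  refine Finset.sum_congr rfl fun x _ => ?_
  rw [Finset.sum_eq_single x]
  · simp only [Pi.basisFun_repr, Matrix.diagonal_apply_eq]
    ring
  · intro y _ hy
    rw [Matrix.diagonal_apply_ne' _ hy, mul_zero, zero_mul]
  · intro hx
    exact absurd (Finset.mem_univ x) hx

theorem diagForm_isSymm (D : n → F) : (diagForm D).IsSymm :=
  ⟨fun u v => by
    simp only [diagForm_apply]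
    exact Finset.sum_congr rfl fun x _ => by ring⟩

theorem diagForm_single_right (D : n → F) (u : n → F) (x : n) :
    diagForm D u (Pi.single x 1) = (D x)⁻¹ * u x := by
  rw [diagForm_apply, Finset.sum_eq_single x]
  · rw [Pi.single_eq_same, mul_one]
  · intro y _ hy
    rw [Pi.single_eq_of_ne hy, mul_zero]
  · intro hx
    exact absurd (Finset.mem_univ x) hx

theorem diagForm_single_left (D : n → F) (u : n → F) (x : n) :
    diagForm D (Pi.single x 1) u = (D x)⁻¹ * u x := by
  rw [(diagForm_isSymm D).eq, diagForm_single_right]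

theorem diagForm_separatingLeft (D : n → F) (hD : ∀ x, D x ≠ 0) :
    (diagForm D).SeparatingLeft := by
  intro u hu
  funext x
  have h1 := hu (Pi.single x 1)
  rw [diagForm_single_right] at h1
  exact (mul_eq_zero.1 h1).resolve_left (inv_ne_zero (hD x))

end DiagonalForm

/-! ### Norms making $R$ self-adjoint, and orthogonality of $W_{4,\ell}$ to the image of the
lowering operator -/

section InvariantForm

variable {F : Type*} [Field F] (q s : F)

/-- The norm of the basis vector `v_m`. -/
def normV (m : ℕ) : F := (q ^ m ^ 2)⁻¹ * fFact q s m

/-- The norm of the pure tensor `v_a ⊗ v_b ⊗ v_c ⊗ v_d`. -/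
def normV4 (a b c d : ℕ) : F := normV q s a * normV q s b * normV q s c * normV q s d

/-- The norms of the pure tensors in `V_{4,ℓ}`, up to a common factor. -/
def normIdx (t : F) (ℓ : ℕ) (x : Idx ℓ) : F := t * normV4 q s x.1.1.1 x.1.1.2 x.1.2.1 x.1.2.2

variable {q s}

theorem normV_ne_zero (h : IsGeneric q s) (m : ℕ) : normV q s m ≠ 0 :=
  mul_ne_zero (inv_ne_zero (pow_ne_zero _ h.q_ne_zero)) (h.fFact_ne_zero m)

theorem normV4_ne_zero (h : IsGeneric q s) (a b c d : ℕ) : normV4 q s a b c d ≠ 0 :=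
  mul_ne_zero (mul_ne_zero (mul_ne_zero (normV_ne_zero h a) (normV_ne_zero h b))
    (normV_ne_zero h c)) (normV_ne_zero h d)

theorem normIdx_ne_zero (h : IsGeneric q s) {t : F} (ht : t ≠ 0) (ℓ : ℕ) (x : Idx ℓ) :
    normIdx q s t ℓ x ≠ 0 :=
  mul_ne_zero ht (normV4_ne_zero h _ _ _ _)

theorem fCoef_mul_inv_normV (h : IsGeneric q s) (m : ℕ) :
    fCoef q s (m + 1) * (normV q s (m + 1))⁻¹ = q ^ (2 * m + 1) * (normV q s m)⁻¹ := by
  have h1 := h.fCoef_ne_zero m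
  have h2 := h.fFact_ne_zero m
  have hq := h.q_ne_zero
  rw [normV, normV, fFact_succ, show (m + 1) ^ 2 = m ^ 2 + (2 * m + 1) by ring, pow_add]
  field_simp

variable (q s) in
/-- The coefficient of `v_a ⊗ v_b` in `R (v_i ⊗ v_j)`. -/
def rEntry (i j a b : ℕ) : F := if a + b = i + j ∧ b ≤ i then rCoef q s (i - b) j b else 0

/-- With $i=b+n$ and $a=j+n$, the factor $q^{-m^2}$ in `normV` balances $q^{2b(n+j)}$ against
$q^{2j(n+b)}$, as $i^2+j^2-a^2-b^2=2n(b-j)$. The `fFact` factors become symmetric by cancelling the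
denominator of `rCoef`. -/
theorem rEntry_symm (h : IsGeneric q s) (i j a b : ℕ) :
    normV q s i * normV q s j * rEntry q s i j a b =
      normV q s a * normV q s b * rEntry q s a b i j := by
  rw [rEntry, rEntry]
  by_cases hc : a + b = i + j ∧ b ≤ i
  · rw [if_pos hc, if_pos (by omega)]
    obtain ⟨n, rfl⟩ := Nat.exists_eq_add_of_le hc.2
    obtain rfl : a = j + n := by omega
    have h1 := h.fFact_ne_zero j
    have h2 := h.fFact_ne_zero b
    have h3 := h.qFact_ne_zero n
    have hq := h.q_ne_zero
    have hs := h.s_ne_zero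
    rw [Nat.add_sub_cancel_left, Nat.add_sub_cancel_left]
    simp only [normV, rCoef, add_comm n]
    rw [show b + n + j = j + n + b by ring]
    field_simp
    ring
  · rw [if_neg hc, if_neg (by omega), mul_zero, mul_zero]

theorem rOp_delta_symm (h : IsGeneric q s) (r : Fin 3) (i j k l a b c d : ℕ) :
    normV4 q s i j k l * rOp q s r (delta F i j k l) a b c d =
      normV4 q s a b c d * rOp q s r (delta F a b c d) i j k l := by
  have key (i j a b : ℕ) (p : Prop) [Decidable p] :
      rFun q s (fun i' j' => if (i' = i ∧ j' = j) ∧ p then 1 else 0) a b =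
        (if p then 1 else 0) * rEntry q s i j a b := by
    have h1 : (fun i' j' => if (i' = i ∧ j' = j) ∧ p then (1 : F) else 0) =
        fun i' j' => (if p then 1 else 0) * if (i, j) = (i', j') then 1 else 0 := by
      funext i' j'
      by_cases hp : p <;> simp [hp, eq_comm]
    rw [h1, rFun_mul_left, rFun_single, rEntry]
  fin_cases r
  · have h1 (i j k l a b c d : ℕ) : rFun₁ q s (delta F i j k l) a b c d =
        (if c = k ∧ d = l then 1 else 0) * rEntry q s i j a b := by
      rw [← key, rFun₁_apply]
      simp only [delta, and_assoc]
    change normV4 q s i j k l * rFun₁ q s _ a b c d = normV4 q s a b c d * rFun₁ q s _ i j k l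
    rw [h1, h1]
    by_cases hc : c = k ∧ d = l
    · obtain ⟨rfl, rfl⟩ := hc
      rw [normV4, normV4, if_pos ⟨rfl, rfl⟩]
      linear_combination normV q s c * normV q s d * rEntry_symm h i j a b
    · rw [if_neg hc, if_neg fun hc' => hc ⟨hc'.1.symm, hc'.2.symm⟩]
      ring
  · have h1 (i j k l a b c d : ℕ) : rFun₂ q s (delta F i j k l) a b c d =
        (if a = i ∧ d = l then 1 else 0) * rEntry q s j k b c := by
      rw [← key, rFun₂_apply]
      simp only [delta, and_left_comm (a := a = i), and_assoc]
    change normV4 q s i j k l * rFun₂ q s _ a b c d = normV4 q s a b c d * rFun₂ q s _ i j k l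
    rw [h1, h1]
    by_cases hc : a = i ∧ d = l
    · obtain ⟨rfl, rfl⟩ := hc
      rw [normV4, normV4, if_pos ⟨rfl, rfl⟩]
      linear_combination normV q s a * normV q s d * rEntry_symm h j k b c
    · rw [if_neg hc, if_neg fun hc' => hc ⟨hc'.1.symm, hc'.2.symm⟩]
      ring
  · have h1 (i j k l a b c d : ℕ) : rFun₃ q s (delta F i j k l) a b c d =
        (if a = i ∧ b = j then 1 else 0) * rEntry q s k l c d := by
      rw [← key, rFun₃_apply]
      have e (p p' : Prop) : (a = i ∧ b = j ∧ p ∧ p') ↔ (p ∧ p') ∧ a = i ∧ b = j := by tauto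
      have e' : delta F i j k l a b =
          fun c' d' => if (c' = k ∧ d' = l) ∧ a = i ∧ b = j then 1 else 0 := by
        funext c' d'
        simp only [delta, e]
      rw [e']
    change normV4 q s i j k l * rFun₃ q s _ a b c d = normV4 q s a b c d * rFun₃ q s _ i j k l
    rw [h1, h1]
    by_cases hc : a = i ∧ b = j
    · obtain ⟨rfl, rfl⟩ := hc
      rw [normV4, normV4, if_pos ⟨rfl, rfl⟩]
      linear_combination normV q s a * normV q s b * rEntry_symm h k l c d
    · rw [if_neg hc, if_neg fun hc' => hc ⟨hc'.1.symm, hc'.2.symm⟩]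
      ring

variable (q s) in
/-- The invariant form on `V_{4,ℓ}`. -/
def formV (t : F) (ℓ : ℕ) : LinearMap.BilinForm F (V4l F ℓ) :=
  diagForm (normIdx q s t ℓ)

theorem formV_isSymm (t : F) (ℓ : ℕ) : (formV q s t ℓ).IsSymm := diagForm_isSymm _

theorem formV_separatingLeft (h : IsGeneric q s) {t : F} (ht : t ≠ 0) (ℓ : ℕ) :
    (formV q s t ℓ).SeparatingLeft :=
  diagForm_separatingLeft _ (normIdx_ne_zero h ht ℓ)

theorem formV_sigmaV (h : IsGeneric q s) {t : F} (ht : t ≠ 0) (ℓ : ℕ) (i : Fin 3)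
    (u v : V4l F ℓ) :
    formV q s t ℓ (sigmaV h ℓ i u) v = formV q s t ℓ u (sigmaV h ℓ i v) := by
  suffices (formV q s t ℓ).compLeft (sigmaV h ℓ i).toLinearMap =
      (formV q s t ℓ).compRight (sigmaV h ℓ i).toLinearMap from LinearMap.congr_fun₂ this u v
  refine LinearMap.BilinForm.ext_basis (Pi.basisFun F (Idx ℓ)) fun x y => ?_
  rw [Pi.basisFun_apply, Pi.basisFun_apply]
  change formV q s t ℓ (sigmaV h ℓ i _) _ = formV q s t ℓ _ (sigmaV h ℓ i _)
  rw [formV, diagForm_single_right]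
  refine Eq.trans ?_ (diagForm_single_left _ _ _).symm
  rw [← extend_idx (sigmaV h ℓ i (Pi.single x 1)), ← extend_idx (sigmaV h ℓ i (Pi.single y 1)),
    extend_sigmaV, extend_sigmaV, extend_single, extend_single]
  have h1 := normIdx_ne_zero h ht ℓ x
  have h2 := normIdx_ne_zero h ht ℓ y
  have h3 := rOp_delta_symm h i x.1.1.1 x.1.1.2 x.1.2.1 x.1.2.2 y.1.1.1 y.1.1.2 y.1.2.1 y.1.2.2
  rw [inv_mul_eq_iff_eq_mul₀ h2, mul_left_comm, eq_inv_mul_iff_mul_eq₀ h1, normIdx, normIdx,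
    mul_assoc, mul_assoc, h3]

theorem formV_restrictIdx_delta (t : F) (ℓ : ℕ) (u : V4l F ℓ) (a b c d : ℕ) :
    formV q s t ℓ u (restrictIdx F ℓ (delta F a b c d)) =
      (t * normV4 q s a b c d)⁻¹ * extend F ℓ u a b c d := by
  rw [extend_apply]
  split_ifs with hN
  · have h1 := extend_single (F := F) (⟨((a, b), (c, d)), hN⟩ : Idx ℓ)
    have h2 : restrictIdx F ℓ (delta F a b c d) = Pi.single ⟨((a, b), (c, d)), hN⟩ 1 := by
      funext x
      rw [← extend_idx (Pi.single _ _) x, h1]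
      rfl
    rw [h2, formV, diagForm_single_right]
    rfl
  · have h2 : restrictIdx F ℓ (delta F a b c d) = 0 := by
      funext x
      refine if_neg ?_
      rintro ⟨rfl, rfl, rfl, rfl⟩
      exact hN x.2
    rw [h2, map_zero, mul_zero]

/-- Pairing $w$ with the lowering of a basis vector gives, by `fCoef_mul_inv_normV`, a multiple of
the corresponding coordinate of $Ew$. -/
theorem formV_fOp_eq_zero (h : IsGeneric q s) (t : F) (ℓ : ℕ)
    {w : V4l F (ℓ + 1)} (hw : w ∈ W4l F q s (ℓ + 1)) (u : V4l F ℓ) :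
    formV q s t (ℓ + 1) w (restrictIdx F (ℓ + 1) (fOp q s (extend F ℓ u))) = 0 := by
  suffices formV q s t (ℓ + 1) w ∘ₗ restrictIdx F (ℓ + 1) ∘ₗ fOp q s ∘ₗ extend F ℓ = 0 from
    LinearMap.congr_fun this u
  refine (Pi.basisFun F (Idx ℓ)).ext ?_
  rintro ⟨⟨⟨a, b⟩, ⟨c, d⟩⟩, hx⟩
  rw [Pi.basisFun_apply]
  simp only [LinearMap.comp_apply, extend_single, LinearMap.zero_apply, fOp_delta,
    map_add, map_smul, formV_restrictIdx_delta, smul_eq_mul]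
  have h0 := congrFun₂ (congrFun₂ ((mem_W4l_iff h).1 hw) a b) c d
  rw [eOp_apply, Pi.zero_apply, Pi.zero_apply, Pi.zero_apply, Pi.zero_apply] at h0
  have ha := fCoef_mul_inv_normV h a
  have hb := fCoef_mul_inv_normV h b
  have hc := fCoef_mul_inv_normV h c
  have hd := fCoef_mul_inv_normV h d
  have hq := h.q_ne_zero
  have hs := h.s_ne_zero
  simp only [normV4, mul_inv]
  generalize extend F (ℓ + 1) w (a + 1) b c d = Wa at *
  generalize extend F (ℓ + 1) w a (b + 1) c d = Wb at *
  generalize extend F (ℓ + 1) w a b (c + 1) d = Wc at *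
  generalize extend F (ℓ + 1) w a b c (d + 1) = Wd at *
  generalize (normV q s (a + 1))⁻¹ = A' at *
  generalize (normV q s (b + 1))⁻¹ = B' at *
  generalize (normV q s (c + 1))⁻¹ = C' at *
  generalize (normV q s (d + 1))⁻¹ = D' at *
  generalize (normV q s a)⁻¹ = A at *
  generalize (normV q s b)⁻¹ = B at *
  generalize (normV q s c)⁻¹ = C at *
  generalize (normV q s d)⁻¹ = D at *
  have h1 : q ^ (2 * a + 1) * Wa + s⁻¹ * q ^ (2 * a) * q ^ (2 * b + 1) * Wb +
      (s ^ 2)⁻¹ * q ^ (2 * (a + b)) * q ^ (2 * c + 1) * Wc +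
      (s ^ 3)⁻¹ * q ^ (2 * (a + b + c)) * q ^ (2 * d + 1) * Wd = 0 := by
    refine Eq.trans ?_ ((congrArg ((s ^ 3)⁻¹ * q ^ (2 * (a + b + c + d) + 1) * ·) h0).trans
      (mul_zero _))
    simp only [mul_add, pow_add]
    field_simp
  linear_combination t⁻¹ * A * B * C * D * h1 + t⁻¹ * B * C * D * Wa * ha +
    t⁻¹ * s⁻¹ * q ^ (2 * a) * A * C * D * Wb * hb +
    t⁻¹ * (s ^ 2)⁻¹ * q ^ (2 * (a + b)) * A * B * D * Wc * hc +
    t⁻¹ * (s ^ 3)⁻¹ * q ^ (2 * (a + b + c)) * A * B * C * Wd * hd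

/-- No positivity is available over a general field. Instead $V_{4,\ell}$ is spanned by $W_{4,\ell}$
and the image of the lowering operator, and the latter is already orthogonal to $W_{4,\ell}$. -/
theorem formV_restrict_separatingLeft (h : IsGeneric q s) {t : F} (ht : t ≠ 0) (ℓ : ℕ) :
    ((formV q s t ℓ).restrict (W4l F q s ℓ)).SeparatingLeft := by
  rintro ⟨w, hw⟩ hw0
  have hw1 (v : V4l F ℓ) (hv : v ∈ W4l F q s ℓ) : formV q s t ℓ w v = 0 := hw0 ⟨v, hv⟩
  refine Subtype.ext (formV_separatingLeft h ht ℓ w fun v => ?_)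
  have hv := extend_mem_weightSpace v
  rcases ℓ with _ | ℓ
  · exact hw1 v ((mem_W4l_iff_hwSpace h).2 (weightSpace_zero_le hv))
  · obtain ⟨u, hu, hvu⟩ := exists_sub_fOp_mem_hwSpace h hv
    have h1 : v = restrictIdx F _ (extend F _ v - fOp q s u) +
        restrictIdx F _ (fOp q s (extend F ℓ (restrictIdx F ℓ u))) := by
      rw [extend_restrictIdx hu, ← LinearMap.map_add, sub_add_cancel]
      funext x
      exact (extend_idx v x).symm
    rw [h1, map_add, formV_fOp_eq_zero h t ℓ hw, add_zero]
    refine hw1 _ ((mem_W4l_iff_hwSpace h).2 ?_)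
    rw [extend_restrictIdx hvu.1]
    exact hvu

/-! ### The dimension of `W_{4,ℓ}` -/

/-- Raising $a$ embeds the indices of weight $\ell$; at least two indices with $a=0$ are missed. As
$E$ maps weight $\ell+1$ to weight $\ell$, its kernel has dimension at least $2$. -/
theorem card_idx_succ (ℓ : ℕ) : Fintype.card (Idx ℓ) + 2 ≤ Fintype.card (Idx (ℓ + 1)) := by
  let f : Idx ℓ ⊕ Bool → Idx (ℓ + 1) := Sum.elim
    (fun x => ⟨((x.1.1.1 + 1, x.1.1.2), x.1.2), by have := x.2; simp only; omega⟩)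
    fun e => cond e ⟨((0, ℓ + 1), (0, 0)), by simp⟩ ⟨((0, 0), (ℓ + 1, 0)), by simp⟩
  have hf : Function.Injective f := by
    rintro (⟨⟨⟨a, b⟩, ⟨c, d⟩⟩, hx⟩ | e) (⟨⟨⟨a', b'⟩, ⟨c', d'⟩⟩, hx'⟩ | e') hxy
    · simp only [f, Sum.elim_inl, Subtype.mk.injEq, Prod.mk.injEq] at hxy
      simp only [Sum.inl.injEq, Subtype.mk.injEq, Prod.mk.injEq]
      omega
    · cases e' <;> simp [f] at hxy
    · cases e <;> simp [f] at hxy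
    · cases e <;> cases e' <;> simp [f] at hxy ⊢
  have h1 := Fintype.card_le_of_injective f hf
  rwa [Fintype.card_sum, Fintype.card_bool] at h1

theorem two_le_finrank_W4l (h : IsGeneric q s) {ℓ : ℕ} (hℓ : 1 ≤ ℓ) :
    2 ≤ Module.finrank F (W4l F q s ℓ) := by
  obtain ⟨ℓ, rfl⟩ := Nat.exists_eq_add_of_le' hℓ
  let e : V4l F (ℓ + 1) →ₗ[F] V4l F ℓ := restrictIdx F ℓ ∘ₗ eOp q s ∘ₗ extend F (ℓ + 1)
  have h1 : W4l F q s (ℓ + 1) = LinearMap.ker e := by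
    ext u
    rw [mem_W4l_iff h, LinearMap.mem_ker]
    refine ⟨fun hu => ?_, fun hu => ?_⟩
    · rw [LinearMap.comp_apply, LinearMap.comp_apply, hu, LinearMap.map_zero]
    · rw [← extend_restrictIdx (eOp_mem_weightSpace (extend_mem_weightSpace u))]
      change extend F ℓ (e u) = 0
      rw [hu, LinearMap.map_zero]
  have h2 := LinearMap.finrank_range_add_finrank_ker e
  have h3 := Submodule.finrank_le (LinearMap.range e)
  rw [Module.finrank_fintype_fun_eq_card] at h2 h3
  have h4 := card_idx_succ ℓ
  rw [h1]
  omega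

end InvariantForm

/-! ### Normalization of $J$ and passage between forms and matrices -/

section Main

variable {F : Type*} [Field F] {q s : F}

/-- Rescaling $J$ does not change $\varphi$, so over an algebraically closed field a root of the
right degree makes the determinant $1$. -/
theorem exists_normalization [CharZero F] (h : IsGeneric q s) (ℓ : ℕ) :
    ∃ t : F, t ≠ 0 ∧ (IsAlgClosed F → ∏ x, normIdx q s t ℓ x = 1) := by
  by_cases hF : IsAlgClosed F
  · have hcard : 0 < Fintype.card (Idx ℓ) :=
      Fintype.card_pos_iff.2 ⟨⟨((ℓ, 0), (0, 0)), rfl⟩⟩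
    have h0 : ∏ x, normIdx q s 1 ℓ x ≠ 0 :=
      Finset.prod_ne_zero_iff.2 fun x _ => normIdx_ne_zero h one_ne_zero ℓ x
    obtain ⟨t, ht⟩ := IsAlgClosed.exists_pow_nat_eq (∏ x, normIdx q s 1 ℓ x)⁻¹ hcard
    refine ⟨t, ?_, fun _ => ?_⟩
    · rintro rfl
      rw [zero_pow hcard.ne'] at ht
      exact inv_ne_zero h0 ht.symm
    · have h1 (x : Idx ℓ) : normIdx q s t ℓ x = t * normIdx q s 1 ℓ x := by
        rw [normIdx, normIdx, one_mul]
      simp only [h1, Finset.prod_mul_distrib, Finset.prod_const, Finset.card_univ]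
      rw [ht, inv_mul_cancel₀ h0]
  · exact ⟨1, one_ne_zero, fun hF' => absurd hF' hF⟩

/-- The Gram matrix of a nondegenerate form is invertible. -/
theorem exists_toMatrix_eq_inv {M n : Type*} [AddCommGroup M] [Module F M] [Fintype n]
    [DecidableEq n] (b : Module.Basis n F M) {B : LinearMap.BilinForm F M}
    (hB : B.IsSymm) (hnd : B.SeparatingLeft) :
    ∃ J : GL n F, LinearMap.BilinForm.toMatrix b B = (J⁻¹).1 := by
  have h1 : B.Nondegenerate := (LinearMap.IsRefl.nondegenerate_iff_separatingLeft hB.isRefl).2 hnd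
  have h2 := (LinearMap.BilinForm.nondegenerate_iff_det_ne_zero b).1 h1
  refine ⟨(Matrix.GeneralLinearGroup.mkOfDetNeZero _ h2)⁻¹, ?_⟩
  rw [inv_inv]
  rfl

/-- The matrix form of `φ(σ) = σ⁻¹`. -/
theorem conj_transpose_of_phi_eq_inv {M n : Type*} [AddCommGroup M] [Module F M] [Fintype n]
    [DecidableEq n] {b : Module.Basis n F M} {J : GL n F} {A : M ≃ₗ[F] M}
    (hA : phi b J A = A⁻¹) :
    J.1 * (toGL b A).1.transpose * (J⁻¹).1 = (toGL b A).1 := by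
  have h1 := toGL_phi b J A⁻¹
  rw [map_inv (phi b J), hA, inv_inv] at h1
  have h2 : (invTranspose (toGL b A⁻¹)).1 = (toGL b A).1.transpose := by
    rw [map_inv]
    rfl
  rw [← h2, ← Units.val_mul, ← Units.val_mul, ← h1]

end Main

end QuantumBraid

end

/-! ### Assembly of the representation, the involution and the extension -/

theorem mainTheorem9 {F : Type*} [Field F] [CharZero F] (q s : F)
    (hqs : AlgebraicIndependent ℚ ![q, s]) (ℓ : ℕ) :
    -- the representation of `B₄` on `V_{4,ℓ}`
    ∃ ρ : QuantumBraid.B4 →* (QuantumBraid.V4l F ℓ ≃ₗ[F] QuantumBraid.V4l F ℓ),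
      (∀ (i : Fin 3) (u : QuantumBraid.V4l F ℓ),
        QuantumBraid.incl F ℓ (ρ (QuantumBraid.sigma i) u) =
          QuantumBraid.braidOp F q s i (QuantumBraid.incl F ℓ u)) ∧
    -- its restriction to `W_{4,ℓ}`, on which the center acts by scalars
    ∃ ρW : QuantumBraid.B4 →* (QuantumBraid.W4l F q s ℓ ≃ₗ[F] QuantumBraid.W4l F q s ℓ),
      (∀ (β : QuantumBraid.B4) (w : QuantumBraid.W4l F q s ℓ),
        (ρW β w : QuantumBraid.V4l F ℓ) = ρ β w) ∧
      (∀ z ∈ Subgroup.center QuantumBraid.B4,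
        ∃ c : F, ∀ w : QuantumBraid.W4l F q s ℓ, ρW z w = c • w) ∧
    -- the matrix `J`
    ∃ J : GL (QuantumBraid.Idx ℓ) F,
      (IsAlgClosed F → J.1.det = 1) ∧
      (∀ i : Fin 3,
        J.1 * (QuantumBraid.toGL (QuantumBraid.basisV4l F ℓ)
            (ρ (QuantumBraid.sigma i))).1.transpose * (J⁻¹).1 =
          (QuantumBraid.toGL (QuantumBraid.basisV4l F ℓ) (ρ (QuantumBraid.sigma i))).1) ∧
    -- `φ` inverts the `σ_i`, in `GL(V_{4,ℓ})` and in `Aut(PSL(V_{4,ℓ}))`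
      (∀ i : Fin 3, QuantumBraid.phi (QuantumBraid.basisV4l F ℓ) J (ρ (QuantumBraid.sigma i)) =
        (ρ (QuantumBraid.sigma i))⁻¹) ∧
      (∀ i : Fin 3,
        QuantumBraid.phiPSL (QuantumBraid.basisV4l F ℓ) J *
            QuantumBraid.conjPSL (ρ (QuantumBraid.sigma i)) *
            (QuantumBraid.phiPSL (QuantumBraid.basisV4l F ℓ) J)⁻¹ =
          (QuantumBraid.conjPSL (ρ (QuantumBraid.sigma i)))⁻¹) ∧
    -- the `B₄`-stable complement of `W_{4,ℓ}`, and the restriction `ψ` of `φ` to `PSL(W_{4,ℓ})`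
    ∃ C : Submodule F (QuantumBraid.V4l F ℓ),
      IsCompl (QuantumBraid.W4l F q s ℓ) C ∧
      (∀ β : QuantumBraid.B4, ∀ c ∈ C, ρ β c ∈ C) ∧
    ∃ ψ : MulAut (QuantumBraid.PSL F (QuantumBraid.W4l F q s ℓ)),
      (∀ (A : SpecialLinearGroup F (QuantumBraid.W4l F q s ℓ))
          (g : QuantumBraid.V4l F ℓ ≃ₗ[F] QuantumBraid.V4l F ℓ),
        (∀ w : QuantumBraid.W4l F q s ℓ, g w = A w) → (∀ c ∈ C, g c ∈ C) →
          (∀ c ∈ C, QuantumBraid.phi (QuantumBraid.basisV4l F ℓ) J g c ∈ C) ∧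
          ∃ B : SpecialLinearGroup F (QuantumBraid.W4l F q s ℓ),
            (∀ w : QuantumBraid.W4l F q s ℓ,
              QuantumBraid.phi (QuantumBraid.basisV4l F ℓ) J g w = B w) ∧
            ψ (QuantumBraid.toPSL A) = QuantumBraid.toPSL B) ∧
      ψ * ψ = 1 ∧ (1 ≤ ℓ → ψ ≠ 1) ∧
      (∀ i : Fin 3, ψ * QuantumBraid.conjPSL (ρW (QuantumBraid.sigma i)) * ψ⁻¹ =
        (QuantumBraid.conjPSL (ρW (QuantumBraid.sigma i)))⁻¹) ∧
    -- the extension to `Aut(F₂)`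
    ∃ Φ : MulAut QuantumBraid.F2 →* MulAut (QuantumBraid.PSL F (QuantumBraid.W4l F q s ℓ)),
      (∀ β : QuantumBraid.B4, Φ (QuantumBraid.toAutF2 β) = QuantumBraid.conjPSL (ρW β)) ∧
      Φ QuantumBraid.iota = ψ := by
  have h := QuantumBraid.isGeneric_of_algebraicIndependent hqs
  obtain ⟨t, ht, hdet⟩ := QuantumBraid.exists_normalization h ℓ
  set D := QuantumBraid.normIdx q s t ℓ with hD
  have hD0 : ∀ x, D x ≠ 0 := QuantumBraid.normIdx_ne_zero h ht ℓ
  set W := QuantumBraid.W4l F q s ℓ with hW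
  set B := QuantumBraid.formV q s t ℓ with hBdef
  set J := QuantumBraid.diagGL D hD0 with hJdef
  have hJ : LinearMap.BilinForm.toMatrix (QuantumBraid.basisV4l F ℓ) B = (J⁻¹).1 :=
    QuantumBraid.toMatrix_diagForm D hD0
  have hB : B.IsSymm := QuantumBraid.formV_isSymm t ℓ
  have hsep : B.SeparatingLeft := QuantumBraid.formV_separatingLeft h ht ℓ
  have hnd : B.Nondegenerate :=
    (LinearMap.IsRefl.nondegenerate_iff_separatingLeft hB.isRefl).2 hsep
  have hBW : (B.restrict W).IsSymm := hB.restrict W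
  have hsepW : (B.restrict W).SeparatingLeft :=
    QuantumBraid.formV_restrict_separatingLeft h ht ℓ
  have hndW : (B.restrict W).Nondegenerate :=
    (LinearMap.IsRefl.nondegenerate_iff_separatingLeft hBW.isRefl).2 hsepW
  obtain ⟨JW, hJW⟩ :=
    QuantumBraid.exists_toMatrix_eq_inv (Module.finBasis F W) hBW hsepW
  set bW := Module.finBasis F W with hbW
  have hphi : ∀ i : Fin 3, QuantumBraid.phi (QuantumBraid.basisV4l F ℓ) J
      (QuantumBraid.repV h ℓ (QuantumBraid.sigma i)) =
        (QuantumBraid.repV h ℓ (QuantumBraid.sigma i))⁻¹ := fun i =>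
    QuantumBraid.phi_eq_inv hJ hB hsep fun u v => by
      rw [QuantumBraid.repV_sigma]
      exact QuantumBraid.formV_sigmaV h ht ℓ i u v
  have hphiW : ∀ i : Fin 3, QuantumBraid.phi bW JW
      (QuantumBraid.repW h ℓ (QuantumBraid.sigma i)) =
        (QuantumBraid.repW h ℓ (QuantumBraid.sigma i))⁻¹ := fun i =>
    QuantumBraid.phi_eq_inv hJW hBW hsepW fun u v => by
      change B (QuantumBraid.repW h ℓ (QuantumBraid.sigma i) u : QuantumBraid.V4l F ℓ) v =
        B u (QuantumBraid.repW h ℓ (QuantumBraid.sigma i) v : QuantumBraid.V4l F ℓ)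
      rw [QuantumBraid.coe_repW, QuantumBraid.coe_repW, QuantumBraid.repV_sigma]
      exact QuantumBraid.formV_sigmaV h ht ℓ i u v
  have hpsi : QuantumBraid.phiPSL bW JW * QuantumBraid.phiPSL bW JW = 1 :=
    QuantumBraid.phiPSL_mul_self hJW hBW hsepW
  have hpsi_sigma : ∀ i : Fin 3, QuantumBraid.phiPSL bW JW *
      QuantumBraid.conjPSL (QuantumBraid.repW h ℓ (QuantumBraid.sigma i)) *
        (QuantumBraid.phiPSL bW JW)⁻¹ =
      (QuantumBraid.conjPSL (QuantumBraid.repW h ℓ (QuantumBraid.sigma i)))⁻¹ := fun i => by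
    rw [QuantumBraid.phiPSL_conj, hphiW, map_inv]
  refine ⟨QuantumBraid.repV h ℓ, QuantumBraid.incl_repV_sigma h ℓ, QuantumBraid.repW h ℓ,
    QuantumBraid.coe_repW h ℓ, fun z hz => QuantumBraid.repW_center h ℓ hz, J, fun hF => ?_,
    fun i => QuantumBraid.conj_transpose_of_phi_eq_inv (hphi i), hphi, fun i => ?_,
    B.orthogonal W, ?_, ?_, QuantumBraid.phiPSL bW JW, ?_, hpsi, fun hℓ => ?_, hpsi_sigma, ?_⟩
  · exact (Matrix.det_diagonal).trans (hdet hF)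
  · rw [QuantumBraid.phiPSL_conj, hphi, map_inv]
  · exact LinearMap.BilinForm.isCompl_orthogonal_of_restrict_nondegenerate hB.isRefl hndW
  · refine QuantumBraid.rep_mem_of_sigma_mem _ fun i c hc => ?_
    -- Applied to the inverse braid, since $\varphi(\sigma_i^{-1})=\sigma_i$.
    have h1 := QuantumBraid.phi_mem_orthogonal hJ hB
      (QuantumBraid.repV_mem_W4l h ℓ (QuantumBraid.sigma i)⁻¹) c hc
    rwa [map_inv, map_inv, hphi, inv_inv] at h1
  · intro A g hA hg
    refine ⟨QuantumBraid.phi_mem_orthogonal hJ hB fun w hw => ?_, QuantumBraid.phiSL bW JW A,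
      fun w => ?_, rfl⟩
    · rw [hA ⟨w, hw⟩]
      exact Subtype.coe_prop _
    · exact QuantumBraid.phi_restrict hJ hB hnd hJW hsepW (A := A.1) hA hg w
  · exact QuantumBraid.phiPSL_ne_one hJW hBW hsepW (QuantumBraid.two_le_finrank_W4l h hℓ)
  · refine QuantumBraid.exists_extension
      (QuantumBraid.conjPSL.comp (QuantumBraid.repW h ℓ)) _ hpsi ?_ hpsi_sigma
    obtain ⟨c, -, hc⟩ := QuantumBraid.repW_full_twist h ℓ
    exact QuantumBraid.conjPSL_eq_one hc
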